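/- Let $\mathbb K$ be a local field (a field with a non-trivial absolute value for which it is complete and locally compact), $V=\mathbb K^4$, and let $\mathcal I$ be the spherical building of $\mathrm{PGL}_4$ over $\mathbb K$: its vertices are the proper nonzero linear subspaces of $V$ (points, lines and planes of $\mathbb P(V)$), its simplices are the flags, and its vertex set carries the topology of the disjoint union of the Grassmannians $\mathrm{Gr}_1(V),\mathrm{Gr}_2(V),\mathrm{Gr}_3(V)$. The apartment of a basis $(b_1,\dots,b_4)$ of $V$ is the subcomplex of all flags of subspaces spanned by basis vectors. Fix such an apartment $\mathcal A$. Let $\mathrm{Mor}(\mathcal A,\mathcal I)$ be the space of type-preserving simplicial maps $f:\mathcal A\to\mathcal I$, with the topology of convergence on all chambers (equivalently, on all vertices), and let $\overline{\mathrm{Mor}_{inj}(\mathcal A,\mathcal I)}$ be the closure in it of the set of marked apartments, i.e. of the morphisms whose image is an apartment. For $f\in\mathrm{Mor}(\mathcal A,\mathcal I)$ write $x_i=f(\langle b_i\rangle)$, $\ell_{ij}=f(\langle b_i,b_j\rangle)$ and $p_i=f(\langle b_j:j\ne i\rangle)$. The morphism $f$ is of type (L) if the six lines $\ell_{ij}$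 are equal, to a line $\ell$ say. It is then called symmetric if at least three of the four points $x_i$ coincide, or at least three of the four planes $p_i$ coincide, or the cross-ratio of $(x_1,x_2,x_3,x_4)$ on $\ell$ is equal to the cross-ratio of $(p_1,p_2,p_3,p_4)$ on the projective line $\ell^\perp\subset\mathbb P(V^*)$. Here the cross-ratio of four points of a projective line, no three of which coincide, with homogeneous coordinates $u_1,\dots,u_4\in\mathbb K^2$, is the element $\dfrac{\det(u_4,u_2)\det(u_3,u_1)}{\det(u_4,u_1)\det(u_3,u_2)}$ of $\mathbb K\cup\{\infty\}$. The morphism $f$ is of type (XP) if the four points $x_i$ are equal, to $x$ say, and the four planes $p_i$ are equal, to $p$ say. It is then called symmetric if there are three distinct, pairwise intersecting two-element subsets $a,b,c$ of $\{1,2,3,4\}$ with $\ell_a=\ell_b=\ell_c$, or if there is an involution $s$ of the projective line $\{\ell : x\subset\ell\subset p\}$ such that $s(\ell_a)=\ell_{\{1,2,3,4\}\setminus a}$ for each two-element subset $a$ of $\{1,2,3,4\}$. Here an involution is a projective transformation $s$ with $s\circ s=\mathrm{id}$ and, if the characteristic of $\mathbb K$ is not $2$, $s\neq\mathrm{id}$.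 Theorem. Every $f\in\mathrm{Mor}(\mathcal A,\mathcal I)$ that is neither of type (L) nor of type (XP) belongs to $\overline{\mathrm{Mor}_{inj}(\mathcal A,\mathcal I)}$. A morphism of type (L) belongs to $\overline{\mathrm{Mor}_{inj}(\mathcal A,\mathcal I)}$ if and only if it is symmetric, and a morphism of type (XP) belongs to $\overline{\mathrm{Mor}_{inj}(\mathcal A,\mathcal I)}$ if and only if it is symmetric. -/

import Mathlib

open Module

namespace Building

/-- A vertex of the spherical building of complete flags of `K⁴`: a proper nonzero linear subspace
of `K⁴`, i.e. a point, a line or a plane of the projective space `ℙ³(K)`. -/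
@[ext]
structure Vertex (K : Type*) [Field K] where
  carrier : Submodule K (Fin 4 → K)
  ne_bot : carrier ≠ ⊥
  ne_top : carrier ≠ ⊤

/-- The type of a vertex: the dimension of the linear subspace
(1 for points, 2 for lines, 3 for planes). -/
noncomputable def Vertex.type {K : Type*} [Field K] (v : Vertex K) : ℕ := finrank K v.carrier

/-- The subspace spanned by one, two or three linearly independent vectors, as a vertex. -/
def vertexOfFrame (K : Type*) [Field K] :
    (Σ k : Fin 3, {u : Fin (k.val + 1) → (Fin 4 → K) // LinearIndependent K u}) → Vertex K :=
  fun u =>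
    { carrier := Submodule.span K (Set.range u.2.1)
      ne_bot := by
        intro h
        have h1 := finrank_span_eq_card u.2.2
        rw [h, finrank_bot, Fintype.card_fin] at h1
        omega
      ne_top := by
        intro h
        have h1 := finrank_span_eq_card u.2.2
        rw [h, finrank_top, Fintype.card_fin, finrank_fintype_fun_eq_card, Fintype.card_fin] at h1
        have := u.1.isLt
        omega }

/-- The set of vertices is the disjoint union of the Grassmannians `Gr₁(K⁴)`, `Gr₂(K⁴)`, `Gr₃(K⁴)`,
each with its usual topology, the quotient topology from the space of linearly independent
`k`-tuples of vectors. -/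
instance (K : Type*) [Field K] [TopologicalSpace K] : TopologicalSpace (Vertex K) :=
  TopologicalSpace.coinduced (vertexOfFrame K) inferInstance

/-- The spherical building of `K⁴`, as a simplicial complex: its simplices are the flags. -/
def building (K : Type*) [Field K] : AbstractSimplicialComplex (Vertex K) where
  faces := {σ | σ.Nonempty ∧
    IsChain (fun v w : Vertex K => v.carrier ≤ w.carrier) (σ : Set (Vertex K))}
  isRelLowerSet_faces := fun {_} hσ =>
    ⟨hσ.1, fun _ hτσ hτ => ⟨hτ, hσ.2.mono (Finset.coe_subset.mpr hτσ)⟩⟩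
  singleton_mem := fun v => ⟨Finset.singleton_nonempty v, by simp⟩

/-- The apartment of a basis `b` of `K⁴`: the subcomplex of all flags consisting of subspaces that
are spanned by elements of the basis. -/
def apartment {K : Type*} [Field K] (b : Basis (Fin 4) K (Fin 4 → K)) :
    PreAbstractSimplicialComplex (Vertex K) where
  faces := {σ | σ ∈ (building K).faces ∧
    ∀ v ∈ σ, ∃ S : Finset (Fin 4), v.carrier = Submodule.span K (b '' (S : Set (Fin 4)))}
  isRelLowerSet_faces := fun {_} hσ =>
    ⟨hσ.1.1, fun _ hτσ hτ =>
      ⟨((building K).isRelLowerSet_faces hσ.1).2 hτσ hτ, fun v hv => hσ.2 v (hτσ hv)⟩⟩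

/-- The apartments of the building are the subcomplexes given by bases of `K⁴`. -/
def IsApartment {K : Type*} [Field K] (A : PreAbstractSimplicialComplex (Vertex K)) : Prop :=
  ∃ b : Basis (Fin 4) K (Fin 4 → K), A = apartment b

open Classical in
/-- `Mor(A, I)`: the type-preserving simplicial maps from a subcomplex `A` to the building. -/
@[ext]
structure Mor {K : Type*} [Field K] (A : PreAbstractSimplicialComplex (Vertex K)) where
  toFun : {v : Vertex K // {v} ∈ A.faces} → Vertex K
  type_eq : ∀ v, (toFun v).type = v.1.type
  map_face : ∀ σ : Finset {v : Vertex K // {v} ∈ A.faces},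
    σ.map (Function.Embedding.subtype _) ∈ A.faces → σ.image toFun ∈ (building K).faces

/-- The topology of `Mor(A, I)`: a chamber is the tuple of its vertices and every vertex of an
apartment lies in a chamber, so convergence on all chambers is convergence on all vertices. -/
instance {K : Type*} [Field K] [TopologicalSpace K] (A : PreAbstractSimplicialComplex (Vertex K)) :
    TopologicalSpace (Mor A) :=
  TopologicalSpace.induced Mor.toFun inferInstance

open Classical in
/-- A marked apartment: a morphism whose image (as a simplicial complex) is an apartment. -/
def Mor.IsMarkedApartment {K : Type*} [Field K] {A : PreAbstractSimplicialComplex (Vertex K)}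
    (f : Mor A) : Prop :=
  ∃ B : PreAbstractSimplicialComplex (Vertex K), IsApartment B ∧
    B.faces = {τ | ∃ σ : Finset {v : Vertex K // {v} ∈ A.faces},
      σ.map (Function.Embedding.subtype _) ∈ A.faces ∧ τ = σ.image f.toFun}

/-- The vertex `⟨b i : i ∈ S⟩` of the apartment of `b`, for a proper nonempty set `S` of indices. -/
def frameVertex {K : Type*} [Field K] (b : Basis (Fin 4) K (Fin 4 → K)) (S : Finset (Fin 4))
    (hS : S.Nonempty ∧ S ≠ Finset.univ) : {v : Vertex K // {v} ∈ (apartment b).faces} :=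
  ⟨{ carrier := Submodule.span K (b '' (S : Set (Fin 4)))
     ne_bot := by
       obtain ⟨i, hi⟩ := hS.1
       intro h
       rw [Submodule.span_eq_bot] at h
       exact b.ne_zero i (h _ ⟨i, hi, rfl⟩)
     ne_top := by
       intro h
       apply hS.2
       ext i
       have hi : b i ∈ Submodule.span K (b '' (S : Set (Fin 4))) := h ▸ Submodule.mem_top
       simpa using b.self_mem_span_image.mp hi },
   ⟨(building K).singleton_mem _, fun v hv => ⟨S, by rw [Finset.mem_singleton.mp hv]⟩⟩⟩

section Labels

variable {K : Type*} [Field K] {b : Basis (Fin 4) K (Fin 4 → K)}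

/-- The two-element subsets of the index set. -/
abbrev Pair : Type := {a : Finset (Fin 4) // a.card = 2}

/-- The complementary pair. -/
def Pair.compl (a : Pair) : Pair := ⟨a.1ᶜ, by rw [Finset.card_compl, a.2]; rfl⟩

/-- The point `x_i = f(⟨b i⟩)`. -/
def Mor.point (f : Mor (apartment b)) (i : Fin 4) : Vertex K :=
  f.toFun (frameVertex b {i} ⟨Finset.singleton_nonempty i, by
    intro h; simpa using congrArg Finset.card h⟩)

/-- The line `ℓ_a = f(⟨b i, b j⟩)` for the pair `a = {i, j}`. -/
def Mor.line (f : Mor (apartment b)) (a : Pair) : Vertex K :=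
  f.toFun (frameVertex b a.1 ⟨Finset.card_pos.mp (by rw [a.2]; norm_num), by
    intro h; simpa [a.2] using congrArg Finset.card h⟩)

/-- The plane `p_i = f(⟨b j : j ≠ i⟩)`. -/
def Mor.plane (f : Mor (apartment b)) (i : Fin 4) : Vertex K :=
  f.toFun (frameVertex b {i}ᶜ ⟨Finset.card_pos.mp (by rw [Finset.card_compl]; simp), by
    intro h; simpa [Finset.card_compl] using congrArg Finset.card h⟩)

/-- Type (L): all six lines are equal. -/
def Mor.IsTypeL (f : Mor (apartment b)) : Prop :=
  ∃ l : Vertex K, ∀ a, f.line a = l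

/-- All four points are equal to `x` and all four planes are equal to `p`. -/
def Mor.HasPointPlane (f : Mor (apartment b)) (x p : Vertex K) : Prop :=
  ∀ i, f.point i = x ∧ f.plane i = p

/-- Type (XP): all four points are equal and all four planes are equal. -/
def Mor.IsTypeXP (f : Mor (apartment b)) : Prop :=
  ∃ x p : Vertex K, f.HasPointPlane x p

end Labels

section CrossRatio

variable {K : Type*} [Field K]

/-- At least three of four objects coincide. -/
def ThreeCoincide {X : Type*} (y : Fin 4 → X) : Prop :=
  ∃ i j k : Fin 4, i ≠ j ∧ j ≠ k ∧ i ≠ k ∧ y i = y j ∧ y j = y k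

/-- The determinant of two vectors of `K²`. -/
def bracket (u v : Fin 2 → K) : K := u 0 * v 1 - u 1 * v 0

open Classical in
/-- The cross-ratio, in `K ∪ {∞}`, of the four points of the projective line with homogeneous
coordinates `u 0, u 1, u 2, u 3`, no three of which coincide. If the first three points are
distinct, it is the image of the fourth one under the homography that maps them to `∞, 0, 1`. -/
noncomputable def crossRatio (u : Fin 4 → Fin 2 → K) : OnePoint K :=
  if bracket (u 3) (u 0) * bracket (u 2) (u 1) = 0 then OnePoint.infty
  else ((bracket (u 3) (u 1) * bracket (u 2) (u 0) /
    (bracket (u 3) (u 0) * bracket (u 2) (u 1)) : K) : OnePoint K)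

/-- `y 0, y 1, y 2, y 3` are four points, no three of which coincide, of a projective line in
`ℙ(E)` (which is parametrised by an injective linear map `K² → E`), with cross-ratio `c`. -/
def HasCrossRatio {E : Type*} [AddCommGroup E] [Module K E] (y : Fin 4 → Submodule K E)
    (c : OnePoint K) : Prop :=
  ¬ ThreeCoincide y ∧
  ∃ (φ : (Fin 2 → K) →ₗ[K] E) (u : Fin 4 → Fin 2 → K), Function.Injective φ ∧
    (∀ i, u i ≠ 0 ∧ y i = Submodule.span K {φ (u i)}) ∧ c = crossRatio u

/-- Symmetry of a morphism of type (L): three of the points coincide, or three of the planes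
coincide, or the cross-ratio of the points on the common line is equal to the cross-ratio of the
planes, seen as points of `ℙ(V*)` on the projective line of the planes through the common line. -/
def Mor.IsSymmetricL {b : Basis (Fin 4) K (Fin 4 → K)} (f : Mor (apartment b)) : Prop :=
  ThreeCoincide f.point ∨ ThreeCoincide f.plane ∨
  ∃ c : OnePoint K, HasCrossRatio (fun i => (f.point i).carrier) c ∧
    HasCrossRatio (fun i => (f.plane i).carrier.dualAnnihilator) c

end CrossRatio

section Involution

variable {K : Type*} [Field K]

/-- The projective line of all lines through the point `x` in the plane `p`. -/
def pencil (x p : Vertex K) : Set (Submodule K (Fin 4 → K)) :=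
  {l | finrank K l = 2 ∧ x.carrier ≤ l ∧ l ≤ p.carrier}

/-- `g` induces an involution of the projective line of all lines through `x` in `p`. (Every
projectivity of this line is induced by some `g`.) An involution is a projectivity of square the
identity and, if the characteristic is not 2, different from the identity. -/
structure InducesInvolution (x p : Vertex K) (g : (Fin 4 → K) ≃ₗ[K] (Fin 4 → K)) : Prop where
  map_mem : ∀ l ∈ pencil x p, l.map g.toLinearMap ∈ pencil x p
  map_map : ∀ l ∈ pencil x p, (l.map g.toLinearMap).map g.toLinearMap = l
  ne_id : (2 : K) ≠ 0 → ∃ l ∈ pencil x p, l.map g.toLinearMap ≠ l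

/-- Symmetry of a morphism of type (XP): three lines indexed by distinct pairwise intersecting
pairs are equal, or an involution of the projective line of all lines through the common point in
the common plane exchanges opposite lines. -/
def Mor.IsSymmetricXP {b : Basis (Fin 4) K (Fin 4 → K)} (f : Mor (apartment b)) : Prop :=
  (∃ a₁ a₂ a₃ : Pair, a₁ ≠ a₂ ∧ a₂ ≠ a₃ ∧ a₁ ≠ a₃ ∧
    (a₁.1 ∩ a₂.1).Nonempty ∧ (a₂.1 ∩ a₃.1).Nonempty ∧ (a₁.1 ∩ a₃.1).Nonempty ∧
    f.line a₁ = f.line a₂ ∧ f.line a₂ = f.line a₃) ∨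
  ∃ x p : Vertex K, f.HasPointPlane x p ∧
    ∃ g : (Fin 4 → K) ≃ₗ[K] (Fin 4 → K), InducesInvolution x p g ∧
      ∀ a : Pair, (f.line a).carrier.map g.toLinearMap = (f.line a.compl).carrier

end Involution

end Building

/-!
A morphism from the apartment of a basis is a family of subspaces `F S` of `K⁴`, for `S` a set of
indices, which is increasing and satisfies `dim F S = |S|` (`Family`, `IsConfig`); the marked
apartments are the families of spans of the subsets of a basis (`frameFamilies`). In this form,
duality is `F ↦ (S ↦ (F Sᶜ)⊥)`, and a permutation of the indices acts by relabelling. Since a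
closure is stable under limits, it suffices to move a family slightly, through families of the same
kind, to one for which the claim is known (`IsConfig.mem_closure_of_movePoint`,
`IsConfig.mem_closure_of_pencil`).

Every type-preserving image of a triangle in a plane is a limit of triangles
(`triangle_mem_closure`). Therefore a family is a limit of apartments as soon as one of its points
is outside of the opposite plane: it is a cone over such an image. It is also one if one of the
points is on none of the three lines opposite to it, as this point can then be moved out of the
plane (`mem_closure_of_notMem_lines`). If this never applies, and the points are not all equal, then
all points lie on one line `m` and all planes contain it. If some line differs from `m`, then up to
small movements there are only two kinds of families left, with one or two lines different from `m`,
and for these the apartments converging to them can be written down (`OneLine.mem_closure`,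
`mem_closure_of_two_lines`). This covers the families whose
points are not all equal and whose lines are not all equal (`mem_closure_of_points_ne`) and, by
duality, those whose planes are not all equal and whose lines are not all equal
(`mem_closure_of_planes_ne`). Only the types (L) and (XP) are left.

If all lines are equal to `ℓ`, let `u i ∈ K²` be the coordinates of the points on `ℓ` and `n i ∈ K²`
those of the planes as vectors modulo `ℓ`. The cross-ratios of points and planes agree if and only
if the four tensors `u i ⊗ n i` are linearly dependent (up to the cases of three equal points or
planes), that is, if `crossDet u n = 0`. This is necessary: for a basis with points `⟨c i⟩` and dual
basis `d i`, the identity is the sum of the tensors `c i ⊗ d i`, and those of its components that map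
a fixed complement of `ℓ` to `ℓ` vanish. So the corresponding components of the four tensors are
linearly dependent, which is a closed condition (`crossDet_eq_zero_of_mem_closure`). Conversely, four distinct points of `ℓ` can
be moved out of `ℓ` with velocities for which the planes tend to the given ones
(`lineFamily_mem_closure_of_distinct`), and the other configurations are limits of these or have
been treated before (`lineFamily_mem_closure_of_crossDet`).

If all points are equal to `x` and all planes to `p`, the lines are six directions in an affine
plane. If there are four points of this plane, not all equal, that are joined by lines in these
directions (`IsShift`), then contracting them to `x` shows that the family is a limit of families
whose points are not all equal (`pencilFamily_mem_closure`). Such points exist if three directions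
with pairwise intersecting labels agree, or if opposite directions are orthogonal for a
nondegenerate symmetric bilinear form (`exists_isShift_of_symForm`). Such forms are the involutions
of the pencil (`exists_symForm_of_inducesInvolution`, `exists_inducesInvolution`): `s` is the
involution that sends a direction to its orthogonal. In the other direction, the three-term Plücker
relation for the projection of a basis to `p` is a linear relation between the three products of
opposite minors. Hence opposite lines are orthogonal for some nonzero symmetric form, which is again
a closed condition (`involutionDet_minors`, `exists_symForm_of_mem_closure`). If the form is
degenerate, it is the square of a linear form up to a factor, so that one line of each opposite pair
is equal to its kernel, and the labels of such lines form a star or a triangle.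
-/


namespace Building

open Filter Topology

/-! ### Topology of the Grassmannians -/

section Grassmannian

variable {K : Type*} [NontriviallyNormedField K]

/-- The subspace spanned by a linearly independent tuple of vectors. -/
def spanFrame (K : Type*) [Field K] :
    (Σ k : ℕ, {u : Fin k → (Fin 4 → K) // LinearIndependent K u}) → Submodule K (Fin 4 → K) :=
  fun u => Submodule.span K (Set.range u.2.1)

/-- The disjoint union of the Grassmannians of all dimensions `0, …, 4`, topologised like the set
of vertices of the building; including `⊥` and `⊤` makes families of subspaces indexed by all
subsets of the index set available. -/
instance : TopologicalSpace (Submodule K (Fin 4 → K)) :=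
  TopologicalSpace.coinduced (spanFrame K) inferInstance

lemma continuous_spanFrame : Continuous (spanFrame K) := continuous_coinduced_rng

lemma exists_frame {U : Submodule K (Fin 4 → K)} {k : ℕ} (h : finrank K U = k) :
    ∃ u : Fin k → (Fin 4 → K), LinearIndependent K u ∧ Submodule.span K (Set.range u) = U := by
  let b := finBasisOfFinrankEq K U h
  refine ⟨fun i => (b i : Fin 4 → K),
    b.linearIndependent.map' U.subtype (Submodule.ker_subtype U), ?_⟩
  have h1 : (fun i => (b i : Fin 4 → K)) = U.subtype ∘ b := rfl
  rw [h1, Set.range_comp, ← Submodule.map_span, b.span_eq, Submodule.map_top,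
    Submodule.range_subtype]

lemma exists_frame' (U : Submodule K (Fin 4 → K)) : ∃ (k : ℕ) (u : Fin k → (Fin 4 → K)),
    LinearIndependent K u ∧ Submodule.span K (Set.range u) = U :=
  ⟨_, exists_frame rfl⟩

variable [CompleteSpace K]

/-- Two frames of the same subspace differ by a matrix, and the same matrix, applied to frames of
nearby subspaces, does not change these subspaces. -/
lemma isOpenMap_spanFrame : IsOpenMap (spanFrame K) := by
  intro O hO
  rw [isOpen_coinduced, isOpen_sigma_iff]
  intro k
  rw [isOpen_iff_mem_nhds]
  rintro ⟨u, hu⟩ ⟨⟨k', u', hu'⟩, hO', he⟩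
  have hkk : k' = k := by
    have h1 := finrank_span_eq_card hu
    have h2 := finrank_span_eq_card hu'
    simp only [Fintype.card_fin] at h1 h2
    rw [← h1, ← h2]
    exact congrArg (fun W : Submodule K (Fin 4 → K) => finrank K W) he
  subst hkk
  simp only [spanFrame] at he
  have hM : ∀ i, ∃ c : Fin k' → K, ∑ j, c j • u j = u' i := fun i =>
    Submodule.mem_span_range_iff_exists_fun K |>.mp (he ▸ Submodule.subset_span ⟨i, rfl⟩)
  choose M hM using hM
  let T : {u : Fin k' → (Fin 4 → K) // LinearIndependent K u} → Fin k' → (Fin 4 → K) :=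
    fun w i => ∑ j, M i j • w.1 j
  have hT₀ : ∀ i j, Continuous fun w : {u : Fin k' → (Fin 4 → K) // LinearIndependent K u} =>
      M i j • w.1 j := fun i j =>
    ((continuous_apply j).comp continuous_subtype_val).const_smul (M i j)
  have hT : Continuous T := continuous_pi fun i => continuous_finsetSum _ fun j _ => hT₀ i j
  have hTu : T ⟨u, hu⟩ = u' := funext hM
  obtain ⟨O1, hO1, hO1'⟩ := isOpen_induced_iff.mp (isOpen_sigma_iff.mp hO k')
  have hu1 : u' ∈ O1 := by
    have : (⟨u', hu'⟩ : {u : Fin k' → (Fin 4 → K) // LinearIndependent K u}) ∈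
      Subtype.val ⁻¹' O1 := by rw [hO1']; exact hO'
    exact this
  have hnear : ∀ᶠ w in 𝓝 (⟨u, hu⟩ : {u : Fin k' → (Fin 4 → K) // LinearIndependent K u}),
      T w ∈ O1 ∩ {v | LinearIndependent K v} :=
    hT.continuousAt.eventually_mem ((hO1.inter isOpen_setOfPred_linearIndependent).mem_nhds
      (by rw [hTu]; exact ⟨hu1, hu'⟩))
  filter_upwards [hnear] with w hw
  refine ⟨⟨k', T w, hw.2⟩, ?_, ?_⟩
  · have : (⟨T w, hw.2⟩ : {u : Fin k' → (Fin 4 → K) // LinearIndependent K u}) ∈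
      Subtype.val ⁻¹' O1 := hw.1
    rw [hO1'] at this
    exact this
  · have h2 : LinearIndependent K (T w) := hw.2
    change Submodule.span K (Set.range (T w)) = Submodule.span K (Set.range w.1)
    refine Submodule.eq_of_le_of_finrank_le (Submodule.span_le.mpr ?_) ?_
    · rintro _ ⟨i, rfl⟩
      exact Submodule.sum_mem _ fun j _ =>
        Submodule.smul_mem _ _ (Submodule.subset_span (Set.mem_range_self j))
    · exact ((finrank_span_eq_card w.2).trans (finrank_span_eq_card h2).symm).le

lemma nhds_span {k : ℕ} {u : Fin k → (Fin 4 → K)} (hu : LinearIndependent K u) :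
    𝓝 (Submodule.span K (Set.range u)) =
      map (fun w : {w : Fin k → (Fin 4 → K) // LinearIndependent K w} =>
        Submodule.span K (Set.range w.1)) (𝓝 ⟨u, hu⟩) := by
  have h := isOpenMap_spanFrame.map_nhds_eq (f := spanFrame K) (x := ⟨k, u, hu⟩)
    continuous_spanFrame.continuousAt
  rw [Sigma.nhds_mk, map_map] at h
  exact h.symm

lemma eventually_finrank_eq (U : Submodule K (Fin 4 → K)) :
    ∀ᶠ W : Submodule K (Fin 4 → K) in 𝓝 U, finrank K W = finrank K U := by
  obtain ⟨k, u, hu, rfl⟩ := exists_frame' U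
  rw [nhds_span hu, eventually_map]
  exact .of_forall fun w => by rw [finrank_span_eq_card w.2, finrank_span_eq_card hu]

/-- Subspaces `U t` of dimension at most `k` that contain the terms of a `k`-tuple converge if
this tuple converges to a basis of the limit. -/
lemma tendsto_of_frame {T : Type*} {l : Filter T} {k : ℕ} {U : T → Submodule K (Fin 4 → K)}
    {U₀ : Submodule K (Fin 4 → K)} (u : T → Fin k → (Fin 4 → K)) (u₀ : Fin k → (Fin 4 → K))
    (hu : Tendsto u l (𝓝 u₀)) (hmem : ∀ᶠ t in l, ∀ j, u t j ∈ U t)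
    (hdim : ∀ᶠ t in l, finrank K (U t) ≤ k) (h₀ : U₀ ≤ Submodule.span K (Set.range u₀))
    (hdim₀ : finrank K U₀ = k) : Tendsto U l (𝓝 U₀) := by
  have hle : finrank K (Submodule.span K (Set.range u₀)) ≤ k :=
    (finrank_range_le_card (R := K) u₀).trans_eq (Fintype.card_fin k)
  obtain rfl := Submodule.eq_of_le_of_finrank_le h₀ (hle.trans hdim₀.ge)
  have hli : LinearIndependent K u₀ := by
    rw [linearIndependent_iff_card_eq_finrank_span, Fintype.card_fin]
    exact hdim₀.symm
  have hev : ∀ᶠ t in l, LinearIndependent K (u t) :=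
    hu.eventually_mem (isOpen_setOfPred_linearIndependent.mem_nhds hli)
  have hEq : ∀ᶠ t in l, Submodule.span K (Set.range (u t)) = U t := by
    filter_upwards [hev, hmem, hdim] with t h1 h2 h3
    refine Submodule.eq_of_le_of_finrank_le (Submodule.span_le.mpr ?_) ?_
    · rintro _ ⟨j, rfl⟩
      exact h2 j
    · rw [finrank_span_eq_card h1, Fintype.card_fin]
      exact h3
  refine Tendsto.congr' hEq ?_
  rw [nhds_span hli]
  intro s hs
  rw [mem_map] at hs ⊢
  obtain ⟨O, hO, hOs⟩ := mem_nhds_subtype _ _ _ |>.mp hs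
  filter_upwards [hev, hu hO] with t h1 h2
  exact hOs (show (⟨u t, h1⟩ : {w : Fin k → (Fin 4 → K) // LinearIndependent K w}) ∈ _ from h2)

lemma tendsto_sup_right {T : Type*} {l : Filter T} {U W : T → Submodule K (Fin 4 → K)}
    {U₀ W₀ : Submodule K (Fin 4 → K)} (hU : Tendsto U l (𝓝 U₀)) (hW : Tendsto W l (𝓝 W₀))
    (hd : Disjoint U₀ W₀) : Tendsto (fun t => U t ⊔ W t) l (𝓝 (U₀ ⊔ W₀)) := by
  suffices h : Tendsto (fun p : Submodule K (Fin 4 → K) × Submodule K (Fin 4 → K) => p.1 ⊔ p.2)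
      (𝓝 U₀ ×ˢ 𝓝 W₀) (𝓝 (U₀ ⊔ W₀)) from
    Tendsto.comp (f := fun t => (U t, W t)) h (hU.prodMk hW)
  obtain ⟨k, u, hu, rfl⟩ := exists_frame' U₀
  obtain ⟨m, w, hw, rfl⟩ := exists_frame' W₀
  rw [nhds_span hu, nhds_span hw, prod_map_map_eq, tendsto_map'_iff]
  have hk := finrank_span_eq_card hu
  have hm := finrank_span_eq_card hw
  have hs := Submodule.finrank_sup_add_finrank_inf_eq (Submodule.span K (Set.range u))
    (Submodule.span K (Set.range w))
  rw [hd.eq_bot, finrank_bot, hk, hm, Fintype.card_fin, Fintype.card_fin, add_zero] at hs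
  have hr : ∀ (f : Fin k → (Fin 4 → K)) (g : Fin m → (Fin 4 → K)),
      Set.range (Fin.append f g) = Set.range f ∪ Set.range g := by
    intro f g
    ext z
    simp only [Set.mem_range, Set.mem_union]
    constructor
    · rintro ⟨i, rfl⟩
      refine Fin.addCases (fun i => ?_) (fun i => ?_) i
      · left; exact ⟨i, by simp⟩
      · right; exact ⟨i, by simp⟩
    · rintro (⟨i, rfl⟩ | ⟨i, rfl⟩)
      · exact ⟨Fin.castAdd m i, by simp⟩
      · exact ⟨Fin.natAdd k i, by simp⟩
  refine tendsto_of_frame (k := k + m) (fun p => Fin.append p.1.1 p.2.1) (Fin.append u w)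
    ?_ ?_ ?_ ?_ hs
  · rw [tendsto_pi_nhds]
    intro i
    refine Fin.addCases (fun i => ?_) (fun i => ?_) i
    · simp only [Fin.append_left]
      exact (((continuous_apply i).comp continuous_subtype_val).tendsto (⟨u, hu⟩ :
        {u : Fin k → (Fin 4 → K) // LinearIndependent K u})).comp tendsto_fst
    · simp only [Fin.append_right]
      exact (((continuous_apply i).comp continuous_subtype_val).tendsto (⟨w, hw⟩ :
        {u : Fin m → (Fin 4 → K) // LinearIndependent K u})).comp tendsto_snd
  · refine .of_forall fun p j => ?_
    have : Fin.append p.1.1 p.2.1 j ∈ Submodule.span K (Set.range p.1.1 ∪ Set.range p.2.1) :=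
      Submodule.subset_span (by rw [← hr]; exact ⟨j, rfl⟩)
    rwa [Submodule.span_union] at this
  · refine .of_forall fun p => ?_
    refine (Submodule.finrank_add_le_finrank_add_finrank _ _).trans ?_
    simp only [finrank_span_eq_card p.1.2, finrank_span_eq_card p.2.2, Fintype.card_fin, le_refl]
  · rw [hr, Submodule.span_union]

/-- A line through the origin spanned by a vector depending continuously on a parameter. -/
lemma tendsto_span_singleton {T : Type*} {l : Filter T} {v : T → (Fin 4 → K)} {v₀ : Fin 4 → K}
    (h : Tendsto v l (𝓝 v₀)) (h₀ : v₀ ≠ 0) :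
    Tendsto (fun t => Submodule.span K {v t}) l (𝓝 (Submodule.span K {v₀})) := by
  refine tendsto_of_frame (k := 1) (fun t _ => v t) (fun _ => v₀) (tendsto_pi_nhds.mpr fun _ => h)
    (.of_forall fun t _ => Submodule.mem_span_singleton_self _)
    (.of_forall fun t => ?_) ?_ (finrank_span_singleton h₀)
  · simpa using finrank_span_le_card (R := K) ({v t} : Set (Fin 4 → K))
  · simp

end Grassmannian

/-! ### Orthogonal subspaces -/

section Orthogonal

variable {K : Type*}

/-- The orthogonal of a subspace for the standard bilinear form; it is used to identify `K⁴` with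
its dual. -/
def perp [Field K] (U : Submodule K (Fin 4 → K)) : Submodule K (Fin 4 → K) :=
  LinearMap.BilinForm.orthogonal (dotProductBilin K K) U

lemma mem_perp [Field K] {U : Submodule K (Fin 4 → K)} {z : Fin 4 → K} :
    z ∈ perp U ↔ ∀ y ∈ U, y ⬝ᵥ z = 0 := Iff.rfl

lemma dotProductBilin_nondegenerate [Field K] :
    (dotProductBilin K K : LinearMap.BilinForm K (Fin 4 → K)).Nondegenerate := by
  constructor
  · intro z hz
    exact dotProduct_eq_zero z hz
  · intro z hz
    refine dotProduct_eq_zero z fun w => ?_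
    rw [dotProduct_comm]
    exact hz w

lemma dotProductBilin_isRefl [Field K] :
    LinearMap.BilinForm.IsRefl (dotProductBilin K K : LinearMap.BilinForm K (Fin 4 → K)) := by
  intro y z h
  change z ⬝ᵥ y = 0
  rw [dotProduct_comm]
  exact h

lemma finrank_perp [Field K] (U : Submodule K (Fin 4 → K)) :
    finrank K (perp U) = 4 - finrank K U := by
  rw [perp, LinearMap.BilinForm.finrank_orthogonal dotProductBilin_nondegenerate]
  simp

lemma perp_perp [Field K] (U : Submodule K (Fin 4 → K)) : perp (perp U) = U :=
  LinearMap.BilinForm.orthogonal_orthogonal dotProductBilin_nondegenerate dotProductBilin_isRefl U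

lemma perp_le_perp [Field K] {U W : Submodule K (Fin 4 → K)} (h : U ≤ W) : perp W ≤ perp U :=
  fun _ hz y hy => hz y (h hy)

/-- A subspace `g U` with `g` close to the identity has orthogonal `(gᵀ)⁻¹ U⊥`. -/
lemma continuous_perp [NontriviallyNormedField K] [CompleteSpace K] :
    Continuous (perp : Submodule K (Fin 4 → K) → Submodule K (Fin 4 → K)) := by
  rw [continuous_iff_continuousAt]
  intro U
  obtain ⟨k, u, hu, rfl⟩ := exists_frame' U
  obtain ⟨L, hL⟩ := LinearMap.exists_leftInverse_of_injective (Fintype.linearCombination K u)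
    (LinearMap.ker_eq_bot.mpr (linearIndependent_iff_injective_fintypeLinearCombination.mp hu))
  have hLu : ∀ i, L (u i) = Pi.single i 1 := fun i => by
    have := LinearMap.congr_fun hL (Pi.single i 1)
    simpa [Fintype.linearCombination_apply_single] using this
  let A : Matrix (Fin k) (Fin 4) K := LinearMap.toMatrix' L
  have hA : ∀ i, A.mulVec (u i) = Pi.single i 1 := fun i => by
    rw [LinearMap.toMatrix'_mulVec, hLu]
  let G : (Fin k → (Fin 4 → K)) → Matrix (Fin 4) (Fin 4) K :=
    fun w => 1 + (Matrix.of (w - u)).transpose * A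
  have hGu : ∀ w i, (G w).mulVec (u i) = w i := fun w i => by
    simp only [G, Matrix.add_mulVec, Matrix.one_mulVec, ← Matrix.mulVec_mulVec, hA]
    ext a
    simp [Matrix.mulVec_single]
  have hGc : Continuous G := by
    refine continuous_const.add (Continuous.matrix_mul ?_ continuous_const)
    refine Continuous.matrix_transpose ?_
    exact continuous_id.sub continuous_const
  have hG1 : G u = 1 := by simp [G]
  obtain ⟨y, hy, hyU⟩ := exists_frame (K := K) (rfl :
    finrank K (perp (Submodule.span K (Set.range u))) = _)
  rw [ContinuousAt, nhds_span hu, tendsto_map'_iff]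
  refine tendsto_of_frame (fun w j => (G w.1).adjugate.transpose.mulVec (y j)) y ?_ ?_ ?_ hyU.ge rfl
  · rw [tendsto_pi_nhds]
    intro j
    have hc : Continuous fun w : {w : Fin k → (Fin 4 → K) // LinearIndependent K w} =>
        (G w.1).adjugate.transpose.mulVec (y j) :=
      Continuous.matrix_mulVec
        (Continuous.matrix_transpose
          (Continuous.matrix_adjugate (hGc.comp continuous_subtype_val))) continuous_const
    have := hc.tendsto ⟨u, hu⟩
    simpa [hG1] using this
  · refine .of_forall fun w j => ?_
    have hyj : y j ∈ perp (Submodule.span K (Set.range u)) := by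
      rw [← hyU]; exact Submodule.subset_span ⟨j, rfl⟩
    intro z hz
    change z ⬝ᵥ _ = 0
    have hle : Submodule.span K (Set.range w.1) ≤
        LinearMap.ker ((dotProductBilin K K : LinearMap.BilinForm K (Fin 4 → K)).flip
          ((G w.1).adjugate.transpose.mulVec (y j))) := by
      rw [Submodule.span_le]
      rintro _ ⟨i, rfl⟩
      change w.1 i ⬝ᵥ _ = 0
      rw [Matrix.dotProduct_mulVec, Matrix.vecMul_transpose, ← hGu w.1 i, Matrix.mulVec_mulVec,
        Matrix.adjugate_mul, Matrix.smul_mulVec, Matrix.one_mulVec, smul_dotProduct,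
        mem_perp.mp hyj _ (Submodule.subset_span ⟨i, rfl⟩), smul_zero]
    exact hle hz
  · refine .of_forall fun w => ?_
    simp only [Function.comp_apply, finrank_perp, finrank_span_eq_card w.2, finrank_span_eq_card hu,
      le_refl]

end Orthogonal

/-! ### Families of subspaces -/

section Families

variable {K : Type*}

/-- Families of subspaces of `K⁴` indexed by the subsets of the index set. A morphism `f` is
encoded by the family of the subspaces `f(⟨b i : i ∈ S⟩)`, completed by `⊥` and `⊤`. -/
abbrev Family (K : Type*) [Field K] : Type _ := Finset (Fin 4) → Submodule K (Fin 4 → K)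

/-- The restriction of `F` to the subsets of `T` is a type-preserving simplicial map: it preserves
dimensions and inclusions. -/
structure IsConfig [Field K] (T : Finset (Fin 4)) (F : Family K) : Prop where
  finrank_eq : ∀ S ⊆ T, finrank K (F S) = S.card
  mono : ∀ S S', S ⊆ S' → S' ⊆ T → F S ≤ F S'

/-- The families whose restriction to the subsets of `T` consists of the spans of the subfamilies
of a linearly independent family `(c i)_{i ∈ T}`; the values on other subsets are arbitrary. -/
def frameFamilies (K : Type*) [Field K] (T : Finset (Fin 4)) : Set (Family K) :=
  {F | ∃ c : Fin 4 → (Fin 4 → K), LinearIndepOn K c (T : Set (Fin 4)) ∧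
    ∀ S ⊆ T, F S = Submodule.span K (c '' (S : Set (Fin 4)))}

lemma finrank_span_image [Field K] {c : Fin 4 → (Fin 4 → K)} {S : Finset (Fin 4)}
    (hc : LinearIndepOn K c (S : Set (Fin 4))) :
    finrank K (Submodule.span K (c '' (S : Set (Fin 4)))) = S.card := by
  rw [Set.image_eq_range]
  exact (finrank_span_eq_card (R := K) (b := fun i : (S : Set (Fin 4)) => c i) hc).trans (by simp)

lemma finrank_span_image_le [Field K] (c : Fin 4 → (Fin 4 → K)) (S : Finset (Fin 4)) :
    finrank K (Submodule.span K (c '' (S : Set (Fin 4)))) ≤ S.card := by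
  classical
  have := finrank_span_finset_le_card (R := K) (S.image c)
  rw [Finset.coe_image] at this
  exact this.trans Finset.card_image_le

namespace IsConfig

variable [Field K] {T : Finset (Fin 4)} {F : Family K}

lemma mem_frameFamilies (hF : IsConfig T F) {c : Fin 4 → (Fin 4 → K)}
    (hc : LinearIndepOn K c (T : Set (Fin 4))) (h : ∀ i ∈ T, c i ∈ F {i}) :
    F ∈ frameFamilies K T := by
  refine ⟨c, hc, fun S hS => ?_⟩
  refine (Submodule.eq_of_le_of_finrank_le (Submodule.span_le.mpr ?_) ?_).symm
  · rintro _ ⟨i, hi, rfl⟩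
    exact hF.mono {i} S (by simpa using hi) hS (h i (hS hi))
  · rw [hF.finrank_eq S hS, finrank_span_image (hc.mono (by exact_mod_cast hS))]

lemma restrict (hF : IsConfig T F) {T' : Finset (Fin 4)} (h : T' ⊆ T) : IsConfig T' F :=
  ⟨fun S hS => hF.finrank_eq S (hS.trans h), fun S S' hS hS' => hF.mono S S' hS (hS'.trans h)⟩

lemma exists_vec (hF : IsConfig T F) {i : Fin 4} (hi : i ∈ T) :
    ∃ v, v ≠ 0 ∧ F {i} = Submodule.span K {v} := by
  obtain ⟨⟨v, hv⟩, h0, h⟩ := finrank_eq_one_iff'.mp (hF.finrank_eq {i} (by simpa using hi))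
  refine ⟨v, by simpa using h0, le_antisymm (fun w hw => ?_) (by simpa using hv)⟩
  obtain ⟨a, ha⟩ := h ⟨w, hw⟩
  rw [Submodule.mem_span_singleton]
  exact ⟨a, congrArg Subtype.val ha⟩

end IsConfig

lemma frameFamilies_isConfig [Field K] {T : Finset (Fin 4)} {F : Family K}
    (h : F ∈ frameFamilies K T) : IsConfig T F := by
  obtain ⟨c, hc, h⟩ := h
  refine ⟨fun S hS => ?_, fun S S' hS hS' => ?_⟩
  · rw [h S hS, finrank_span_image (hc.mono (by exact_mod_cast hS))]
  · rw [h S (hS.trans hS'), h S' hS']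
    exact Submodule.span_mono (Set.image_mono (by exact_mod_cast hS))

variable [NontriviallyNormedField K]

/-- Limits of points of `closure (frameFamilies K T)` stay there; only the values on the subsets
of `T` matter. -/
lemma mem_closure_of_tendsto_family {T : Finset (Fin 4)} {F : Family K} {X : Type*} {l : Filter X}
    [l.NeBot] (G : X → Family K) (hG : ∀ᶠ t in l, G t ∈ closure (frameFamilies K T))
    (hlim : ∀ S ⊆ T, Tendsto (fun t => G t S) l (𝓝 (F S))) :
    F ∈ closure (frameFamilies K T) := by
  classical
  let ρ : Family K → Family K := fun H S => if S ⊆ T then H S else F S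
  have hρ : Continuous ρ := by
    refine continuous_pi fun S => ?_
    by_cases hS : S ⊆ T
    · simpa only [ρ, hS, if_true] using continuous_apply S
    · simpa only [ρ, hS, if_false] using continuous_const
  have hρG : ∀ᶠ t in l, ρ (G t) ∈ closure (frameFamilies K T) := by
    filter_upwards [hG] with t ht
    refine map_mem_closure hρ ht ?_
    rintro H ⟨c, hc, hH⟩
    exact ⟨c, hc, fun S hS => by simp only [ρ, hS, if_true, hH S hS]⟩
  refine isClosed_closure.mem_of_tendsto (f := fun t => ρ (G t)) ?_ hρG
  rw [tendsto_pi_nhds]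
  intro S
  by_cases hS : S ⊆ T
  · simpa only [ρ, hS, if_true] using hlim S hS
  · simpa only [ρ, hS, if_false] using tendsto_const_nhds

/-- Relabelling the index set. -/
def relabel (σ : Equiv.Perm (Fin 4)) (F : Family K) : Family K := fun S => F (S.map σ.toEmbedding)

lemma relabel_mem_closure {F : Family K} (σ : Equiv.Perm (Fin 4))
    (h : relabel σ F ∈ closure (frameFamilies K Finset.univ)) :
    F ∈ closure (frameFamilies K Finset.univ) := by
  have hc : Continuous (relabel σ.symm : Family K → Family K) :=
    continuous_pi fun S => continuous_apply _
  have h1 : relabel σ.symm (relabel σ F) = F := by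
    funext S
    simp only [relabel, Finset.map_map]
    congr 1
    ext i
    simp
  rw [← h1]
  refine map_mem_closure hc h ?_
  rintro H ⟨c, hcl, hH⟩
  refine ⟨c ∘ σ.symm, ?_, fun S _ => ?_⟩
  · simp only [Finset.coe_univ, linearIndepOn_univ_iff] at hcl ⊢
    exact hcl.comp _ σ.symm.injective
  · simp only [relabel]
    rw [hH _ (Finset.subset_univ _), Finset.coe_map, Set.image_image]
    rfl

lemma IsConfig.relabel {F : Family K} (hF : IsConfig Finset.univ F) (σ : Equiv.Perm (Fin 4)) :
    IsConfig Finset.univ (relabel σ F) :=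
  ⟨fun S _ => by
    change finrank K (F _) = _
    rw [hF.finrank_eq _ (Finset.subset_univ _), Finset.card_map],
  fun S S' h _ => hF.mono _ _ (Finset.map_subset_map.mpr h) (Finset.subset_univ _)⟩

/-- The family obtained by the duality of the projective space, which exchanges points and
planes. -/
def dualFamily (F : Family K) : Family K := fun S => perp (F Sᶜ)

lemma dualFamily_dualFamily (F : Family K) : dualFamily (dualFamily F) = F := by
  funext S
  simp only [dualFamily, compl_compl, perp_perp]

lemma IsConfig.dualFamily {F : Family K} (hF : IsConfig Finset.univ F) :
    IsConfig Finset.univ (dualFamily F) :=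
  ⟨fun S _ => by
    change finrank K (perp (F Sᶜ)) = _
    have := Finset.card_add_card_compl S
    rw [Fintype.card_fin] at this
    rw [finrank_perp, hF.finrank_eq _ (Finset.subset_univ _)]
    omega,
  fun S S' h _ => perp_le_perp (hF.mono _ _ (Finset.compl_subset_compl.mpr h)
    (Finset.subset_univ _))⟩

/-- The dual of the apartment of a basis is the apartment of the dual basis. -/
lemma dualFamily_mem_frameFamilies {F : Family K} (h : F ∈ frameFamilies K Finset.univ) :
    dualFamily F ∈ frameFamilies K Finset.univ := by
  have hD := (frameFamilies_isConfig h).dualFamily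
  choose v hv hF using fun i => hD.exists_vec (Finset.mem_univ i)
  refine hD.mem_frameFamilies (c := v) ?_ fun i _ => by
    rw [hF i]; exact Submodule.mem_span_singleton_self _
  obtain ⟨c, hc, h⟩ := h
  rw [Finset.coe_univ, linearIndepOn_univ_iff] at hc ⊢
  have h0 : ∀ i j, j ≠ i → c j ⬝ᵥ v i = 0 := fun i j hij => by
    have hvi : v i ∈ dualFamily F {i} := by rw [hF i]; exact Submodule.mem_span_singleton_self _
    refine mem_perp.mp hvi (c j) ?_
    rw [h _ (Finset.subset_univ _)]
    exact Submodule.subset_span ⟨j, by simpa using hij, rfl⟩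
  have hspan : Submodule.span K (Set.range c) = ⊤ :=
    hc.span_eq_top_of_card_eq_finrank' (by simp)
  have h1 : ∀ i, c i ⬝ᵥ v i ≠ 0 := fun i hi => by
    apply hv i
    refine dotProduct_eq_zero _ fun w => ?_
    have hle : Submodule.span K (Set.range c) ≤ LinearMap.ker
        ((dotProductBilin K K : (Fin 4 → K) →ₗ[K] (Fin 4 → K) →ₗ[K] K) (v i)) := by
      rw [Submodule.span_le]
      rintro _ ⟨j, rfl⟩
      change v i ⬝ᵥ c j = 0
      rw [dotProduct_comm]
      by_cases hij : j = i
      · rw [hij, hi]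
      · exact h0 i j hij
    exact hle (hspan ▸ Submodule.mem_top)
  rw [Fintype.linearIndependent_iff]
  intro g hg i
  have h2 := congrArg (fun w => c i ⬝ᵥ w) hg
  simp only [dotProduct_sum, dotProduct_smul, dotProduct_zero] at h2
  rw [Finset.sum_eq_single i (fun j _ hj => by rw [h0 j i (Ne.symm hj), smul_zero]) (by simp)] at h2
  exact (mul_eq_zero.mp h2).resolve_right (h1 i)

lemma dualFamily_mem_closure [CompleteSpace K] {F : Family K}
    (h : dualFamily F ∈ closure (frameFamilies K Finset.univ)) :
    F ∈ closure (frameFamilies K Finset.univ) := by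
  have hc : Continuous (dualFamily : Family K → Family K) :=
    continuous_pi fun S => continuous_perp.comp (continuous_apply _)
  rw [← dualFamily_dualFamily F]
  exact map_mem_closure hc h fun H hH => dualFamily_mem_frameFamilies hH

end Families

/-! ### Morphisms as families -/

section Morphisms

variable {K : Type*} [Field K] {b : Basis (Fin 4) K (Fin 4 → K)}

open Classical in
/-- The family of subspaces encoding a morphism defined on the apartment of `b`. -/
noncomputable def Mor.family (f : Mor (apartment b)) :
    Family K := fun S =>
  if h : S.Nonempty ∧ S ≠ Finset.univ then (f.toFun (frameVertex b S h)).carrier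
  else if S = ∅ then ⊥ else ⊤

lemma Mor.family_eq (f : Mor (apartment b)) {S : Finset (Fin 4)}
    (h : S.Nonempty ∧ S ≠ Finset.univ) :
    f.family S = (f.toFun (frameVertex b S h)).carrier := dif_pos h

lemma Mor.family_empty (f : Mor (apartment b)) : f.family ∅ = ⊥ := by
  simp [Mor.family]

lemma Mor.family_univ (f : Mor (apartment b)) : f.family Finset.univ = ⊤ := by
  simp [Mor.family, Finset.univ_eq_empty_iff]

lemma span_basis_image_le_iff {S S' : Finset (Fin 4)} :
    Submodule.span K (b '' (S : Set (Fin 4))) ≤ Submodule.span K (b '' (S' : Set (Fin 4))) ↔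
      S ⊆ S' := by
  constructor
  · intro h i hi
    have : b i ∈ Submodule.span K (b '' (S' : Set (Fin 4))) :=
      h (Submodule.subset_span ⟨i, hi, rfl⟩)
    simpa using b.self_mem_span_image.mp this
  · intro h
    exact Submodule.span_mono (Set.image_mono (by exact_mod_cast h))

lemma frameVertex_surjective (v : {v : Vertex K // {v} ∈ (apartment b).faces}) :
    ∃ (S : Finset (Fin 4)) (h : S.Nonempty ∧ S ≠ Finset.univ), v = frameVertex b S h := by
  obtain ⟨S, hS⟩ := v.2.2 v.1 (Finset.mem_singleton_self _)
  have h : S.Nonempty ∧ S ≠ Finset.univ := by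
    constructor
    · rw [Finset.nonempty_iff_ne_empty]
      rintro rfl
      exact v.1.ne_bot (by simpa using hS)
    · rintro rfl
      exact v.1.ne_top (by simpa [b.span_eq] using hS)
  exact ⟨S, h, Subtype.ext (Vertex.ext hS)⟩

lemma frameVertex_type {S : Finset (Fin 4)} (h : S.Nonempty ∧ S ≠ Finset.univ) :
    (frameVertex b S h).1.type = S.card :=
  finrank_span_image (b.linearIndependent.linearIndepOn _)

lemma Mor.isConfig_family (f : Mor (apartment b)) : IsConfig Finset.univ f.family := by
  classical
  have hdim : ∀ S : Finset (Fin 4), finrank K (f.family S) = S.card := by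
    intro S
    by_cases h : S.Nonempty ∧ S ≠ Finset.univ
    · rw [f.family_eq h]
      exact (f.type_eq _).trans (frameVertex_type h)
    · by_cases hS : S = ∅
      · rw [hS, f.family_empty]; simp
      · have : S = Finset.univ := by
          by_contra hu; exact h ⟨Finset.nonempty_iff_ne_empty.mpr hS, hu⟩
        rw [this, f.family_univ]; simp
  refine ⟨fun S _ => hdim S, fun S S' hSS _ => ?_⟩
  by_cases h : S.Nonempty ∧ S ≠ Finset.univ
  · by_cases h' : S' = Finset.univ
    · rw [h', f.family_univ]; exact le_top
    · have h' : S'.Nonempty ∧ S' ≠ Finset.univ := ⟨h.1.mono hSS, h'⟩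
      have hface := f.map_face {frameVertex b S h, frameVertex b S' h'} (by
        have hle : (frameVertex b S h).1.carrier ≤ (frameVertex b S' h').1.carrier :=
          span_basis_image_le_iff.mpr hSS
        rw [Finset.map_insert, Finset.map_singleton]
        refine ⟨⟨by simp, ?_⟩, ?_⟩
        · intro v hv w hw hne
          simp only [Finset.coe_insert, Finset.coe_singleton, Set.mem_insert_iff,
            Set.mem_singleton_iff, Function.Embedding.subtype_apply] at hv hw
          rcases hv with rfl | rfl <;> rcases hw with rfl | rfl
          · exact absurd rfl hne
          · exact Or.inl hle
          · exact Or.inr hle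
          · exact absurd rfl hne
        · intro v hv
          simp only [Finset.mem_insert, Finset.mem_singleton,
            Function.Embedding.subtype_apply] at hv
          rcases hv with rfl | rfl
          exacts [⟨S, rfl⟩, ⟨S', rfl⟩])
      rw [f.family_eq h, f.family_eq h']
      by_cases he : f.toFun (frameVertex b S h) = f.toFun (frameVertex b S' h')
      · rw [he]
      · rcases hface.2 (by simp) (by simp) he with h1 | h1
        · exact h1
        · refine (Submodule.eq_of_le_of_finrank_le h1 ?_).ge
          have e1 := hdim S
          have e2 := hdim S'
          rw [f.family_eq h] at e1
          rw [f.family_eq h'] at e2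
          rw [e1, e2]
          exact Finset.card_le_card hSS
  · by_cases hS : S = ∅
    · rw [hS, f.family_empty]; exact bot_le
    · have hu : S = Finset.univ := by
        by_contra hu; exact h ⟨Finset.nonempty_iff_ne_empty.mpr hS, hu⟩
      have : S' = Finset.univ := by rw [← Finset.univ_subset_iff, ← hu]; exact hSS
      rw [hu, this]

/-- The points of a marked apartment are the points of the target basis, in some order, and they
determine the other vertices. -/
lemma Mor.IsMarkedApartment.family_mem {f : Mor (apartment b)}
    (hf : f.IsMarkedApartment) : f.family ∈ frameFamilies K Finset.univ := by
  classical
  obtain ⟨_, ⟨c, rfl⟩, hB⟩ := hf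
  have hp : ∀ i : Fin 4, ({i} : Finset (Fin 4)).Nonempty ∧ ({i} : Finset (Fin 4)) ≠ Finset.univ :=
    fun i => ⟨Finset.singleton_nonempty i, fun h => by simpa using congrArg Finset.card h⟩
  have hdim := f.isConfig_family.finrank_eq
  have h1 : ∀ i, ∃ j, f.family {i} = Submodule.span K {c j} := by
    intro i
    have : ({f.toFun (frameVertex b {i} (hp i))} : Finset (Vertex K)) ∈ (apartment c).faces := by
      rw [hB]
      refine ⟨{frameVertex b {i} (hp i)}, ?_, by rw [Finset.image_singleton]⟩
      rw [Finset.map_singleton]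
      exact (frameVertex b {i} (hp i)).2
    obtain ⟨S, hS⟩ := this.2 _ (Finset.mem_singleton_self _)
    have hcard : S.card = 1 := by
      have := hdim {i} (Finset.subset_univ _)
      rw [f.family_eq (hp i), hS, finrank_span_image (c.linearIndependent.linearIndepOn _)] at this
      simpa using this
    obtain ⟨j, rfl⟩ := Finset.card_eq_one.mp hcard
    exact ⟨j, by rw [f.family_eq (hp i), hS]; simp⟩
  choose σ hσ using h1
  have hsurj : Function.Surjective σ := by
    intro j
    have : ({(frameVertex c {j} (hp j)).1} : Finset (Vertex K)) ∈
        {τ | ∃ σ : Finset {v : Vertex K // {v} ∈ (apartment b).faces},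
      σ.map (Function.Embedding.subtype _) ∈ (apartment b).faces ∧ τ = σ.image f.toFun} := by
      rw [← hB]; exact (frameVertex c {j} (hp j)).2
    obtain ⟨τ, hτ, he⟩ := this
    have hj : (frameVertex c {j} (hp j)).1 ∈ τ.image f.toFun := by
      rw [← he]; exact Finset.mem_singleton_self _
    obtain ⟨v, -, hv⟩ := Finset.mem_image.mp hj
    obtain ⟨S, hS, rfl⟩ := frameVertex_surjective v
    have ht : S.card = 1 := by
      rw [← frameVertex_type (b := b) hS, ← f.type_eq, hv, frameVertex_type]; simp
    obtain ⟨i, rfl⟩ := Finset.card_eq_one.mp ht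
    refine ⟨i, ?_⟩
    have h2 : Submodule.span K {c j} = Submodule.span K {c (σ i)} := by
      rw [← hσ i, f.family_eq hS, hv]; simp [frameVertex]
    have h3 : c j ∈ Submodule.span K (c '' ({σ i} : Set (Fin 4))) := by
      rw [Set.image_singleton, ← h2]; exact Submodule.mem_span_singleton_self _
    exact (by simpa using c.self_mem_span_image.mp h3 : j = σ i).symm
  refine f.isConfig_family.mem_frameFamilies (c := c ∘ σ) ?_ fun i _ => ?_
  · rw [Finset.coe_univ, linearIndepOn_univ_iff]
    exact c.linearIndependent.comp σ (Finite.injective_iff_surjective.mpr hsurj)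
  · rw [hσ i]; exact Submodule.mem_span_singleton_self _

/-- Every basis of `K⁴` comes from a marked apartment. -/
lemma exists_markedApartment {F : Family K} (hF : F ∈ frameFamilies K Finset.univ) :
    ∃ f : Mor (apartment b), f.IsMarkedApartment ∧ f.family = F := by
  classical
  obtain ⟨c', hc', h⟩ := hF
  rw [Finset.coe_univ, linearIndepOn_univ_iff] at hc'
  let c : Basis (Fin 4) K (Fin 4 → K) := basisOfLinearIndependentOfCardEqFinrank hc' (by simp)
  have hcc : ⇑c = c' := coe_basisOfLinearIndependentOfCardEqFinrank hc' (by simp)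
  rw [← hcc] at h
  choose S hS hSv using fun v => frameVertex_surjective (b := b) v
  let g : {v : Vertex K // {v} ∈ (apartment b).faces} → Vertex K := fun v =>
    (frameVertex c (S v) (hS v)).1
  have hgv : ∀ (T : Finset (Fin 4)) (hT : T.Nonempty ∧ T ≠ Finset.univ),
      g (frameVertex b T hT) = (frameVertex c T hT).1 := by
    intro T hT
    have : S (frameVertex b T hT) = T := by
      have h1 := congrArg (fun v => v.1.carrier) (hSv (frameVertex b T hT))
      exact Finset.Subset.antisymm (span_basis_image_le_iff.mp h1.ge)
        (span_basis_image_le_iff.mp h1.le)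
    simp only [g, this]
  have hle : ∀ v w, v.1.carrier ≤ w.1.carrier ↔ (g v).carrier ≤ (g w).carrier := by
    intro v w
    obtain ⟨T, hT, rfl⟩ := frameVertex_surjective v
    obtain ⟨T', hT', rfl⟩ := frameVertex_surjective w
    rw [hgv, hgv]
    exact span_basis_image_le_iff.trans span_basis_image_le_iff.symm
  let f : Mor (apartment b) :=
    { toFun := g
      type_eq := fun v => by
        obtain ⟨T, hT, rfl⟩ := frameVertex_surjective v
        rw [hgv, frameVertex_type, frameVertex_type]
      map_face := fun σ hσ => by
        obtain ⟨⟨hne, hch⟩, -⟩ := hσ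
        refine ⟨(Finset.map_nonempty.mp hne).image _, ?_⟩
        intro v hv w hw hvw
        simp only [Finset.coe_image, Set.mem_image] at hv hw
        obtain ⟨v, hv, rfl⟩ := hv
        obtain ⟨w, hw, rfl⟩ := hw
        have hne' : v.1 ≠ w.1 := fun he => hvw (by rw [Subtype.ext he])
        have := hch (Finset.mem_coe.mpr (Finset.mem_map_of_mem _ hv))
          (Finset.mem_coe.mpr (Finset.mem_map_of_mem _ hw)) hne'
        exact this.imp (hle v w).mp (hle w v).mp }
  refine ⟨f, ⟨apartment c, ⟨c, rfl⟩, ?_⟩, ?_⟩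
  · ext τ
    simp only [Set.mem_ofPred_eq]
    constructor
    · rintro ⟨⟨hne, hch⟩, hτ⟩
      have hτ' : ∀ v ∈ τ, ∃ w, g w = v := by
        intro v hv
        have hv' : ({v} : Finset (Vertex K)) ∈ (apartment c).faces :=
          ⟨(building K).singleton_mem v, fun w hw => by
            rw [Finset.mem_singleton.mp hw]; exact hτ v hv⟩
        obtain ⟨T, hT, he⟩ := frameVertex_surjective (b := c) ⟨v, hv'⟩
        exact ⟨frameVertex b T hT, by rw [hgv, ← he]⟩
      refine ⟨(Finset.univ.filter fun T : {T : Finset (Fin 4) // T.Nonempty ∧ T ≠ Finset.univ} =>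
        (frameVertex c T.1 T.2).1 ∈ τ).image fun T => frameVertex b T.1 T.2, ?_, ?_⟩
      · refine ⟨⟨?_, ?_⟩, ?_⟩
        · obtain ⟨v, hv⟩ := hne
          obtain ⟨w, hw⟩ := hτ' v hv
          obtain ⟨T, hT, rfl⟩ := frameVertex_surjective w
          rw [hgv] at hw
          refine ⟨(frameVertex b T hT).1, ?_⟩
          simp only [Finset.mem_map, Finset.mem_image, Finset.mem_filter, Finset.mem_univ, true_and]
          exact ⟨_, ⟨⟨T, hT⟩, by rw [hw]; exact hv, rfl⟩, rfl⟩
        · intro v hv w hw hvw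
          simp only [Finset.coe_map, Set.mem_image, Finset.mem_coe, Finset.mem_image,
            Finset.mem_filter, Finset.mem_univ, true_and] at hv hw
          obtain ⟨_, ⟨T, hT, rfl⟩, rfl⟩ := hv
          obtain ⟨_, ⟨T', hT', rfl⟩, rfl⟩ := hw
          by_cases he : (frameVertex c T.1 T.2).1 = (frameVertex c T'.1 T'.2).1
          · left
            refine (hle _ _).mpr ?_
            rw [hgv, hgv, he]
          · refine (hch hT hT' he).imp (fun h => (hle _ _).mpr ?_) (fun h => (hle _ _).mpr ?_) <;>
            rwa [hgv, hgv]
        · intro v hv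
          simp only [Finset.mem_map, Finset.mem_image, Finset.mem_filter, Finset.mem_univ,
            true_and] at hv
          obtain ⟨_, ⟨T, hT, rfl⟩, rfl⟩ := hv
          exact ⟨T.1, rfl⟩
      · ext v
        simp only [Finset.mem_image, Finset.mem_filter, Finset.mem_univ, true_and]
        constructor
        · intro hv
          obtain ⟨w, hw⟩ := hτ' v hv
          obtain ⟨T, hT, rfl⟩ := frameVertex_surjective w
          refine ⟨_, ⟨⟨T, hT⟩, ?_, rfl⟩, hw⟩
          rw [← hgv T hT, hw]; exact hv
        · rintro ⟨_, ⟨T, hT, rfl⟩, rfl⟩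
          change g _ ∈ τ
          rw [hgv]; exact hT
    · rintro ⟨σ, hσ, rfl⟩
      refine ⟨f.map_face σ hσ, ?_⟩
      intro v hv
      obtain ⟨w, -, rfl⟩ := Finset.mem_image.mp hv
      exact ⟨S w, rfl⟩
  · funext T
    by_cases hT : T.Nonempty ∧ T ≠ Finset.univ
    · rw [f.family_eq hT, h T (Finset.subset_univ _)]
      change (g _).carrier = _
      rw [hgv]; rfl
    · rw [h T (Finset.subset_univ _)]
      by_cases he : T = ∅
      · rw [he, f.family_empty]; simp
      · have hu : T = Finset.univ := by
          by_contra hu; exact hT ⟨Finset.nonempty_iff_ne_empty.mpr he, hu⟩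
        rw [hu, f.family_univ, Finset.coe_univ, Set.image_univ, c.span_eq]

end Morphisms

/-! ### The topology of the space of morphisms -/

section MorphismTopology

variable {K : Type*} [NontriviallyNormedField K] [CompleteSpace K]
  {b : Basis (Fin 4) K (Fin 4 → K)}

/-- The subspaces carried by the vertices are topologised in the same way as the vertices. -/
lemma isInducing_carrier :
    IsInducing (Vertex.carrier : Vertex K → Submodule K (Fin 4 → K)) := by
  have hfac : ∀ u, (vertexOfFrame K u).carrier = spanFrame K ⟨u.1.val + 1, u.2⟩ := fun _ => rfl
  let ι : (Σ k : Fin 3, {u : Fin (k.val + 1) → (Fin 4 → K) // LinearIndependent K u}) →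
    (Σ k : ℕ, {u : Fin k → (Fin 4 → K) // LinearIndependent K u}) := fun u => ⟨u.1.val + 1, u.2⟩
  have hι : Continuous ι := continuous_sigma fun k =>
    continuous_sigmaMk (σ := fun k : ℕ => {u : Fin k → (Fin 4 → K) // LinearIndependent K u})
      (i := k.val + 1)
  have hιo : IsOpenMap ι := isOpenMap_sigma.mpr fun k =>
    isOpenMap_sigmaMk (σ := fun k : ℕ => {u : Fin k → (Fin 4 → K) // LinearIndependent K u})
      (i := k.val + 1)
  have hc : Continuous (Vertex.carrier : Vertex K → Submodule K (Fin 4 → K)) :=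
    continuous_coinduced_dom.mpr (continuous_spanFrame.comp hι)
  have hsurj : Function.Surjective (vertexOfFrame K) := by
    intro v
    have h1 : finrank K v.carrier ≠ 0 := fun h => v.ne_bot (Submodule.finrank_eq_zero.mp h)
    have h2 : finrank K v.carrier < 4 := by
      have := Submodule.finrank_lt v.ne_top
      simpa using this
    obtain ⟨u, hu, hs⟩ := exists_frame (K := K) (U := v.carrier)
      (k := (⟨finrank K v.carrier - 1, by omega⟩ : Fin 3).val + 1) (by
        change _ = finrank K v.carrier - 1 + 1
        omega)
    exact ⟨⟨⟨finrank K v.carrier - 1, by omega⟩, u, hu⟩, Vertex.ext hs⟩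
  have ho : IsOpenMap (Vertex.carrier : Vertex K → Submodule K (Fin 4 → K)) := by
    intro O hO
    have : Vertex.carrier '' O = spanFrame K '' (ι '' (vertexOfFrame K ⁻¹' O)) := by
      ext U
      constructor
      · rintro ⟨v, hv, rfl⟩
        obtain ⟨u, rfl⟩ := hsurj v
        exact ⟨ι u, ⟨u, hv, rfl⟩, rfl⟩
      · rintro ⟨_, ⟨u, hu, rfl⟩, rfl⟩
        exact ⟨vertexOfFrame K u, hu, rfl⟩
    rw [this]
    exact isOpenMap_spanFrame _ (hιo _ (isOpen_coinduced.mp hO))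
  exact (IsOpenEmbedding.of_continuous_injective_isOpenMap hc (fun v w h => Vertex.ext h)
    ho).isInducing

lemma isInducing_family :
    IsInducing (Mor.family : Mor (apartment b) → Family K) := by
  constructor
  apply le_antisymm
  · rw [← continuous_iff_le_induced]
    refine continuous_pi fun S => ?_
    by_cases h : S.Nonempty ∧ S ≠ Finset.univ
    · simp only [Mor.family_eq _ h]
      exact isInducing_carrier.continuous.comp ((continuous_apply _).comp continuous_induced_dom)
    · simp only [Mor.family, h, dif_neg, not_false_eq_true]
      exact continuous_const
  · refine (continuous_iff_le_induced (f := Mor.toFun)).mp ?_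
    let := TopologicalSpace.induced (Mor.family (b := b)) inferInstance
    refine continuous_pi fun v => ?_
    obtain ⟨S, h, rfl⟩ := frameVertex_surjective v
    rw [isInducing_carrier.continuous_iff]
    have h0 : Continuous (Mor.family (b := b)) := continuous_induced_dom
    have h1 : Continuous fun f : Mor (apartment b) => f.family S := (continuous_apply S).comp h0
    simp only [Mor.family_eq _ h] at h1
    exact h1

lemma mem_closure_marked_iff
    (f : Mor (apartment b)) :
    f ∈ closure {h : Mor (apartment b) | h.IsMarkedApartment} ↔
      f.family ∈ closure (frameFamilies K Finset.univ) := by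
  have himg : Mor.family '' {h : Mor (apartment b) | h.IsMarkedApartment} =
      frameFamilies K Finset.univ := by
    ext F
    constructor
    · rintro ⟨h, hh, rfl⟩
      exact Mor.IsMarkedApartment.family_mem hh
    · intro hF
      obtain ⟨f, hf, rfl⟩ := exists_markedApartment (b := b) hF
      exact ⟨f, hf, rfl⟩
  rw [isInducing_family.closure_eq_preimage_closure_image, Set.mem_preimage, himg]

end MorphismTopology

/-! ### Convergence of spans -/

section Convergence

variable {K : Type*} [NontriviallyNormedField K]

lemma tendsto_nhdsNE_zero {X : Type*} [TopologicalSpace X] {f : K → X} (hf : Continuous f) :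
    Tendsto f (𝓝[≠] 0) (𝓝 (f 0)) :=
  (hf.tendsto 0).mono_left nhdsWithin_le_nhds

variable [CompleteSpace K]

lemma eventually_add_smul_notMem {W : Submodule K (Fin 4 → K)} {x v : Fin 4 → K}
    (h : x ∉ W ∨ v ∉ W) : ∀ᶠ t : K in 𝓝[≠] 0, x + t • v ∉ W := by
  by_cases hx : x ∈ W
  · filter_upwards [self_mem_nhdsWithin] with t ht hmem
    have h1 : t • v ∈ W := by simpa using W.sub_mem hmem hx
    exact h.elim (fun h => h hx) fun h => h ((W.smul_mem_iff ht).mp h1)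
  · have hc : Continuous fun t : K => x + t • v := by fun_prop
    have hW : IsOpen ((W : Set (Fin 4 → K))ᶜ) := W.closed_of_finiteDimensional.isOpen_compl
    exact (tendsto_nhdsNE_zero hc).eventually_mem (hW.mem_nhds (by simpa using hx))

lemma tendsto_of_vec {U : K → Submodule K (Fin 4 → K)} {U₀ : Submodule K (Fin 4 → K)}
    (f : K → (Fin 4 → K)) (hf : Continuous f) (hm : ∀ t ≠ 0, f t ∈ U t)
    (hdim : ∀ t, finrank K (U t) ≤ 1) (h₀ : U₀ ≤ Submodule.span K {f 0})
    (hdim₀ : finrank K U₀ = 1) : Tendsto U (𝓝[≠] 0) (𝓝 U₀) := by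
  refine tendsto_of_frame (fun t => ![f t]) ![f 0] ?_ ?_ (.of_forall hdim) (by simpa using h₀) hdim₀
  · refine tendsto_nhdsNE_zero (f := fun t => ![f t]) (continuous_pi fun j => ?_)
    fin_cases j
    exact hf
  · filter_upwards [self_mem_nhdsWithin] with t ht j
    fin_cases j
    exact hm t ht

lemma tendsto_of_two_vecs {U : K → Submodule K (Fin 4 → K)} {U₀ : Submodule K (Fin 4 → K)}
    (f g : K → (Fin 4 → K)) (hf : Continuous f) (hg : Continuous g)
    (hm : ∀ t ≠ 0, f t ∈ U t ∧ g t ∈ U t) (hdim : ∀ t, finrank K (U t) ≤ 2)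
    (h₀ : U₀ ≤ Submodule.span K {f 0, g 0}) (hdim₀ : finrank K U₀ = 2) :
    Tendsto U (𝓝[≠] 0) (𝓝 U₀) := by
  refine tendsto_of_frame (fun t => ![f t, g t]) ![f 0, g 0] ?_ ?_ (.of_forall hdim)
    (by simpa [Matrix.range_cons, Set.pair_comm, ← Set.insert_eq] using h₀) hdim₀
  · refine tendsto_nhdsNE_zero (f := fun t => ![f t, g t]) (continuous_pi fun j => ?_)
    fin_cases j
    exacts [hf, hg]
  · filter_upwards [self_mem_nhdsWithin] with t ht j
    fin_cases j
    exacts [(hm t ht).1, (hm t ht).2]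

lemma tendsto_of_three_vecs {U : K → Submodule K (Fin 4 → K)} {U₀ : Submodule K (Fin 4 → K)}
    (f g h : K → (Fin 4 → K)) (hf : Continuous f) (hg : Continuous g) (hh : Continuous h)
    (hm : ∀ t ≠ 0, f t ∈ U t ∧ g t ∈ U t ∧ h t ∈ U t) (hdim : ∀ t, finrank K (U t) ≤ 3)
    (h₀ : U₀ ≤ Submodule.span K {f 0, g 0, h 0}) (hdim₀ : finrank K U₀ = 3) :
    Tendsto U (𝓝[≠] 0) (𝓝 U₀) := by
  refine tendsto_of_frame (fun t => ![f t, g t, h t]) ![f 0, g 0, h 0] ?_ ?_ (.of_forall hdim)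
    (by
      have : Set.range ![f 0, g 0, h 0] = {f 0, g 0, h 0} := by
        simp only [Matrix.range_cons, Matrix.range_empty, Set.union_empty, Set.insert_eq]
      rwa [this]) hdim₀
  · refine tendsto_nhdsNE_zero (f := fun t => ![f t, g t, h t]) (continuous_pi fun j => ?_)
    fin_cases j
    exacts [hf, hg, hh]
  · filter_upwards [self_mem_nhdsWithin] with t ht j
    fin_cases j
    exacts [(hm t ht).1, (hm t ht).2.1, (hm t ht).2.2]

end Convergence

namespace IsConfig

variable {K : Type*} [Field K] {T : Finset (Fin 4)} {F : Family K}

lemma eq_bot (hF : IsConfig T F) : F ∅ = ⊥ :=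
  Submodule.finrank_eq_zero.mp (by simpa using hF.finrank_eq ∅ (Finset.empty_subset T))

lemma sup_span_eq (hF : IsConfig T F) {S : Finset (Fin 4)} {i : Fin 4} {x : Fin 4 → K}
    (hS : S ⊆ T) (hi : i ∈ S) (hx : F {i} = Submodule.span K {x}) (h : x ∉ F (S.erase i)) :
    F (S.erase i) ⊔ Submodule.span K {x} = F S := by
  refine Submodule.eq_of_le_of_finrank_eq (sup_le (hF.mono _ _ (Finset.erase_subset i S) hS) ?_) ?_
  · rw [← hx]; exact hF.mono _ _ (by simpa using hi) hS
  · rw [Submodule.finrank_sup_span_singleton h, hF.finrank_eq _ ((Finset.erase_subset i S).trans hS),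
      hF.finrank_eq S hS, Finset.card_erase_add_one hi]

lemma eq_of_le (hF : IsConfig T F) {S : Finset (Fin 4)} (hS : S ⊆ T)
    {U : Submodule K (Fin 4 → K)} (h : U ≤ F S) (hU : finrank K U = S.card) : U = F S :=
  Submodule.eq_of_le_of_finrank_eq h (by rw [hU, hF.finrank_eq S hS])

lemma exists_notMem (hF : IsConfig T F) {S : Finset (Fin 4)} (hS : S ⊆ T)
    {U : Submodule K (Fin 4 → K)} (hU : finrank K U < S.card) : ∃ v ∈ F S, v ∉ U := by
  by_contra! h
  have := Submodule.finrank_mono (show F S ≤ U from h)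
  rw [hF.finrank_eq S hS] at this
  omega

end IsConfig

/-! ### Moving one subspace of a family -/

section Moves

open Classical in
/-- Moving the point indexed by `i` from `⟨x⟩` to `⟨x + t v⟩`, together with the subspaces that
this point spans with others. -/
noncomputable def movePoint {K : Type*} [Field K] (F : Family K) (i : Fin 4) (x v : Fin 4 → K)
    (t : K) : Family K := fun S =>
  if i ∈ S ∧ x ∉ F (S.erase i) then F (S.erase i) ⊔ Submodule.span K {x + t • v} else F S

section

variable {K : Type*} [Field K] {F : Family K} {i : Fin 4} {x v : Fin 4 → K} {t : K}

lemma movePoint_of_notMem {S : Finset (Fin 4)} (h : i ∉ S) : movePoint F i x v t S = F S :=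
  if_neg fun h' => h h'.1

lemma movePoint_of_mem {S : Finset (Fin 4)} (h : x ∈ F (S.erase i)) : movePoint F i x v t S = F S :=
  if_neg fun h' => h'.2 h

lemma movePoint_singleton (hF : F ∅ = ⊥) (hx : x ≠ 0) :
    movePoint F i x v t {i} = Submodule.span K {x + t • v} := by
  have h : i ∈ ({i} : Finset (Fin 4)) ∧ x ∉ F (({i} : Finset (Fin 4)).erase i) := by
    simp [hF, hx]
  rw [movePoint, if_pos h]
  simp [hF]

end

variable {K : Type*} [NontriviallyNormedField K] [CompleteSpace K]
  {T : Finset (Fin 4)} {F : Family K}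

lemma IsConfig.movePoint (hF : IsConfig T F) {i : Fin 4} {x v : Fin 4 → K}
    (hx : F {i} = Submodule.span K {x})
    (hv : ∀ S ⊆ T, i ∈ S → x ∈ F (S.erase i) → v ∈ F S) :
    ∀ᶠ t : K in 𝓝[≠] 0, IsConfig T (movePoint F i x v t) := by
  have hev : ∀ S : Finset (Fin 4), ∀ᶠ t : K in 𝓝[≠] 0, x ∉ F (S.erase i) →
      x + t • v ∉ F (S.erase i) := by
    intro S
    by_cases h : x ∈ F (S.erase i)
    · exact .of_forall fun t h' => absurd h h'
    · filter_upwards [eventually_add_smul_notMem (Or.inl h)] with t ht _ using ht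
  filter_upwards [eventually_all.mpr hev] with t ht
  refine ⟨fun S hS => ?_, fun S S' hSS hS' => ?_⟩
  · by_cases h : i ∈ S ∧ x ∉ F (S.erase i)
    · rw [Building.movePoint, if_pos h, Submodule.finrank_sup_span_singleton (ht S h.2),
        hF.finrank_eq _ ((Finset.erase_subset i S).trans hS), Finset.card_erase_add_one h.1]
    · rw [Building.movePoint, if_neg h, hF.finrank_eq S hS]
  · have hx' : ∀ S ⊆ T, i ∈ S → x ∈ F S := fun S hS hi => by
      refine hF.mono {i} S (by simpa using hi) hS ?_
      rw [hx]; exact Submodule.mem_span_singleton_self x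
    have hle : F (S.erase i) ≤ F (S'.erase i) :=
      hF.mono _ _ (Finset.erase_subset_erase i hSS) ((Finset.erase_subset i S').trans hS')
    have hleS : F S ≤ F S' := hF.mono _ _ hSS hS'
    by_cases h' : i ∈ S' ∧ x ∉ F (S'.erase i)
    · rw [Building.movePoint, Building.movePoint, if_pos h']
      by_cases hi : i ∈ S
      · rw [if_pos ⟨hi, fun h => h'.2 (hle h)⟩]
        exact sup_le_sup_right hle _
      · rw [if_neg fun h => hi h.1]
        exact (hF.mono S (S'.erase i) (Finset.subset_erase.mpr ⟨hSS, hi⟩)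
          ((Finset.erase_subset i S').trans hS')).trans le_sup_left
    · rw [Building.movePoint, Building.movePoint, if_neg h']
      by_cases h : i ∈ S ∧ x ∉ F (S.erase i)
      · have hi' : i ∈ S' := hSS h.1
        have hvS : v ∈ F S' := hv S' hS' hi' (by
          by_contra hn; exact h' ⟨hi', hn⟩)
        rw [if_pos h]
        refine sup_le ((hF.mono _ _ (Finset.erase_subset i S) (hSS.trans hS')).trans hleS) ?_
        rw [Submodule.span_singleton_le_iff_mem]
        exact Submodule.add_mem _ (hx' S' hS' hi') (Submodule.smul_mem _ _ hvS)
      · rw [if_neg h]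
        exact hleS

/-- A configuration is a limit of apartments if the configurations obtained by slightly moving one
point are. The direction of the move has to lie in all subspaces that are not moved. -/
lemma IsConfig.mem_closure_of_movePoint (hF : IsConfig T F) {i : Fin 4} {x v : Fin 4 → K}
    (hx : F {i} = Submodule.span K {x})
    (hv : ∀ S ⊆ T, i ∈ S → x ∈ F (S.erase i) → v ∈ F S)
    (h : ∀ᶠ t : K in 𝓝[≠] 0, IsConfig T (Building.movePoint F i x v t) →
      Building.movePoint F i x v t ∈ closure (frameFamilies K T)) :
    F ∈ closure (frameFamilies K T) := by
  refine mem_closure_of_tendsto_family (l := 𝓝[≠] 0) (fun t => Building.movePoint F i x v t) ?_ ?_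
  · filter_upwards [h, hF.movePoint hx hv] with t h1 h2 using h1 h2
  · intro S hS
    by_cases hS' : i ∈ S ∧ x ∉ F (S.erase i)
    · simp only [Building.movePoint, if_pos hS']
      have hx0 : x ≠ 0 := fun h0 => hS'.2 (h0 ▸ Submodule.zero_mem _)
      have hc : Tendsto (fun t : K => x + t • v) (𝓝[≠] 0) (𝓝 x) := by
        simpa using tendsto_nhdsNE_zero (f := fun t : K => x + t • v) (by fun_prop)
      have hd : Disjoint (F (S.erase i)) (Submodule.span K {x}) :=
        Submodule.disjoint_span_singleton_of_notMem hS'.2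
      have := tendsto_sup_right (tendsto_const_nhds (x := F (S.erase i)))
        (tendsto_span_singleton hc hx0) hd
      rwa [hF.sup_span_eq hS hS'.1 hx hS'.2] at this
    · simp only [Building.movePoint, if_neg hS']
      exact tendsto_const_nhds

/-- A configuration is a limit of apartments if all but finitely many of the configurations
obtained by replacing one subspace `F S₀` by another member of a pencil are. -/
lemma IsConfig.mem_closure_of_pencil (hF : IsConfig T F) {S₀ : Finset (Fin 4)} (hS₀ : S₀ ⊆ T)
    {A B : Submodule K (Fin 4 → K)} (hA : ∀ S, S ⊂ S₀ → F S ≤ A)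
    (hB : ∀ S ⊆ T, S₀ ⊂ S → B ≤ F S) (hAF : A ≤ F S₀) (hFB : F S₀ ≤ B)
    (hdA : finrank K A + 1 = S₀.card) (hdB : finrank K B = S₀.card + 1)
    (Z : Set (Submodule K (Fin 4 → K))) (hZ : Z.Finite)
    (h : ∀ U, A ≤ U → U ≤ B → finrank K U = S₀.card → U ∉ Z →
      IsConfig T (Function.update F S₀ U) →
      Function.update F S₀ U ∈ closure (frameFamilies K T)) :
    F ∈ closure (frameFamilies K T) := by
  obtain ⟨θ, hθ, hθA⟩ := hF.exists_notMem hS₀ (U := A) (by omega)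
  have hFS := hF.finrank_eq S₀ hS₀
  obtain ⟨δ, hδ, hδF⟩ : ∃ δ ∈ B, δ ∉ F S₀ := by
    by_contra! h'
    have := Submodule.finrank_mono (show B ≤ F S₀ from h')
    omega
  let U : K → Submodule K (Fin 4 → K) := fun t => A ⊔ Submodule.span K {θ + t • δ}
  have hθt : ∀ t : K, θ + t • δ ∉ A := by
    intro t ht
    by_cases h0 : t = 0
    · subst h0; simp at ht; exact hθA ht
    · have h1 : t • δ ∈ F S₀ := by simpa using (F S₀).sub_mem (hAF ht) hθ
      exact hδF (((F S₀).smul_mem_iff h0).mp h1)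
  have hUd : ∀ t, finrank K (U t) = S₀.card := fun t => by
    rw [Submodule.finrank_sup_span_singleton (hθt t), hdA]
  have hUB : ∀ t, U t ≤ B := fun t => sup_le (hAF.trans hFB) (by
    rw [Submodule.span_singleton_le_iff_mem]
    exact B.add_mem (hFB hθ) (B.smul_mem t hδ))
  have hU0 : U 0 = F S₀ := by
    refine hF.eq_of_le hS₀ (sup_le hAF ?_) (hUd 0)
    rw [Submodule.span_singleton_le_iff_mem]
    simpa using hθ
  have hmemU : ∀ t, θ + t • δ ∈ U t := fun t =>
    Submodule.mem_sup_right (Submodule.mem_span_singleton_self _)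
  have hinj : Function.Injective U := by
    intro s t hst
    by_contra hne
    have h1 : θ + s • δ ∈ U t := hst ▸ hmemU s
    have h2 : (s - t) • δ ∈ U t := by
      have := (U t).sub_mem h1 (hmemU t)
      rwa [add_sub_add_left_eq_sub, ← sub_smul] at this
    have h3 : δ ∈ U t := ((U t).smul_mem_iff (sub_ne_zero.mpr hne)).mp h2
    have h4 : θ ∈ U t := by simpa using (U t).sub_mem (hmemU t) ((U t).smul_mem t h3)
    have h5 : U 0 ≤ U t := sup_le le_sup_left (by
      rw [Submodule.span_singleton_le_iff_mem]; simpa using h4)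
    have h6 := Submodule.eq_of_le_of_finrank_eq h5 (by rw [hUd, hUd])
    exact hδF (by rw [← hU0, h6]; exact h3)
  have hconf : ∀ t, IsConfig T (Function.update F S₀ (U t)) := by
    intro t
    refine ⟨fun S hS => ?_, fun S S' hSS hS' => ?_⟩
    · by_cases he : S = S₀
      · rw [he, Function.update_self, hUd]
      · rw [Function.update_of_ne he, hF.finrank_eq S hS]
    · by_cases he : S = S₀
      · by_cases he' : S' = S₀
        · rw [he, he']
        · rw [he, Function.update_self, Function.update_of_ne he']
          exact (hUB t).trans (hB S' hS' (lt_of_le_of_ne (he ▸ hSS) (Ne.symm he')))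
      · by_cases he' : S' = S₀
        · rw [he', Function.update_self, Function.update_of_ne he]
          exact (hA S (lt_of_le_of_ne (he' ▸ hSS) he)).trans le_sup_left
        · rw [Function.update_of_ne he, Function.update_of_ne he']
          exact hF.mono S S' hSS hS'
  refine mem_closure_of_tendsto_family (l := 𝓝[≠] 0) (fun t => Function.update F S₀ (U t)) ?_ ?_
  · have hfin : ∀ᶠ t : K in 𝓝[≠] 0, t ∉ U ⁻¹' Z :=
      nhdsNE_le_cofinite 0 (hZ.preimage hinj.injOn).compl_mem_cofinite
    filter_upwards [hfin] with t ht
    exact h (U t) le_sup_left (hUB t) (hUd t) ht (hconf t)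
  · intro S hS
    by_cases he : S = S₀
    · subst he
      simp only [Function.update_self]
      have hc : Tendsto (fun t : K => θ + t • δ) (𝓝[≠] 0) (𝓝 θ) := by
        simpa using tendsto_nhdsNE_zero (f := fun t : K => θ + t • δ) (by fun_prop)
      have := tendsto_sup_right (tendsto_const_nhds (x := A)) (tendsto_span_singleton hc
        (fun h0 => hθA (h0 ▸ A.zero_mem))) (Submodule.disjoint_span_singleton_of_notMem hθA)
      rw [← hU0]
      simpa [U] using this
    · simp only [Function.update_of_ne he]
      exact tendsto_const_nhds

end Moves

namespace IsConfig

variable {K : Type*} [Field K] {T : Finset (Fin 4)} {F : Family K}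

lemma point_eq_of_mem (hF : IsConfig T F) {i j : Fin 4} (hi : i ∈ T) (hj : j ∈ T)
    {x : Fin 4 → K} (hx : F {i} = Submodule.span K {x}) (h : x ∈ F {j}) : F {i} = F {j} := by
  refine hF.eq_of_le (by simpa using hj) ?_ ?_
  · rw [hx, Submodule.span_singleton_le_iff_mem]; exact h
  · rw [hF.finrank_eq {i} (by simpa using hi)]; simp

lemma ne_zero (hF : IsConfig T F) {i : Fin 4} (hi : i ∈ T)
    {x : Fin 4 → K} (hx : F {i} = Submodule.span K {x}) : x ≠ 0 := by
  rintro rfl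
  have := hF.finrank_eq {i} (by simpa using hi)
  rw [hx, Submodule.span_zero_singleton, finrank_bot] at this
  simp at this

lemma mem_of_span (hF : IsConfig T F) {i : Fin 4} {S : Finset (Fin 4)} (hi : i ∈ S) (hS : S ⊆ T)
    {x : Fin 4 → K} (hx : F {i} = Submodule.span K {x}) : x ∈ F S :=
  hF.mono {i} S (by simpa using hi) hS (hx ▸ Submodule.mem_span_singleton_self x)

/-- Two distinct lines meet in at most one point. -/
lemma point_eq_of_mem_lines (hF : IsConfig T F)
    {S S' : Finset (Fin 4)}
    (hS : S ⊆ T) (hS' : S' ⊆ T) (hc : S.card = 2) (hc' : S'.card = 2) (hne : F S ≠ F S') {a b : Fin 4}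
    (ha : a ∈ T) (hb : b ∈ T) (haS : F {a} ≤ F S) (haS' : F {a} ≤ F S') (hbS : F {b} ≤ F S)
    (hbS' : F {b} ≤ F S') : F {a} = F {b} := by
  by_contra hab
  have hlt : F {a} < F {a} ⊔ F {b} := le_sup_left.lt_of_ne fun h => hab (by
    refine (hF.eq_of_le (by simpa using ha) (h ▸ le_sup_right) ?_).symm
    rw [hF.finrank_eq {b} (by simpa using hb)]; simp)
  have h3 := Submodule.finrank_lt_finrank_of_lt hlt
  rw [hF.finrank_eq {a} (by simpa using ha), Finset.card_singleton] at h3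
  have e1 := Submodule.eq_of_le_of_finrank_le (sup_le haS hbS) (by
    rw [hF.finrank_eq S hS, hc]; exact h3)
  have e2 := Submodule.eq_of_le_of_finrank_le (sup_le haS' hbS') (by
    rw [hF.finrank_eq S' hS', hc']; exact h3)
  exact hne (e1.symm.trans e2)

end IsConfig

/-! ### Triangles in a plane -/

section Triangle

lemma subset_triple_cases : ∀ (i j k : Fin 4) (S : Finset (Fin 4)), S ⊆ {i, j, k} → k ∈ S →
    S = {k} ∨ S = {i, k} ∨ S = {j, k} ∨ S = {i, j, k} := by decide

lemma subset_triple_cases' : ∀ (i j k : Fin 4) (S : Finset (Fin 4)), S ⊆ {i, j, k} →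
    S = ∅ ∨ S = {i} ∨ S = {j} ∨ S = {k} ∨ S = {i, j} ∨ S = {i, k} ∨ S = {j, k} ∨
      S = {i, j, k} := by decide

lemma erase_pair : ∀ i k : Fin 4, i ≠ k → ({i, k} : Finset (Fin 4)).erase k = {i} := by decide

variable {K : Type*} [NontriviallyNormedField K]
  {F : Family K} {i j k : Fin 4}

/-- A point off the line through two other distinct points: this is already a triangle. -/
lemma triangle_of_apex_of_ne (hij : i ≠ j) (hik : i ≠ k) (hjk : j ≠ k)
    (hF : IsConfig {i, j, k} F) {x : Fin 4 → K} (hx : F {i} = Submodule.span K {x})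
    (h : x ∉ F {j, k}) (hne : F {j} ≠ F {k}) : F ∈ closure (frameFamilies K {i, j, k}) := by
  obtain ⟨y, hy0, hy⟩ := hF.exists_vec (i := j) (by simp)
  obtain ⟨z, hz0, hz⟩ := hF.exists_vec (i := k) (by simp)
  let c : Fin 4 → (Fin 4 → K) := Function.update (Function.update (fun _ => x) j y) k z
  have hci : c i = x := by simp [c, hik, hij]
  have hcj : c j = y := by simp [c, hjk]
  have hck : c k = z := by simp [c]
  refine subset_closure (hF.mem_frameFamilies (c := c) ?_ ?_)
  · have h1 : LinearIndepOn K c {k} := LinearIndepOn.singleton (by rw [hck]; exact hz0)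
    have h2 : LinearIndepOn K c (insert j {k}) := h1.insert (by
      rw [Set.image_singleton, hcj, hck, ← hz]
      exact fun hm => hne (hF.point_eq_of_mem (by simp) (by simp) hy hm))
    have h3 : LinearIndepOn K c (insert i (insert j {k})) := h2.insert (by
      rw [Set.image_insert_eq, Set.image_singleton, hci, hcj, hck]
      refine fun hm => h ((Submodule.span_le.mpr ?_ : Submodule.span K {y, z} ≤ F {j, k}) hm)
      rintro w (rfl | rfl)
      · exact hF.mem_of_span (by simp) (by simp) hy
      · exact hF.mem_of_span (by simp) (by simp) hz)
    simpa using h3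
  · intro a ha
    simp only [Finset.mem_insert, Finset.mem_singleton] at ha
    rcases ha with rfl | rfl | rfl
    · rw [hci, hx]; exact Submodule.mem_span_singleton_self _
    · rw [hcj, hy]; exact Submodule.mem_span_singleton_self _
    · rw [hck, hz]; exact Submodule.mem_span_singleton_self _

variable [CompleteSpace K]

/-- A point off the line opposite to it. If the other two points coincide, then one of them is moved
along that line. -/
lemma triangle_of_apex (hij : i ≠ j) (hik : i ≠ k) (hjk : j ≠ k)
    (hF : IsConfig {i, j, k} F) {x : Fin 4 → K} (hx : F {i} = Submodule.span K {x})
    (h : x ∉ F {j, k}) : F ∈ closure (frameFamilies K {i, j, k}) := by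
  by_cases hne : F {j} = F {k}
  swap
  · exact triangle_of_apex_of_ne hij hik hjk hF hx h hne
  obtain ⟨z, hz0, hz⟩ := hF.exists_vec (i := k) (by simp)
  obtain ⟨v, hv, hvj⟩ := hF.exists_notMem (S := {j, k}) (U := F {k}) (by simp) (by
    rw [hF.finrank_eq {k} (by simp), Finset.card_pair hjk]; simp)
  refine hF.mem_closure_of_movePoint (i := k) (x := z) (v := v) hz ?_ ?_
  · intro S hS hk hzS
    rcases subset_triple_cases i j k S hS hk with rfl | rfl | rfl | rfl
    · simp [hF.eq_bot, hz0] at hzS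
    · rw [erase_pair i k hik] at hzS
      have h1 := hF.point_eq_of_mem (by simp) (by simp) hz hzS
      exact absurd (hF.mono {k} {j, k} (by simp) (by simp)
        (h1 ▸ hx ▸ Submodule.mem_span_singleton_self x)) h
    · exact hv
    · exact hF.mono {j, k} {i, j, k} (by simp) (by simp) hv
  · filter_upwards [self_mem_nhdsWithin] with t ht hconf
    have e1 : movePoint F k z v t {i} = F {i} := movePoint_of_notMem (by simpa using hik.symm)
    have e2 : movePoint F k z v t {j} = F {j} := movePoint_of_notMem (by simpa using hjk.symm)
    have e3 : movePoint F k z v t {j, k} = F {j, k} := movePoint_of_mem (by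
      rw [erase_pair j k hjk, hne, hz]; exact Submodule.mem_span_singleton_self _)
    refine triangle_of_apex_of_ne hij hik hjk hconf (e1.trans hx) (by rwa [e3]) ?_
    rw [e2, movePoint_singleton hF.eq_bot hz0, hne]
    intro he
    have h1 : z + t • v ∈ F {k} := he ▸ Submodule.mem_span_singleton_self _
    have h2 : t • v ∈ F {k} := by
      have := (F {k}).sub_mem h1 (hz ▸ Submodule.mem_span_singleton_self z)
      rwa [add_sub_cancel_left] at this
    exact hvj (((F {k}).smul_mem_iff ht).mp h2)

/-- If the third point differs from the other two, it can be moved out of the line joining them: the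
lines through it follow, and only the plane has to contain the direction of the movement. -/
lemma triangle_of_lines_eq_of_ne (hij : i ≠ j) (hik : i ≠ k) (hjk : j ≠ k)
    (hF : IsConfig {i, j, k} F) (h1 : F {k} ≠ F {i}) (h2 : F {k} ≠ F {j}) :
    F ∈ closure (frameFamilies K {i, j, k}) := by
  obtain ⟨z, hz0, hz⟩ := hF.exists_vec (i := k) (by simp)
  obtain ⟨v, hv, hvr⟩ := hF.exists_notMem (S := {i, j, k}) (U := F {i, j}) (by simp) (by
    rw [hF.finrank_eq {i, j} (by intro a; simp; tauto), Finset.card_pair hij,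
      Finset.card_eq_three.mpr ⟨i, j, k, hij, hik, hjk, rfl⟩]; norm_num)
  refine hF.mem_closure_of_movePoint (i := k) (x := z) (v := v) hz ?_ ?_
  · intro S hS hk hzS
    rcases subset_triple_cases i j k S hS hk with rfl | rfl | rfl | rfl
    · simp [hF.eq_bot, hz0] at hzS
    · rw [erase_pair i k hik] at hzS
      exact absurd (hF.point_eq_of_mem (by simp) (by simp) hz hzS) h1
    · rw [erase_pair j k hjk] at hzS
      exact absurd (hF.point_eq_of_mem (by simp) (by simp) hz hzS) h2
    · exact hv
  · filter_upwards [eventually_add_smul_notMem (Or.inr hvr)] with t ht hconf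
    have e3 : movePoint F k z v t {i, j} = F {i, j} :=
      movePoint_of_notMem (by simp [hik.symm, hjk.symm])
    have hT : ({i, j, k} : Finset (Fin 4)) = {k, i, j} := by ext a; simp; tauto
    rw [hT] at hconf ⊢
    exact triangle_of_apex hik.symm hjk.symm hij hconf (movePoint_singleton hF.eq_bot hz0)
      (by rwa [e3])

/-- Three equal lines: the third point is moved along the common line, away from the other two. -/
lemma triangle_of_lines_eq (hij : i ≠ j) (hik : i ≠ k) (hjk : j ≠ k)
    (hF : IsConfig {i, j, k} F) (h1 : F {i, k} = F {i, j}) (h2 : F {j, k} = F {i, j}) :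
    F ∈ closure (frameFamilies K {i, j, k}) := by
  have hijT : ({i, j} : Finset (Fin 4)) ⊆ {i, j, k} := by intro a; simp; tauto
  refine hF.mem_closure_of_pencil (S₀ := {k}) (A := ⊥) (B := F {i, j}) (by simp) ?_ ?_ bot_le ?_
    (by simp) (by rw [hF.finrank_eq _ hijT, Finset.card_pair hij]; simp) {F {i}, F {j}}
    (Set.toFinite _) ?_
  · intro S hS
    rw [Finset.ssubset_singleton_iff.mp hS, hF.eq_bot]
  · intro S hS hkS
    rcases subset_triple_cases i j k S hS (hkS.subset (by simp)) with rfl | rfl | rfl | rfl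
    · exact absurd rfl hkS.ne
    · exact h1.ge
    · exact h2.ge
    · exact hF.mono _ _ hijT (by simp)
  · rw [← h1]; exact hF.mono _ _ (by simp) (by intro a; simp; tauto)
  · intro U _ _ _ hUZ hconf
    simp only [Set.mem_insert_iff, Set.mem_singleton_iff, not_or] at hUZ
    refine triangle_of_lines_eq_of_ne hij hik hjk hconf ?_ ?_
    · rw [Function.update_self, Function.update_of_ne (by simpa using hik)]; exact hUZ.1
    · rw [Function.update_self, Function.update_of_ne (by simpa using hjk)]; exact hUZ.2

/-- Three coinciding points, joined by lines of which the first and the third one coincide. -/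
lemma triangle_of_points_eq_of_eq (hij : i ≠ j) (hik : i ≠ k) (hjk : j ≠ k)
    (hF : IsConfig {i, j, k} F) (hpj : F {j} = F {i}) (hl : F {i, j} ≠ F {i, k})
    (hc : F {j, k} = F {i, j}) :
    F ∈ closure (frameFamilies K {i, j, k}) := by
  obtain ⟨x, hx0, hx⟩ := hF.exists_vec (i := j) (by simp)
  have hijT : ({i, j} : Finset (Fin 4)) ⊆ {i, j, k} := by intro a; simp; tauto
  have hikT : ({i, k} : Finset (Fin 4)) ⊆ {i, j, k} := by intro a; simp; tauto
  obtain ⟨v, hv, hvx⟩ := hF.exists_notMem (S := {i, j}) (U := F {i, k} ⊓ F {i, j}) hijT (by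
    have : F {i, k} ⊓ F {i, j} < F {i, j} := inf_le_right.lt_of_ne fun h => hl (by
      refine hF.eq_of_le hikT (inf_eq_right.mp h) ?_
      rw [hF.finrank_eq _ hijT, Finset.card_pair hij, Finset.card_pair hik])
    have := Submodule.finrank_lt_finrank_of_lt this
    rwa [hF.finrank_eq _ hijT] at this)
  have hvk : v ∉ F {i, k} := fun h => hvx ⟨h, hv⟩
  have hxk : x ∈ F {i, k} := hF.mono {i} _ (by simp) hikT
    (hpj ▸ hx ▸ Submodule.mem_span_singleton_self x)
  refine hF.mem_closure_of_movePoint (i := j) (x := x) (v := v) hx ?_ ?_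
  · intro S hS hj hxS
    rcases subset_triple_cases i k j S (by rwa [Finset.pair_comm k j]) hj with
      rfl | rfl | rfl | rfl
    · simp [hF.eq_bot, hx0] at hxS
    · exact hv
    · rw [Finset.pair_comm, hc]; exact hv
    · exact hF.mono _ _ (by intro a; simp; tauto) hS hv
  · filter_upwards [eventually_add_smul_notMem (Or.inr hvk)] with t ht hconf
    have e3 : movePoint F j x v t {i, k} = F {i, k} :=
      movePoint_of_notMem (by simp [hij.symm, hjk])
    have hT : ({i, j, k} : Finset (Fin 4)) = {j, i, k} := by ext a; simp; tauto
    rw [hT] at hconf ⊢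
    exact triangle_of_apex hij.symm hjk hik hconf (movePoint_singleton hF.eq_bot hx0)
      (by rwa [e3])

/-- Three coinciding points, joined by three distinct concurrent lines, are the limit of
homothetic triangles. -/
lemma triangle_of_points_eq_of_distinct (hij : i ≠ j) (hik : i ≠ k) (hjk : j ≠ k)
    (hF : IsConfig {i, j, k} F) (hpj : F {j} = F {i}) (hpk : F {k} = F {i})
    (hl : F {i, j} ≠ F {i, k}) (h1 : F {j, k} ≠ F {i, j}) (h2 : F {j, k} ≠ F {i, k}) :
    F ∈ closure (frameFamilies K {i, j, k}) := by
  obtain ⟨x, hx0, hx⟩ := hF.exists_vec (i := i) (by simp)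
  have hT3 : ({i, j, k} : Finset (Fin 4)).card = 3 :=
    Finset.card_eq_three.mpr ⟨i, j, k, hij, hik, hjk, rfl⟩
  have hijT : ({i, j} : Finset (Fin 4)) ⊆ {i, j, k} := by intro a; simp; tauto
  have hikT : ({i, k} : Finset (Fin 4)) ⊆ {i, j, k} := by intro a; simp; tauto
  have hjkT : ({j, k} : Finset (Fin 4)) ⊆ {i, j, k} := Finset.subset_insert _ _
  have hxm : ∀ S ⊆ {i, j, k}, S.Nonempty → x ∈ F S := by
    rintro S hS ⟨a, ha⟩
    have : F {a} = Submodule.span K {x} := by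
      have := hS ha
      simp only [Finset.mem_insert, Finset.mem_singleton] at this
      rcases this with rfl | rfl | rfl
      exacts [hx, hpj.trans hx, hpk.trans hx]
    exact hF.mem_of_span ha hS this
  have hline : ∀ {S : Finset (Fin 4)} {y z : Fin 4 → K}, S ⊆ {i, j, k} → S.card = 2 → y ∈ F S →
      z ∈ F S → z ∉ Submodule.span K {y} → y ≠ 0 → F S = Submodule.span K {y, z} := by
    intro S y z hS hc hy hz hzx hy0
    refine (hF.eq_of_le hS (Submodule.span_le.mpr ?_) ?_).symm
    · rintro w (rfl | rfl) <;> assumption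
    · have h' := finrank_span_singleton (K := K) hy0
      rw [Set.pair_comm, Set.insert_eq, Submodule.span_union, sup_comm,
        Submodule.finrank_sup_span_singleton hzx, h', hc]
  obtain ⟨z, hz, hzx⟩ := hF.exists_notMem (S := {j, k}) (U := F {i}) hjkT (by
    rw [hF.finrank_eq {i} (by simp), Finset.card_pair hjk]; simp)
  have hsup : F {i, j} ⊔ F {i, k} = F {i, j, k} := by
    have hlt : F {i, j} < F {i, j} ⊔ F {i, k} := le_sup_left.lt_of_ne fun h => hl (by
      refine (hF.eq_of_le hijT (h ▸ le_sup_right) ?_).symm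
      rw [hF.finrank_eq _ hikT, Finset.card_pair hij, Finset.card_pair hik])
    have h3 := Submodule.finrank_lt_finrank_of_lt hlt
    rw [hF.finrank_eq _ hijT, Finset.card_pair hij] at h3
    refine Submodule.eq_of_le_of_finrank_le
      (sup_le (hF.mono _ _ hijT subset_rfl) (hF.mono _ _ hikT subset_rfl)) ?_
    rw [hF.finrank_eq _ subset_rfl, hT3]
    exact h3
  -- The third line contains `z = v - w` with `v` and `w` in the first two lines, and is therefore
  -- the limit of the lines through `x + t v` and `x + t w`.
  obtain ⟨v, hv, w', hw', rfl⟩ := Submodule.mem_sup.mp (show z ∈ F {i, j} ⊔ F {i, k} by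
    rw [hsup]; exact hF.mono _ _ hjkT subset_rfl hz)
  obtain ⟨w, rfl⟩ : ∃ w, w' = -w := ⟨-w', by simp⟩
  have hw : w ∈ F {i, k} := by simpa using hw'
  rw [hx] at hzx
  have hvx : v ∉ Submodule.span K {x} := fun h => h2 (by
    have hmem : v + -w ∈ F {i, k} := Submodule.add_mem _ ((Submodule.span_singleton_le_iff_mem _ _).mpr
      (hxm _ hikT (by simp)) h) hw'
    rw [hline hjkT (Finset.card_pair hjk) (hxm _ hjkT (by simp)) hz hzx hx0,
      hline hikT (Finset.card_pair hik) (hxm _ hikT (by simp)) hmem hzx hx0])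
  have hwa : w ∉ F {i, j} := fun h => h1 (by
    have hmem : v + -w ∈ F {i, j} := Submodule.add_mem _ hv (Submodule.neg_mem _ h)
    rw [hline hjkT (Finset.card_pair hjk) (hxm _ hjkT (by simp)) hz hzx hx0,
      hline hijT (Finset.card_pair hij) (hxm _ hijT (by simp)) hmem hzx hx0])
  have hwx : w ∉ Submodule.span K {x} := fun h => hwa
    ((Submodule.span_singleton_le_iff_mem _ _).mpr (hxm _ hijT (by simp)) h)
  let c : K → Fin 4 → (Fin 4 → K) := fun t =>
    Function.update (Function.update (fun _ => x) j (x + t • v)) k (x + t • w)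
  have hci : ∀ t, c t i = x := fun t => by simp [c, hik, hij]
  have hcj : ∀ t, c t j = x + t • v := fun t => by simp [c, hjk]
  have hck : ∀ t, c t k = x + t • w := fun t => by simp [c]
  have hmem : ∀ (t : K) (S : Finset (Fin 4)) (a : Fin 4), a ∈ S →
      c t a ∈ Submodule.span K (c t '' (S : Set (Fin 4))) := fun t S a ha =>
    Submodule.subset_span ⟨a, ha, rfl⟩
  refine mem_closure_of_tendsto_family (l := 𝓝[≠] (0 : K))
    (fun t S => Submodule.span K (c t '' (S : Set (Fin 4)))) ?_ ?_
  · filter_upwards [self_mem_nhdsWithin] with t ht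
    refine subset_closure ⟨c t, ?_, fun S _ => rfl⟩
    have l1 : LinearIndepOn K (c t) {i} := LinearIndepOn.singleton (by rw [hci]; exact hx0)
    have l2 : LinearIndepOn K (c t) (insert j {i}) := l1.insert (by
      rw [Set.image_singleton, hcj, hci]
      intro h
      have : t • v ∈ Submodule.span K {x} := by
        have := Submodule.sub_mem _ h (Submodule.mem_span_singleton_self x)
        rwa [add_sub_cancel_left] at this
      exact hvx ((Submodule.smul_mem_iff _ ht).mp this))
    have l3 : LinearIndepOn K (c t) (insert k (insert j {i})) := l2.insert (by
      rw [Set.image_insert_eq, Set.image_singleton, hci, hcj, hck]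
      intro h
      have hle : Submodule.span K {x + t • v, x} ≤ F {i, j} := by
        rw [Submodule.span_le]
        have hxa := hxm _ hijT (by simp)
        rintro y (rfl | rfl)
        · exact Submodule.add_mem _ hxa (Submodule.smul_mem _ _ hv)
        · exact hxa
      have : t • w ∈ F {i, j} := by
        have := Submodule.sub_mem _ (hle h) (hxm _ hijT (by simp))
        rwa [add_sub_cancel_left] at this
      exact hwa ((Submodule.smul_mem_iff _ ht).mp this))
    have : (({i, j, k} : Finset (Fin 4)) : Set (Fin 4)) = insert k (insert j {i}) := by
      ext a; simp; tauto
    rw [this]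
    exact l3
  · intro S hS
    have hdim : ∀ t, finrank K (Submodule.span K (c t '' (S : Set (Fin 4)))) ≤ S.card :=
      fun t => finrank_span_image_le _ _
    have hd0 := hF.finrank_eq S hS
    rcases subset_triple_cases' i j k S hS with
      rfl | rfl | rfl | rfl | rfl | rfl | rfl | rfl
    · simp [hF.eq_bot, tendsto_const_nhds]
    · exact tendsto_of_vec (fun _ => x) (by fun_prop)
        (fun t _ => by rw [← hci t]; exact hmem t _ i (by simp)) hdim hx.le hd0
    · exact tendsto_of_vec (fun t => x + t • v) (by fun_prop)
        (fun t _ => by rw [← hcj t]; exact hmem t _ j (by simp)) hdim (by simp [hpj, hx]) hd0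
    · exact tendsto_of_vec (fun t => x + t • w) (by fun_prop)
        (fun t _ => by rw [← hck t]; exact hmem t _ k (by simp)) hdim (by simp [hpk, hx]) hd0
    · rw [Finset.card_pair hij] at hdim hd0
      refine tendsto_of_two_vecs (fun _ => x) (fun _ => v) (by fun_prop) (by fun_prop)
        (fun t ht => ?_) hdim (hline hS (Finset.card_pair hij) (hxm _ hS (by simp)) hv hvx hx0).le hd0
      have m1 := hmem t {i, j} i (by simp)
      have m2 := hmem t {i, j} j (by simp)
      rw [hci] at m1
      rw [hcj] at m2
      refine ⟨m1, (Submodule.smul_mem_iff _ ht).mp ?_⟩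
      have := Submodule.sub_mem _ m2 m1
      rwa [add_sub_cancel_left] at this
    · rw [Finset.card_pair hik] at hdim hd0
      refine tendsto_of_two_vecs (fun _ => x) (fun _ => w) (by fun_prop) (by fun_prop)
        (fun t ht => ?_) hdim (hline hS (Finset.card_pair hik) (hxm _ hS (by simp)) hw hwx hx0).le hd0
      have m1 := hmem t {i, k} i (by simp)
      have m2 := hmem t {i, k} k (by simp)
      rw [hci] at m1
      rw [hck] at m2
      refine ⟨m1, (Submodule.smul_mem_iff _ ht).mp ?_⟩
      have := Submodule.sub_mem _ m2 m1
      rwa [add_sub_cancel_left] at this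
    · rw [Finset.card_pair hjk] at hdim hd0
      refine tendsto_of_two_vecs (fun t => x + t • v) (fun _ => v + -w) (by fun_prop)
        (by fun_prop) (fun t ht => ?_) hdim ?_ hd0
      · have m1 := hmem t {j, k} j (by simp)
        have m2 := hmem t {j, k} k (by simp)
        rw [hcj] at m1
        rw [hck] at m2
        refine ⟨m1, (Submodule.smul_mem_iff _ ht).mp ?_⟩
        have := Submodule.sub_mem _ m1 m2
        rwa [add_sub_add_left_eq_sub, ← smul_sub, sub_eq_add_neg] at this
      · rw [zero_smul, add_zero]
        exact (hline hS (Finset.card_pair hjk) (hxm _ hS (by simp)) hz hzx hx0).le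
    · rw [hT3] at hdim hd0
      refine tendsto_of_three_vecs (fun _ => x) (fun _ => v) (fun _ => w) (by fun_prop)
        (by fun_prop) (by fun_prop) (fun t ht => ?_) hdim ?_ hd0
      · have m1 := hmem t {i, j, k} i (by simp)
        have m2 := hmem t {i, j, k} j (by simp)
        have m3 := hmem t {i, j, k} k (by simp)
        rw [hci] at m1
        rw [hcj] at m2
        rw [hck] at m3
        refine ⟨m1, (Submodule.smul_mem_iff _ ht).mp ?_, (Submodule.smul_mem_iff _ ht).mp ?_⟩
        · have := Submodule.sub_mem _ m2 m1
          rwa [add_sub_cancel_left] at this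
        · have := Submodule.sub_mem _ m3 m1
          rwa [add_sub_cancel_left] at this
      · rw [← hsup, hline hijT (Finset.card_pair hij) (hxm _ hijT (by simp)) hv hvx hx0,
          hline hikT (Finset.card_pair hik) (hxm _ hikT (by simp)) hw hwx hx0]
        refine sup_le (Submodule.span_mono ?_) (Submodule.span_mono ?_) <;> intro y <;> simp <;>
          tauto

lemma triangle_of_points_eq (hij : i ≠ j) (hik : i ≠ k) (hjk : j ≠ k)
    (hF : IsConfig {i, j, k} F) (hpj : F {j} = F {i}) (hpk : F {k} = F {i})
    (hl : F {i, j} ≠ F {i, k}) : F ∈ closure (frameFamilies K {i, j, k}) := by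
  by_cases h1 : F {j, k} = F {i, j}
  · exact triangle_of_points_eq_of_eq hij hik hjk hF hpj hl h1
  by_cases h2 : F {j, k} = F {i, k}
  · have hT : ({i, j, k} : Finset (Fin 4)) = {i, k, j} := by ext a; simp; tauto
    rw [hT] at hF ⊢
    exact triangle_of_points_eq_of_eq hik hij hjk.symm hF hpk hl.symm (by
      rw [Finset.pair_comm, h2])
  exact triangle_of_points_eq_of_distinct hij hik hjk hF hpj hpk hl h1 h2

/-- In the plane every type-preserving image of a triangle is a limit of triangles. -/
lemma triangle_mem_closure (hij : i ≠ j) (hik : i ≠ k) (hjk : j ≠ k)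
    (hF : IsConfig {i, j, k} F) : F ∈ closure (frameFamilies K {i, j, k}) := by
  have hijT : ({i, j} : Finset (Fin 4)) ⊆ {i, j, k} := by intro a; simp; tauto
  have hikT : ({i, k} : Finset (Fin 4)) ⊆ {i, j, k} := by intro a; simp; tauto
  have hjkT : ({j, k} : Finset (Fin 4)) ⊆ {i, j, k} := Finset.subset_insert _ _
  have hT1 : ({i, j, k} : Finset (Fin 4)) = {j, i, k} := by ext a; simp; tauto
  have hT2 : ({i, j, k} : Finset (Fin 4)) = {k, i, j} := by ext a; simp; tauto
  obtain ⟨x, hx0, hx⟩ := hF.exists_vec (i := i) (by simp)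
  obtain ⟨y, hy0, hy⟩ := hF.exists_vec (i := j) (by simp)
  obtain ⟨z, hz0, hz⟩ := hF.exists_vec (i := k) (by simp)
  -- If each point is on the opposite line, then the lines are all equal or the points are: two
  -- different lines meet in one point, and all three points are on both of them.
  by_cases hi : x ∈ F {j, k}
  swap
  · exact triangle_of_apex hij hik hjk hF hx hi
  by_cases hj : y ∈ F {i, k}
  swap
  · rw [hT1] at hF ⊢
    exact triangle_of_apex hij.symm hjk hik hF hy hj
  by_cases hk : z ∈ F {i, j}
  swap
  · rw [hT2] at hF ⊢
    exact triangle_of_apex hik.symm hjk.symm hij hF hz hk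
  rw [← Submodule.span_singleton_le_iff_mem] at hi hj hk
  rw [← hx] at hi
  rw [← hy] at hj
  rw [← hz] at hk
  have mi := hF.mono {i} {i, j} (by simp) hijT
  have mi' := hF.mono {i} {i, k} (by simp) hikT
  have mj := hF.mono {j} {i, j} (by simp) hijT
  have mj' := hF.mono {j} {j, k} (by simp) hjkT
  have mk := hF.mono {k} {i, k} (by simp) hikT
  have mk' := hF.mono {k} {j, k} (by simp) hjkT
  by_cases h1 : F {i, j} = F {i, k}
  · by_cases h2 : F {i, j} = F {j, k}
    · exact triangle_of_lines_eq hij hik hjk hF h1.symm h2.symm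
    · have e1 := hF.point_eq_of_mem_lines hijT hjkT (Finset.card_pair hij) (Finset.card_pair hjk) h2
        (a := i) (b := j) (by simp) (by simp) mi hi mj mj'
      have e2 := hF.point_eq_of_mem_lines hijT hjkT (Finset.card_pair hij) (Finset.card_pair hjk) h2
        (a := k) (b := j) (by simp) (by simp) hk mk' mj mj'
      rw [hT1] at hF ⊢
      exact triangle_of_points_eq hij.symm hjk hik hF e1 e2 (by rwa [Finset.pair_comm])
  · have e1 := hF.point_eq_of_mem_lines hijT hikT (Finset.card_pair hij) (Finset.card_pair hik) h1
      (a := j) (b := i) (by simp) (by simp) mj hj mi mi'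
    have e2 := hF.point_eq_of_mem_lines hijT hikT (Finset.card_pair hij) (Finset.card_pair hik) h1
      (a := k) (b := i) (by simp) (by simp) hk mk mi mi'
    exact triangle_of_points_eq hij hik hjk hF e1 e2 h1

end Triangle

/-! ### A point outside of the opposite plane -/

section Cone

variable {K : Type*} [NontriviallyNormedField K] [CompleteSpace K] {F : Family K}

lemma erase_univ_eq_triple : ∀ i : Fin 4, ∃ a b c : Fin 4, a ≠ b ∧ a ≠ c ∧ b ≠ c ∧
    Finset.univ.erase i = {a, b, c} := by decide

lemma exists_pair_superset : ∀ (i : Fin 4) (S : Finset (Fin 4)), i ∈ S → S ≠ Finset.univ →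
    ∃ S' : Finset (Fin 4), S.erase i ⊆ S' ∧ i ∉ S' ∧ S'.card = 2 := by decide

/-- If the point `F {i}` is not in the opposite plane, then the family is the join of this point
and a triangle in that plane. -/
lemma mem_closure_of_notMem_plane (hF : IsConfig Finset.univ F) {i : Fin 4} {x : Fin 4 → K}
    (hx : F {i} = Submodule.span K {x}) (h : x ∉ F (Finset.univ.erase i)) :
    F ∈ closure (frameFamilies K Finset.univ) := by
  classical
  have hx0 := hF.ne_zero (Finset.mem_univ i) hx
  have htri : F ∈ closure (frameFamilies K (Finset.univ.erase i)) := by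
    obtain ⟨a, b, c, hab, hac, hbc, hT⟩ : ∃ a b c : Fin 4, a ≠ b ∧ a ≠ c ∧ b ≠ c ∧
        Finset.univ.erase i = {a, b, c} := erase_univ_eq_triple i
    rw [hT]
    exact triangle_mem_closure hab hac hbc (hF.restrict (Finset.subset_univ _))
  -- the join of a family on the opposite plane with the fixed point `x`
  let J : Family K → Family K := fun G S =>
    if i ∈ S then G (S.erase i) ⊔ Submodule.span K {x} else G S
  have hlim : ∀ S, Tendsto (fun G => J G S) (𝓝[frameFamilies K (Finset.univ.erase i)] F)
      (𝓝 (F S)) := by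
    intro S
    have hev : ∀ S, Tendsto (fun G : Family K => G S)
        (𝓝[frameFamilies K (Finset.univ.erase i)] F) (𝓝 (F S)) := fun S =>
      ((continuous_apply S).tendsto F).mono_left nhdsWithin_le_nhds
    by_cases hi : i ∈ S
    · simp only [J, hi, if_true]
      have hn : x ∉ F (S.erase i) := fun hm => h (hF.mono _ _
        (Finset.erase_subset_erase i (Finset.subset_univ S)) (Finset.subset_univ _) hm)
      rw [← hF.sup_span_eq (Finset.subset_univ S) hi hx hn]
      exact tendsto_sup_right (hev _) tendsto_const_nhds
        (Submodule.disjoint_span_singleton_of_notMem hn)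
    · simp only [J, hi, if_false]
      exact hev S
  have : (𝓝[frameFamilies K (Finset.univ.erase i)] F).NeBot := mem_closure_iff_nhdsWithin_neBot.mp htri
  refine mem_closure_of_tendsto_family J ?_ fun S _ => hlim S
  -- the join of a nearby triangle with `x` still spans the space, so that it is an apartment
  have hfull : ∀ᶠ G in 𝓝[frameFamilies K (Finset.univ.erase i)] F,
      finrank K (J G Finset.univ) = 4 := by
    filter_upwards [(hlim Finset.univ).eventually (eventually_finrank_eq _)] with G hG
    rw [hG, hF.finrank_eq _ subset_rfl]
    simp
  filter_upwards [hfull, self_mem_nhdsWithin] with G hG hGT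
  obtain ⟨c, hc, hcG⟩ := hGT
  have hxG : x ∉ G (Finset.univ.erase i) := by
    intro hm
    have e : J G Finset.univ = G (Finset.univ.erase i) := by
      simp only [J, Finset.mem_univ, if_true]
      exact sup_eq_left.mpr ((Submodule.span_singleton_le_iff_mem _ _).mpr hm)
    rw [e, hcG _ subset_rfl, finrank_span_image hc] at hG
    simp at hG
  have himg : ∀ S : Finset (Fin 4), Function.update c i x '' ((S.erase i : Finset (Fin 4)) :
      Set (Fin 4)) = c '' ((S.erase i : Finset (Fin 4)) : Set (Fin 4)) := fun S =>
    Set.image_congr fun a ha => Function.update_of_ne (Finset.ne_of_mem_erase ha) _ _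
  refine subset_closure ⟨Function.update c i x, ?_, fun S _ => ?_⟩
  · have h1 : LinearIndepOn K (Function.update c i x)
        ((Finset.univ.erase i : Finset (Fin 4)) : Set (Fin 4)) :=
      hc.congr fun a ha => (Function.update_of_ne (Finset.ne_of_mem_erase ha) _ _).symm
    have h2 := h1.insert (x := i) (by
      rw [himg, Function.update_self, ← hcG _ subset_rfl]
      exact hxG)
    rwa [← Finset.coe_insert, Finset.insert_erase (Finset.mem_univ i)] at h2
  · by_cases hi : i ∈ S
    · simp only [J, hi, if_true]
      rw [hcG _ (Finset.erase_subset_erase i (Finset.subset_univ S))]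
      conv_rhs => rw [← Finset.insert_erase hi, Finset.coe_insert, Set.image_insert_eq, himg,
        Function.update_self, Set.insert_eq, Submodule.span_union, sup_comm]
    · simp only [J, hi, if_false]
      rw [hcG S (Finset.subset_erase.mpr ⟨Finset.subset_univ S, hi⟩), ← Finset.erase_eq_of_notMem hi,
        himg]

/-- If the point `F {i}` is on none of the three lines opposite to it, it can be moved out of the
opposite plane. -/
lemma mem_closure_of_notMem_lines (hF : IsConfig Finset.univ F) {i : Fin 4} {x : Fin 4 → K}
    (hx : F {i} = Submodule.span K {x})
    (h : ∀ S : Finset (Fin 4), i ∉ S → S.card = 2 → x ∉ F S) :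
    F ∈ closure (frameFamilies K Finset.univ) := by
  have hx0 := hF.ne_zero (Finset.mem_univ i) hx
  obtain ⟨v, -, hv⟩ := hF.exists_notMem (S := Finset.univ) (U := F (Finset.univ.erase i))
    subset_rfl (by rw [hF.finrank_eq _ (Finset.subset_univ _)]; simp)
  refine hF.mem_closure_of_movePoint (v := v) hx ?_ ?_
  · intro S _ hi hxS
    by_cases hS : S = Finset.univ
    · have : F Finset.univ = ⊤ := Submodule.eq_top_of_finrank_eq (by
        rw [hF.finrank_eq _ subset_rfl]; simp)
      rw [hS, this]; exact Submodule.mem_top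
    · obtain ⟨S', hS', hi', hc⟩ := exists_pair_superset i S hi hS
      exact absurd (hF.mono _ _ hS' (Finset.subset_univ _) hxS) (h S' hi' hc)
  · filter_upwards [eventually_add_smul_notMem (Or.inr hv)] with t ht hconf
    refine mem_closure_of_notMem_plane hconf (movePoint_singleton hF.eq_bot hx0) ?_
    rwa [movePoint_of_notMem (by simp)]

end Cone

/-! ### Two explicit degenerations of apartments -/

section Paths

lemma proper_subset_cases : ∀ S : Finset (Fin 4), S = ∅ ∨ S = Finset.univ ∨
    S = {0} ∨ S = {1} ∨ S = {2} ∨ S = {3} ∨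
    S = {0, 1} ∨ S = {0, 2} ∨ S = {0, 3} ∨ S = {1, 2} ∨ S = {1, 3} ∨ S = {2, 3} ∨
    S = {0, 1, 2} ∨ S = {0, 1, 3} ∨ S = {0, 2, 3} ∨ S = {1, 2, 3} := by decide

variable {K : Type*}

lemma span_pair_eq [Field K] {F : Family K} (hF : IsConfig Finset.univ F) {S : Finset (Fin 4)}
    (hS : S.card = 2) {y z : Fin 4 → K} (hy : y ∈ F S) (hz : z ∈ F S) (hy0 : y ≠ 0)
    (hzy : z ∉ Submodule.span K {y}) : F S = Submodule.span K {y, z} := by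
  refine (hF.eq_of_le (Finset.subset_univ _) (Submodule.span_le.mpr ?_) ?_).symm
  · rintro w (rfl | rfl) <;> assumption
  · rw [Set.pair_comm, Set.insert_eq, Submodule.span_union, sup_comm,
      Submodule.finrank_sup_span_singleton hzy, finrank_span_singleton hy0, hS]

lemma span_triple_eq [Field K] {F : Family K} (hF : IsConfig Finset.univ F) {S S' : Finset (Fin 4)}
    (hS : S.card = 2) (hS' : S'.card = 3) {y z w : Fin 4 → K} (h : F S = Submodule.span K {y, z})
    (hle : F S ≤ F S') (hw : w ∈ F S') (hwS : w ∉ F S) : F S' = Submodule.span K {y, z, w} := by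
  have e : Submodule.span K {y, z, w} = F S ⊔ Submodule.span K {w} := by
    rw [h, ← Submodule.span_union]
    congr 1
    ext u; simp; tauto
  refine (hF.eq_of_le (Finset.subset_univ _) ?_ ?_).symm
  · rw [e]
    exact sup_le hle ((Submodule.span_singleton_le_iff_mem _ _).mpr hw)
  · rw [e, Submodule.finrank_sup_span_singleton hwS, hF.finrank_eq S (Finset.subset_univ _), hS, hS']

variable [NontriviallyNormedField K]

/-- A configuration is a limit of apartments if it is the limit along a path of bases. -/
lemma mem_closure_of_path {F : Family K} (hF : IsConfig Finset.univ F)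
    (c : K → Fin 4 → (Fin 4 → K)) (hc : ∀ t ≠ 0, ⊤ ≤ Submodule.span K (Set.range (c t)))
    (h : ∀ S : Finset (Fin 4), S.Nonempty → S ≠ Finset.univ →
      Tendsto (fun t => Submodule.span K (c t '' (S : Set (Fin 4)))) (𝓝[≠] 0) (𝓝 (F S))) :
    F ∈ closure (frameFamilies K Finset.univ) := by
  refine mem_closure_of_tendsto_family (l := 𝓝[≠] (0 : K))
    (fun t S => Submodule.span K (c t '' (S : Set (Fin 4)))) ?_ ?_
  · filter_upwards [self_mem_nhdsWithin] with t ht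
    refine subset_closure ⟨c t, ?_, fun S _ => rfl⟩
    rw [Finset.coe_univ, linearIndepOn_univ_iff]
    exact linearIndependent_of_top_le_span_of_card_eq_finrank (hc t ht) (by simp)
  · intro S _
    by_cases h0 : S = ∅
    · subst h0
      simp only [Finset.coe_empty, Set.image_empty, Submodule.span_empty, hF.eq_bot]
      exact tendsto_const_nhds
    by_cases h1 : S = Finset.univ
    · subst h1
      have hu : F Finset.univ = ⊤ := Submodule.eq_top_of_finrank_eq (by
        rw [hF.finrank_eq _ subset_rfl]; simp)
      rw [hu]
      refine Tendsto.congr' ?_ tendsto_const_nhds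
      filter_upwards [self_mem_nhdsWithin] with t ht
      rw [Finset.coe_univ, Set.image_univ]
      exact (top_le_iff.mp (hc t ht)).symm
    · exact h S (Finset.nonempty_iff_ne_empty.mpr h0) h1

variable [CompleteSpace K]

/-- All points lie on the line `⟨e, f⟩`, all planes contain it, and it is the only line apart from
`⟨e, d⟩`. -/
lemma mem_closure_of_one_line_frame {F : Family K} (hF : IsConfig Finset.univ F)
    {e f d w : Fin 4 → K} (hspan : ⊤ ≤ Submodule.span K {e, f, d, w})
    (h0 : F {0} = Submodule.span K {e}) (h1 : F {1} = Submodule.span K {e})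
    (h2 : F {2} = Submodule.span K {f}) (h3 : F {3} = Submodule.span K {e + f})
    (h01 : F {0, 1} = Submodule.span K {e, d})
    (h02 : F {0, 2} = Submodule.span K {e, f}) (h03 : F {0, 3} = Submodule.span K {e, f})
    (h12 : F {1, 2} = Submodule.span K {e, f}) (h13 : F {1, 3} = Submodule.span K {e, f})
    (h23 : F {2, 3} = Submodule.span K {e, f})
    (h012 : F {0, 1, 2} = Submodule.span K {e, f, d})
    (h013 : F {0, 1, 3} = Submodule.span K {e, f, d})
    (h023 : F {0, 2, 3} = Submodule.span K {e, f, w})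
    (h123 : F {1, 2, 3} = Submodule.span K {e, f, w + d}) :
    F ∈ closure (frameFamilies K Finset.univ) := by
  -- The difference of the first two vectors is `t d`, so that their line tends to `⟨e, d⟩`; in the
  -- same way, combinations of three vectors are `t` times `d`, `w` and `w + d`, which gives the limits
  -- of the planes. All other pairs of vectors stay independent for `t = 0`.
  let c : K → Fin 4 → (Fin 4 → K) := fun t => ![e, e - t • d, f, e + f + t • w]
  have hmem : ∀ (t : K) (S : Finset (Fin 4)) (a : Fin 4), a ∈ S →
      c t a ∈ Submodule.span K (c t '' (S : Set (Fin 4))) := fun t S a ha =>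
    Submodule.subset_span ⟨a, ha, rfl⟩
  have m0 : ∀ (t : K) (S : Finset (Fin 4)), 0 ∈ S →
    e ∈ Submodule.span K (c t '' (S : Set (Fin 4))) := fun t S h => hmem t S 0 h
  have m1 : ∀ (t : K) (S : Finset (Fin 4)), 1 ∈ S →
    e - t • d ∈ Submodule.span K (c t '' (S : Set (Fin 4))) := fun t S h => hmem t S 1 h
  have m2 : ∀ (t : K) (S : Finset (Fin 4)), 2 ∈ S →
    f ∈ Submodule.span K (c t '' (S : Set (Fin 4))) := fun t S h => hmem t S 2 h
  have m3 : ∀ (t : K) (S : Finset (Fin 4)), 3 ∈ S →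
    e + f + t • w ∈ Submodule.span K (c t '' (S : Set (Fin 4))) := fun t S h => hmem t S 3 h
  have md : ∀ t : K, t ≠ 0 → ∀ S : Finset (Fin 4), 0 ∈ S → 1 ∈ S →
      d ∈ Submodule.span K (c t '' (S : Set (Fin 4))) := fun t ht S hS0 hS1 => by
    refine (Submodule.smul_mem_iff _ ht).mp ?_
    have := Submodule.sub_mem _ (m0 t S hS0) (m1 t S hS1)
    rwa [sub_sub_cancel] at this
  have mfw : ∀ (t : K) (S : Finset (Fin 4)), 0 ∈ S → 3 ∈ S →
      f + t • w ∈ Submodule.span K (c t '' (S : Set (Fin 4))) := fun t S hS0 hS3 => by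
    have := Submodule.sub_mem _ (m3 t S hS3) (m0 t S hS0)
    rwa [add_assoc, add_sub_cancel_left] at this
  have mew : ∀ (t : K) (S : Finset (Fin 4)), 2 ∈ S → 3 ∈ S →
      e + t • w ∈ Submodule.span K (c t '' (S : Set (Fin 4))) := fun t S hS2 hS3 => by
    have := Submodule.sub_mem _ (m3 t S hS3) (m2 t S hS2)
    rwa [add_right_comm, add_sub_cancel_right] at this
  have mw : ∀ t : K, t ≠ 0 → ∀ S : Finset (Fin 4), 0 ∈ S → 2 ∈ S → 3 ∈ S →
      w ∈ Submodule.span K (c t '' (S : Set (Fin 4))) := fun t ht S hS0 hS2 hS3 => by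
    refine (Submodule.smul_mem_iff _ ht).mp ?_
    have := Submodule.sub_mem _ (mew t S hS2 hS3) (m0 t S hS0)
    rwa [add_sub_cancel_left] at this
  have mwd : ∀ t : K, t ≠ 0 → ∀ S : Finset (Fin 4), 1 ∈ S → 2 ∈ S → 3 ∈ S →
      w + d ∈ Submodule.span K (c t '' (S : Set (Fin 4))) := fun t ht S hS1 hS2 hS3 => by
    refine (Submodule.smul_mem_iff _ ht).mp ?_
    have := Submodule.sub_mem _ (mew t S hS2 hS3) (m1 t S hS1)
    rwa [add_sub_sub_cancel, ← smul_add] at this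
  refine mem_closure_of_path hF c (fun t ht => hspan.trans (Submodule.span_le.mpr ?_)) ?_
  · rw [← Set.image_univ, ← Finset.coe_univ]
    rintro y (rfl | rfl | rfl | rfl)
    · exact m0 t _ (Finset.mem_univ _)
    · exact m2 t _ (Finset.mem_univ _)
    · exact md t ht _ (Finset.mem_univ _) (Finset.mem_univ _)
    · exact mw t ht _ (Finset.mem_univ _) (Finset.mem_univ _) (Finset.mem_univ _)
  · intro S hSne hSu
    have hdim : ∀ t, finrank K (Submodule.span K (c t '' (S : Set (Fin 4)))) ≤ S.card :=
      fun t => finrank_span_image_le _ _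
    have hd0 := hF.finrank_eq S (Finset.subset_univ _)
    rcases proper_subset_cases S with rfl | rfl | rfl | rfl | rfl | rfl | rfl | rfl | rfl | rfl |
      rfl | rfl | rfl | rfl | rfl | rfl
    · exact absurd hSne (by simp)
    · exact absurd rfl hSu
    · exact tendsto_of_vec (fun _ => e) (by fun_prop) (fun t _ => m0 t _ (by simp)) hdim h0.le hd0
    · exact tendsto_of_vec (fun t => e - t • d) (by fun_prop) (fun t _ => m1 t _ (by simp)) hdim
        (by simp [h1]) hd0
    · exact tendsto_of_vec (fun _ => f) (by fun_prop) (fun t _ => m2 t _ (by simp)) hdim h2.le hd0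
    · exact tendsto_of_vec (fun t => e + f + t • w) (by fun_prop) (fun t _ => m3 t _ (by simp)) hdim
        (by simp [h3]) hd0
    · exact tendsto_of_two_vecs (fun _ => e) (fun _ => d) (by fun_prop) (by fun_prop)
        (fun t ht => ⟨m0 t _ (by simp), md t ht _ (by simp) (by simp)⟩) hdim h01.le hd0
    · exact tendsto_of_two_vecs (fun _ => e) (fun _ => f) (by fun_prop) (by fun_prop)
        (fun t ht => ⟨m0 t _ (by simp), m2 t _ (by simp)⟩) hdim h02.le hd0
    · exact tendsto_of_two_vecs (fun _ => e) (fun t => f + t • w) (by fun_prop) (by fun_prop)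
        (fun t ht => ⟨m0 t _ (by simp), mfw t _ (by simp) (by simp)⟩) hdim (by simp [h03]) hd0
    · exact tendsto_of_two_vecs (fun t => e - t • d) (fun _ => f) (by fun_prop) (by fun_prop)
        (fun t ht => ⟨m1 t _ (by simp), m2 t _ (by simp)⟩) hdim (by simp [h12]) hd0
    · refine tendsto_of_two_vecs (fun t => e - t • d) (fun t => e + f + t • w) (by fun_prop)
        (by fun_prop) (fun t ht => ⟨m1 t _ (by simp), m3 t _ (by simp)⟩) hdim ?_ hd0
      rw [h13, zero_smul, zero_smul, sub_zero, add_zero, Submodule.span_le]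
      rintro y (rfl | rfl)
      · exact Submodule.subset_span (by simp)
      · have := Submodule.sub_mem (Submodule.span K {e, e + y}) (x := e + y) (y := e)
          (Submodule.subset_span (by simp)) (Submodule.subset_span (by simp))
        rwa [add_sub_cancel_left] at this
    · refine tendsto_of_two_vecs (fun t => e + t • w) (fun _ => f) (by fun_prop) (by fun_prop)
        (fun t ht => ⟨mew t _ (by simp) (by simp), m2 t _ (by simp)⟩) hdim (by simp [h23]) hd0
    · refine tendsto_of_three_vecs (fun _ => e) (fun _ => f) (fun _ => d) (by fun_prop)
        (by fun_prop) (by fun_prop)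
        (fun t ht => ⟨m0 t _ (by simp), m2 t _ (by simp), md t ht _ (by simp) (by simp)⟩) hdim
        h012.le hd0
    · refine tendsto_of_three_vecs (fun _ => e) (fun t => f + t • w) (fun _ => d) (by fun_prop)
        (by fun_prop) (by fun_prop)
        (fun t ht => ⟨m0 t _ (by simp), mfw t _ (by simp) (by simp),
          md t ht _ (by simp) (by simp)⟩) hdim (by simp [h013]) hd0
    · refine tendsto_of_three_vecs (fun _ => e) (fun _ => f) (fun _ => w) (by fun_prop)
        (by fun_prop) (by fun_prop)
        (fun t ht => ⟨m0 t _ (by simp), m2 t _ (by simp),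
          mw t ht _ (by simp) (by simp) (by simp)⟩) hdim h023.le hd0
    · refine tendsto_of_three_vecs (fun t => e - t • d) (fun _ => f) (fun _ => w + d) (by fun_prop)
        (by fun_prop) (by fun_prop)
        (fun t ht => ⟨m1 t _ (by simp), m2 t _ (by simp),
          mwd t ht _ (by simp) (by simp) (by simp)⟩) hdim (by simp [h123]) hd0

/-- Three coinciding points, joined by the line `⟨x, y⟩` and two other lines. -/
lemma mem_closure_of_two_lines_frame {F : Family K} (hF : IsConfig Finset.univ F)
    {x y v w : Fin 4 → K} (hspan : ⊤ ≤ Submodule.span K {x, y, v, w})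
    (h0 : F {0} = Submodule.span K {x}) (h1 : F {1} = Submodule.span K {x})
    (h2 : F {2} = Submodule.span K {x}) (h3 : F {3} = Submodule.span K {y})
    (h01 : F {0, 1} = Submodule.span K {x, v}) (h02 : F {0, 2} = Submodule.span K {x, v - y})
    (h03 : F {0, 3} = Submodule.span K {x, y}) (h12 : F {1, 2} = Submodule.span K {x, y})
    (h13 : F {1, 3} = Submodule.span K {x, y}) (h23 : F {2, 3} = Submodule.span K {x, y})
    (h012 : F {0, 1, 2} = Submodule.span K {x, y, v})
    (h013 : F {0, 1, 3} = Submodule.span K {x, y, v})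
    (h023 : F {0, 2, 3} = Submodule.span K {x, y, v})
    (h123 : F {1, 2, 3} = Submodule.span K {x, y, w}) :
    F ∈ closure (frameFamilies K Finset.univ) := by
  let c : K → Fin 4 → (Fin 4 → K) := fun t =>
    -- Dividing differences by `t` gives the limits of the lines through the first three points; the
    -- term of second order only matters for the plane through the last three points.
    ![x, x + t • v, x + t • (v - y) + (t * t) • w, y]
  have hmem : ∀ (t : K) (S : Finset (Fin 4)) (a : Fin 4), a ∈ S →
      c t a ∈ Submodule.span K (c t '' (S : Set (Fin 4))) := fun t S a ha =>
    Submodule.subset_span ⟨a, ha, rfl⟩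
  have m0 : ∀ (t : K) (S : Finset (Fin 4)), 0 ∈ S →
    x ∈ Submodule.span K (c t '' (S : Set (Fin 4))) := fun t S h => hmem t S 0 h
  have m1 : ∀ (t : K) (S : Finset (Fin 4)), 1 ∈ S →
    x + t • v ∈ Submodule.span K (c t '' (S : Set (Fin 4))) := fun t S h => hmem t S 1 h
  have m2 : ∀ (t : K) (S : Finset (Fin 4)), 2 ∈ S →
    x + t • (v - y) + (t * t) • w ∈ Submodule.span K (c t '' (S : Set (Fin 4))) :=
      fun t S h => hmem t S 2 h
  have m3 : ∀ (t : K) (S : Finset (Fin 4)), 3 ∈ S →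
    y ∈ Submodule.span K (c t '' (S : Set (Fin 4))) := fun t S h => hmem t S 3 h
  have mv : ∀ t : K, t ≠ 0 → ∀ S : Finset (Fin 4), 0 ∈ S → 1 ∈ S →
      v ∈ Submodule.span K (c t '' (S : Set (Fin 4))) := fun t ht S hS0 hS1 => by
    refine (Submodule.smul_mem_iff _ ht).mp ?_
    have := Submodule.sub_mem _ (m1 t S hS1) (m0 t S hS0)
    rwa [add_sub_cancel_left] at this
  have mvw : ∀ t : K, t ≠ 0 → ∀ S : Finset (Fin 4), 0 ∈ S → 2 ∈ S →
      v - y + t • w ∈ Submodule.span K (c t '' (S : Set (Fin 4))) := fun t ht S hS0 hS2 => by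
    refine (Submodule.smul_mem_iff _ ht).mp ?_
    have := Submodule.sub_mem _ (m2 t S hS2) (m0 t S hS0)
    rwa [add_assoc, add_sub_cancel_left, mul_smul, ← smul_add] at this
  have myw : ∀ t : K, t ≠ 0 → ∀ S : Finset (Fin 4), 1 ∈ S → 2 ∈ S →
      y - t • w ∈ Submodule.span K (c t '' (S : Set (Fin 4))) := fun t ht S hS1 hS2 => by
    refine (Submodule.smul_mem_iff _ ht).mp ?_
    have := Submodule.sub_mem _ (m1 t S hS1) (m2 t S hS2)
    have e : x + t • v - (x + t • (v - y) + (t * t) • w) = t • (y - t • w) := by module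
    rwa [e] at this
  have mw : ∀ t : K, t ≠ 0 → ∀ S : Finset (Fin 4), 1 ∈ S → 2 ∈ S → 3 ∈ S →
      w ∈ Submodule.span K (c t '' (S : Set (Fin 4))) := fun t ht S hS1 hS2 hS3 => by
    refine (Submodule.smul_mem_iff _ ht).mp ?_
    have := Submodule.sub_mem _ (m3 t S hS3) (myw t ht S hS1 hS2)
    rwa [sub_sub_cancel] at this
  refine mem_closure_of_path hF c (fun t ht => hspan.trans (Submodule.span_le.mpr ?_)) ?_
  · rw [← Set.image_univ, ← Finset.coe_univ]
    rintro z (rfl | rfl | rfl | rfl)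
    · exact m0 t _ (Finset.mem_univ _)
    · exact m3 t _ (Finset.mem_univ _)
    · exact mv t ht _ (Finset.mem_univ _) (Finset.mem_univ _)
    · exact mw t ht _ (Finset.mem_univ _) (Finset.mem_univ _) (Finset.mem_univ _)
  · intro S hSne hSu
    have hdim : ∀ t, finrank K (Submodule.span K (c t '' (S : Set (Fin 4)))) ≤ S.card :=
      fun t => finrank_span_image_le _ _
    have hd0 := hF.finrank_eq S (Finset.subset_univ _)
    have hvy : ∀ W : Submodule K (Fin 4 → K), v - y ∈ W → y ∈ W → v ∈ W := fun W h1 h2 => by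
      simpa using W.add_mem h1 h2
    rcases proper_subset_cases S with rfl | rfl | rfl | rfl | rfl | rfl | rfl | rfl | rfl | rfl |
      rfl | rfl | rfl | rfl | rfl | rfl
    · exact absurd hSne (by simp)
    · exact absurd rfl hSu
    · exact tendsto_of_vec (fun _ => x) (by fun_prop) (fun t _ => m0 t _ (by simp)) hdim h0.le hd0
    · exact tendsto_of_vec (fun t => x + t • v) (by fun_prop) (fun t _ => m1 t _ (by simp)) hdim
        (by simp [h1]) hd0
    · exact tendsto_of_vec (fun t => x + t • (v - y) + (t * t) • w) (by fun_prop)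
        (fun t _ => m2 t _ (by simp)) hdim (by simp [h2]) hd0
    · exact tendsto_of_vec (fun t => y) (by fun_prop) (fun t _ => m3 t _ (by simp)) hdim h3.le hd0
    · exact tendsto_of_two_vecs (fun _ => x) (fun _ => v) (by fun_prop) (by fun_prop)
        (fun t ht => ⟨m0 t _ (by simp), mv t ht _ (by simp) (by simp)⟩) hdim h01.le hd0
    · exact tendsto_of_two_vecs (fun _ => x) (fun t => v - y + t • w) (by fun_prop) (by fun_prop)
        (fun t ht => ⟨m0 t _ (by simp), mvw t ht _ (by simp) (by simp)⟩) hdim (by simp [h02]) hd0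
    · exact tendsto_of_two_vecs (fun _ => x) (fun _ => y) (by fun_prop) (by fun_prop)
        (fun t ht => ⟨m0 t _ (by simp), m3 t _ (by simp)⟩) hdim h03.le hd0
    · exact tendsto_of_two_vecs (fun t => x + t • v) (fun t => y - t • w) (by fun_prop)
        (by fun_prop) (fun t ht => ⟨m1 t _ (by simp), myw t ht _ (by simp) (by simp)⟩) hdim
        (by simp [h12]) hd0
    · exact tendsto_of_two_vecs (fun t => x + t • v) (fun _ => y) (by fun_prop)
        (by fun_prop) (fun t ht => ⟨m1 t _ (by simp), m3 t _ (by simp)⟩) hdim (by simp [h13]) hd0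
    · exact tendsto_of_two_vecs (fun t => x + t • (v - y) + (t * t) • w) (fun _ => y) (by fun_prop)
        (by fun_prop) (fun t ht => ⟨m2 t _ (by simp), m3 t _ (by simp)⟩) hdim (by simp [h23]) hd0
    · exact tendsto_of_three_vecs (fun _ => x) (fun t => y - t • w) (fun _ => v) (by fun_prop)
        (by fun_prop) (by fun_prop)
        (fun t ht => ⟨m0 t _ (by simp), myw t ht _ (by simp) (by simp),
          mv t ht _ (by simp) (by simp)⟩) hdim (by simp [h012]) hd0
    · exact tendsto_of_three_vecs (fun _ => x) (fun _ => y) (fun _ => v) (by fun_prop)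
        (by fun_prop) (by fun_prop)
        (fun t ht => ⟨m0 t _ (by simp), m3 t _ (by simp), mv t ht _ (by simp) (by simp)⟩) hdim
        h013.le hd0
    · refine tendsto_of_three_vecs (fun _ => x) (fun _ => y) (fun t => v - y + t • w) (by fun_prop)
        (by fun_prop) (by fun_prop)
        (fun t ht => ⟨m0 t _ (by simp), m3 t _ (by simp), mvw t ht _ (by simp) (by simp)⟩) hdim
        ?_ hd0
      rw [h023, zero_smul, add_zero, Submodule.span_le]
      rintro z (rfl | rfl | rfl)
      · exact Submodule.subset_span (by simp)
      · exact Submodule.subset_span (by simp)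
      · exact hvy _ (Submodule.subset_span (by simp)) (Submodule.subset_span (by simp))
    · exact tendsto_of_three_vecs (fun t => x + t • v) (fun _ => y) (fun _ => w) (by fun_prop)
        (by fun_prop) (by fun_prop)
        (fun t ht => ⟨m1 t _ (by simp), m3 t _ (by simp),
          mw t ht _ (by simp) (by simp) (by simp)⟩) hdim (by simp [h123]) hd0

end Paths

/-! ### Families with a single exceptional line -/

section OneLine

variable {K : Type*}

namespace IsConfig

variable [Field K] {F : Family K}

/-- Two lines through the same two distinct points are equal. -/
lemma line_eq {T : Finset (Fin 4)} (hF : IsConfig T F) {S S' : Finset (Fin 4)}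
    (hS : S ⊆ T) (hS' : S' ⊆ T) (hc : S.card = 2) (hc' : S'.card = 2) {a b : Fin 4}
    (ha : a ∈ T) (hb : b ∈ T) (hab : F {a} ≠ F {b}) (haS : F {a} ≤ F S) (haS' : F {a} ≤ F S')
    (hbS : F {b} ≤ F S) (hbS' : F {b} ≤ F S') : F S = F S' := by
  by_contra hne
  exact hab (hF.point_eq_of_mem_lines hS hS' hc hc' hne ha hb haS haS' hbS hbS')

lemma mono' (hF : IsConfig Finset.univ F) {S S' : Finset (Fin 4)} (h : S ⊆ S') : F S ≤ F S' :=
  hF.mono S S' h (Finset.subset_univ _)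

lemma rank (hF : IsConfig Finset.univ F) (S : Finset (Fin 4)) : finrank K (F S) = S.card :=
  hF.finrank_eq S (Finset.subset_univ _)

lemma top_le_span (hF : IsConfig Finset.univ F) {S : Finset (Fin 4)} (hS : S.card = 3)
    {x y z w : Fin 4 → K} (h : F S = Submodule.span K {x, y, z}) (hw : w ∉ F S) :
    ⊤ ≤ Submodule.span K {x, y, z, w} := by
  have e : Submodule.span K {x, y, z, w} = F S ⊔ Submodule.span K {w} := by
    rw [h, ← Submodule.span_union]
    congr 1
    ext u; simp; tauto
  refine (Submodule.eq_top_of_finrank_eq ?_).ge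
  rw [e, Submodule.finrank_sup_span_singleton hw, hF.rank, hS]
  simp

end IsConfig

/-- All lines apart from `F {0, 1}` are equal, the points `F {0}`, `F {1}` are equal, and so are the
planes through `F {0, 1}`. -/
structure OneLine [Field K] (F : Family K) : Prop where
  point : F {1} = F {0}
  plane : F {0, 1, 3} = F {0, 1, 2}
  line02 : F {0, 2} = F {2, 3}
  line03 : F {0, 3} = F {2, 3}
  line12 : F {1, 2} = F {2, 3}
  line13 : F {1, 3} = F {2, 3}

lemma OneLine.update [Field K] {F : Family K} (h : OneLine F) (S₀ : Finset (Fin 4))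
    (hS₀ : S₀ = {0, 1} ∨ S₀ = {2} ∨ S₀ = {3} ∨ S₀ = {0, 2, 3} ∨ S₀ = {1, 2, 3})
    (U : Submodule K (Fin 4 → K)) : OneLine (Function.update F S₀ U) := by
  have hne : ∀ S : Finset (Fin 4), S ≠ {0, 1} → S ≠ {2} → S ≠ {3} → S ≠ {0, 2, 3} → S ≠ {1, 2, 3} →
      Function.update F S₀ U S = F S := fun S h1 h2 h3 h4 h5 => by
    refine Function.update_of_ne ?_ _ _
    rcases hS₀ with rfl | rfl | rfl | rfl | rfl <;> assumption
  constructor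
  · rw [hne {0} (by decide) (by decide) (by decide) (by decide) (by decide),
      hne {1} (by decide) (by decide) (by decide) (by decide) (by decide), h.point]
  · rw [hne {0, 1, 2} (by decide) (by decide) (by decide) (by decide) (by decide),
      hne {0, 1, 3} (by decide) (by decide) (by decide) (by decide) (by decide), h.plane]
  all_goals rw [hne {2, 3} (by decide) (by decide) (by decide) (by decide) (by decide)]
  · rw [hne {0, 2} (by decide) (by decide) (by decide) (by decide) (by decide), h.line02]
  · rw [hne {0, 3} (by decide) (by decide) (by decide) (by decide) (by decide), h.line03]
  · rw [hne {1, 2} (by decide) (by decide) (by decide) (by decide) (by decide), h.line12]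
  · rw [hne {1, 3} (by decide) (by decide) (by decide) (by decide) (by decide), h.line13]

/-- Three distinct points on a line, in coordinates of the line. -/
lemma IsConfig.exists_line_frame {K : Type*} [Field K] {F : Family K}
    (hF : IsConfig Finset.univ F) {S : Finset (Fin 4)} (hS : S.card = 2) {i j k : Fin 4}
    (hi : F {i} ≤ F S) (hj : F {j} ≤ F S) (hk : F {k} ≤ F S)
    (hji : F {j} ≠ F {i}) (hki : F {k} ≠ F {i}) (hjk : F {j} ≠ F {k}) :
    ∃ e f, F {i} = Submodule.span K {e} ∧ F {j} = Submodule.span K {f} ∧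
      F {k} = Submodule.span K {e + f} ∧ F S = Submodule.span K {e, f} ∧
      f ∉ Submodule.span K {e} := by
  obtain ⟨e, he0, he⟩ := hF.exists_vec (Finset.mem_univ i)
  obtain ⟨f, hf0, hf⟩ := hF.exists_vec (Finset.mem_univ j)
  obtain ⟨g, hg0, hg⟩ := hF.exists_vec (Finset.mem_univ k)
  rw [he, Submodule.span_singleton_le_iff_mem] at hi
  rw [hf, Submodule.span_singleton_le_iff_mem] at hj
  rw [hg, Submodule.span_singleton_le_iff_mem] at hk
  have hfe : f ∉ Submodule.span K {e} := by
    rw [← he]; exact fun hm => hji (hF.point_eq_of_mem (Finset.mem_univ _) (Finset.mem_univ _) hf hm)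
  have hge : g ∉ Submodule.span K {e} := by
    rw [← he]; exact fun hm => hki (hF.point_eq_of_mem (Finset.mem_univ _) (Finset.mem_univ _) hg hm)
  have hgf : g ∉ Submodule.span K {f} := by
    rw [← hf]
    exact fun hm => hjk (hF.point_eq_of_mem (Finset.mem_univ _) (Finset.mem_univ _) hg hm).symm
  have hm := span_pair_eq hF hS hi hj he0 hfe
  obtain ⟨α, β, rfl⟩ := Submodule.mem_span_pair.mp (hm ▸ hk)
  have hα : α ≠ 0 := by
    rintro rfl
    exact hgf (Submodule.mem_span_singleton.mpr ⟨β, by rw [zero_smul, zero_add]⟩)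
  have hβ : β ≠ 0 := by
    rintro rfl
    exact hge (Submodule.mem_span_singleton.mpr ⟨α, by rw [zero_smul, add_zero]⟩)
  -- rescale the vectors, so that the third point is spanned by their sum
  have hn : β • f ∉ Submodule.span K {α • e} := by
    rw [Submodule.span_singleton_smul_eq (IsUnit.mk0 α hα)]
    exact fun h' => hfe ((Submodule.smul_mem_iff _ hβ).mp h')
  refine ⟨α • e, β • f, ?_, ?_, hg, ?_, hn⟩
  · rw [he, Submodule.span_singleton_smul_eq (IsUnit.mk0 α hα)]
  · rw [hf, Submodule.span_singleton_smul_eq (IsUnit.mk0 β hβ)]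
  · exact span_pair_eq hF hS (Submodule.smul_mem _ _ hi) (Submodule.smul_mem _ _ hj)
      (smul_ne_zero hα he0) hn

/-- A subspace that contains `e` and `f`, but is not contained in the hyperplane `⟨e, f, d⟩`, contains
a combination of `d` and `w` that involves `w`. -/
lemma exists_combination_mem {K E : Type*} [Field K] [AddCommGroup E] [Module K E]
    {e f d w u : E} {P R : Submodule K E} (htop : ⊤ ≤ Submodule.span K {e, f, d, w})
    (he : e ∈ P) (hf : f ∈ P) (hd : d ∈ P) (he' : e ∈ R) (hf' : f ∈ R) (hu : u ∈ R) (huP : u ∉ P) :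
    ∃ γ δ : K, δ ≠ 0 ∧ γ • d + δ • w ∈ R := by
  obtain ⟨a₁, z₁, hz₁, e₁⟩ := Submodule.mem_span_insert.mp (htop (Submodule.mem_top (x := u)))
  obtain ⟨a₂, z₂, hz₂, e₂⟩ := Submodule.mem_span_insert.mp hz₁
  obtain ⟨γ, δ, e₃⟩ := Submodule.mem_span_pair.mp hz₂
  refine ⟨γ, δ, ?_, ?_⟩
  · rintro rfl
    refine huP ?_
    rw [e₁, e₂, ← e₃, zero_smul, add_zero]
    exact add_mem (P.smul_mem _ he) (add_mem (P.smul_mem _ hf) (P.smul_mem _ hd))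
  · have h1 := sub_mem (sub_mem hu (R.smul_mem a₁ he')) (R.smul_mem a₂ hf')
    rwa [e₁, e₂, add_sub_cancel_left, add_sub_cancel_left, ← e₃] at h1

/-- Three distinct planes through a line, in coordinates of the quotient by the line, where the
first coordinate vector can be taken in a given line. -/
lemma IsConfig.exists_plane_frame {K : Type*} [Field K] {F : Family K}
    (hF : IsConfig Finset.univ F) {M L P Q R : Finset (Fin 4)} (hM : M.card = 2) (hL : L.card = 2)
    (hP : P.card = 3) (hQ : Q.card = 3) (hR : R.card = 3)
    {e f : Fin 4 → K} (hm : F M = Submodule.span K {e, f})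
    (hMP : F M ≤ F P) (hMQ : F M ≤ F Q) (hMR : F M ≤ F R) (hLP : F L ≤ F P) (hLM : F L ≠ F M)
    (hQP : F Q ≠ F P) (hRP : F R ≠ F P) (hRQ : F R ≠ F Q) :
    ∃ d w, d ∈ F L ∧ d ∉ F M ∧ ⊤ ≤ Submodule.span K {e, f, d, w} ∧
      F P = Submodule.span K {e, f, d} ∧ F Q = Submodule.span K {e, f, w} ∧
      F R = Submodule.span K {e, f, w + d} := by
  have hem : e ∈ F M := hm ▸ Submodule.subset_span (Set.mem_insert _ _)
  have hfm : f ∈ F M := hm ▸ Submodule.subset_span (Set.mem_insert_of_mem _ rfl)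
  obtain ⟨d, hd, hdm⟩ : ∃ d ∈ F L, d ∉ F M := by
    by_contra! hn
    exact hLM (hF.eq_of_le (Finset.subset_univ _) hn (by rw [hF.rank, hL, hM]))
  have hdP : d ∈ F P := hLP hd
  have hPs := span_triple_eq hF hM hP hm hMP hdP hdm
  obtain ⟨w, hw, hwP⟩ : ∃ w ∈ F Q, w ∉ F P := by
    by_contra! hn
    exact hQP (hF.eq_of_le (Finset.subset_univ _) hn (by rw [hF.rank, hQ, hP]))
  have hwm : w ∉ F M := fun h' => hwP (hMP h')
  have hQs := span_triple_eq hF hM hQ hm hMQ hw hwm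
  obtain ⟨u, hu, huP⟩ : ∃ u ∈ F R, u ∉ F P := by
    by_contra! hn
    exact hRP (hF.eq_of_le (Finset.subset_univ _) hn (by rw [hF.rank, hR, hP]))
  obtain ⟨γ, δ, hδ, hz'⟩ := exists_combination_mem (hF.top_le_span hP hPs hwP)
    (hMP hem) (hMP hfm) hdP (hMR hem) (hMR hfm) hu huP
  have hγ : γ ≠ 0 := by
    rintro rfl
    rw [zero_smul, zero_add] at hz'
    have hw' : w ∈ F R := (Submodule.smul_mem_iff _ hδ).mp hz'
    exact hRQ ((span_triple_eq hF hM hR hm hMR hw' hwm).trans hQs.symm)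
  have hγd : γ • d ∉ F M := fun h' => hdm ((Submodule.smul_mem_iff _ hγ).mp h')
  have hδw : δ • w ∉ F P := fun h' => hwP ((Submodule.smul_mem_iff _ hδ).mp h')
  have hP' := span_triple_eq hF hM hP hm hMP (Submodule.smul_mem _ γ hdP) hγd
  refine ⟨γ • d, δ • w, Submodule.smul_mem _ _ hd, hγd, hF.top_le_span hP hP' hδw, hP', ?_, ?_⟩
  · exact span_triple_eq hF hM hQ hm hMQ (Submodule.smul_mem _ _ hw)
      fun h' => hwm ((Submodule.smul_mem_iff _ hδ).mp h')
  · rw [add_comm]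
    refine span_triple_eq hF hM hR hm hMR hz' fun h' => hδw ?_
    have := Submodule.sub_mem _ (hMP h') (Submodule.smul_mem _ γ hdP)
    rwa [add_sub_cancel_left] at this

variable [NontriviallyNormedField K] [CompleteSpace K] {F : Family K}

/-- Distinct points on the common line, distinct planes through it, and a different exceptional line:
in suitable coordinates, this is the limit of `mem_closure_of_one_line_frame`. -/
lemma OneLine.mem_closure_of_generic (h : OneLine F) (hF : IsConfig Finset.univ F)
    (h20 : F {2} ≠ F {0}) (h30 : F {3} ≠ F {0}) (h23 : F {2} ≠ F {3}) (hl : F {0, 1} ≠ F {2, 3})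
    (hp1 : F {0, 2, 3} ≠ F {0, 1, 2}) (hp0 : F {1, 2, 3} ≠ F {0, 1, 2})
    (hp01 : F {1, 2, 3} ≠ F {0, 2, 3}) : F ∈ closure (frameFamilies K Finset.univ) := by
  obtain ⟨e, f, he, hf, hg, hm, hfe⟩ := hF.exists_line_frame (S := {2, 3}) (i := 0) (j := 2)
    (k := 3) (by decide) (h.line02 ▸ hF.mono' (by decide)) (hF.mono' (by decide))
    (hF.mono' (by decide)) h20 h30 h23
  have hmQ : F {2, 3} ≤ F {0, 1, 2} := by rw [← h.line02]; exact hF.mono' (by decide)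
  obtain ⟨d, w, hd, hdm, htop, hP, hQ, hR⟩ := hF.exists_plane_frame (M := {2, 3}) (L := {0, 1})
    (P := {0, 1, 2}) (Q := {0, 2, 3}) (R := {1, 2, 3}) (by decide) (by decide) (by decide)
    (by decide) (by decide) hm hmQ (hF.mono' (by decide)) (hF.mono' (by decide))
    (hF.mono' (by decide)) hl hp1 hp0 hp01
  refine mem_closure_of_one_line_frame hF htop he (h.point.trans he) hf hg ?_
    (h.line02.trans hm) (h.line03.trans hm) (h.line12.trans hm) (h.line13.trans hm) hm hP
    (h.plane.trans hP) hQ hR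
  refine span_pair_eq hF (S := {0, 1}) (by decide)
    (hF.mem_of_span (by simp) (Finset.subset_univ _) he) hd (hF.ne_zero (Finset.mem_univ _) he) ?_
  rw [← he]
  exact fun h' => hdm ((h.line02 ▸ hF.mono' (by decide) : F {0} ≤ F {2, 3}) h')

lemma ssubset_pair_cases : ∀ S : Finset (Fin 4), S ⊂ {0, 1} → S = ∅ ∨ S = {0} ∨ S = {1} := by decide

lemma ssuperset_pair_cases : ∀ S : Finset (Fin 4), {0, 1} ⊂ S →
    {0, 1, 2} ⊆ S ∨ {0, 1, 3} ⊆ S := by decide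

lemma ssuperset_two_cases : ∀ S : Finset (Fin 4), {2} ⊂ S →
    {0, 2} ⊆ S ∨ {1, 2} ⊆ S ∨ {2, 3} ⊆ S := by decide

lemma ssuperset_three_cases : ∀ S : Finset (Fin 4), {3} ⊂ S →
    {0, 3} ⊆ S ∨ {1, 3} ⊆ S ∨ {2, 3} ⊆ S := by decide

lemma ssubset_plane_cases : ∀ S : Finset (Fin 4), S ⊂ {0, 2, 3} →
    S ⊆ {0, 2} ∨ S ⊆ {0, 3} ∨ S ⊆ {2, 3} := by decide

lemma ssubset_plane_cases' : ∀ S : Finset (Fin 4), S ⊂ {1, 2, 3} →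
    S ⊆ {1, 2} ∨ S ⊆ {1, 3} ∨ S ⊆ {2, 3} := by decide

lemma ssuperset_plane : ∀ S : Finset (Fin 4), {0, 2, 3} ⊂ S ∨ {1, 2, 3} ⊂ S →
    S = Finset.univ := by decide

lemma IsConfig.univ_eq_top {K : Type*} [Field K] {F : Family K} (hF : IsConfig Finset.univ F) :
    F Finset.univ = ⊤ := Submodule.eq_top_of_finrank_eq (by rw [hF.rank]; simp)

/-- If all lines but one are equal, then the family is a limit of apartments: all points, planes
and the exceptional line can be moved to general position in their pencils. -/
lemma OneLine.mem_closure (h : OneLine F) (hF : IsConfig Finset.univ F) :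
    F ∈ closure (frameFamilies K Finset.univ) := by
  have plane_move : ∀ {F : Family K}, OneLine F → IsConfig Finset.univ F →
      ∀ S₀ : Finset (Fin 4), (S₀ = {0, 2, 3} ∨ S₀ = {1, 2, 3}) →
      ∀ Z : Set (Submodule K (Fin 4 → K)), Z.Finite →
      (∀ U, U ∉ Z → IsConfig Finset.univ (Function.update F S₀ U) →
        Function.update F S₀ U ∈ closure (frameFamilies K Finset.univ)) →
      F ∈ closure (frameFamilies K Finset.univ) := by
    intro F h hF S₀ hS₀ Z hZ hU
    refine hF.mem_closure_of_pencil (S₀ := S₀) (A := F {2, 3}) (B := ⊤) (Finset.subset_univ _)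
      ?_ ?_ (hF.mono' ?_) le_top ?_ ?_ Z hZ fun U _ _ _ hUZ hc => hU U hUZ hc
    · intro S hS
      rcases hS₀ with rfl | rfl
      · rcases ssubset_plane_cases S hS with h' | h' | h'
        · exact h.line02 ▸ hF.mono' h'
        · exact h.line03 ▸ hF.mono' h'
        · exact hF.mono' h'
      · rcases ssubset_plane_cases' S hS with h' | h' | h'
        · exact h.line12 ▸ hF.mono' h'
        · exact h.line13 ▸ hF.mono' h'
        · exact hF.mono' h'
    · intro S _ hS
      rw [ssuperset_plane S (by rcases hS₀ with rfl | rfl; exacts [Or.inl hS, Or.inr hS]),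
        hF.univ_eq_top]
    · rcases hS₀ with rfl | rfl <;> decide
    · rw [hF.rank]; rcases hS₀ with rfl | rfl <;> rfl
    · rcases hS₀ with rfl | rfl <;> simp
  have point_move : ∀ {F : Family K}, OneLine F → IsConfig Finset.univ F →
      ∀ S₀ : Finset (Fin 4), (S₀ = {2} ∨ S₀ = {3}) →
      ∀ Z : Set (Submodule K (Fin 4 → K)), Z.Finite →
      (∀ U, U ∉ Z → IsConfig Finset.univ (Function.update F S₀ U) →
        Function.update F S₀ U ∈ closure (frameFamilies K Finset.univ)) →
      F ∈ closure (frameFamilies K Finset.univ) := by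
    intro F h hF S₀ hS₀ Z hZ hU
    refine hF.mem_closure_of_pencil (S₀ := S₀) (A := ⊥) (B := F {2, 3}) (Finset.subset_univ _)
      ?_ ?_ bot_le (hF.mono' ?_) ?_ ?_ Z hZ fun U _ _ _ hUZ hc => hU U hUZ hc
    · intro S hS
      rw [show S = ∅ by rcases hS₀ with rfl | rfl <;> exact Finset.ssubset_singleton_iff.mp hS,
        hF.eq_bot]
    · intro S _ hS
      rcases hS₀ with rfl | rfl
      · rcases ssuperset_two_cases S hS with h' | h' | h'
        · exact h.line02 ▸ hF.mono' h'
        · exact h.line12 ▸ hF.mono' h'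
        · exact hF.mono' h'
      · rcases ssuperset_three_cases S hS with h' | h' | h'
        · exact h.line03 ▸ hF.mono' h'
        · exact h.line13 ▸ hF.mono' h'
        · exact hF.mono' h'
    · rcases hS₀ with rfl | rfl <;> decide
    · rcases hS₀ with rfl | rfl <;> simp
    · rw [hF.rank]; rcases hS₀ with rfl | rfl <;> rfl
  have line_move : ∀ {F : Family K}, OneLine F → IsConfig Finset.univ F →
      ∀ Z : Set (Submodule K (Fin 4 → K)), Z.Finite →
      (∀ U, U ∉ Z → IsConfig Finset.univ (Function.update F {0, 1} U) →
        Function.update F {0, 1} U ∈ closure (frameFamilies K Finset.univ)) →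
      F ∈ closure (frameFamilies K Finset.univ) := by
    intro F h hF Z hZ hU
    refine hF.mem_closure_of_pencil (S₀ := {0, 1}) (A := F {0}) (B := F {0, 1, 2})
      (Finset.subset_univ _) ?_ ?_ (hF.mono' (by decide)) (hF.mono' (by decide)) ?_ ?_ Z hZ
      fun U _ _ _ hUZ hc => hU U hUZ hc
    · intro S hS
      rcases ssubset_pair_cases S hS with rfl | rfl | rfl
      · rw [hF.eq_bot]; exact bot_le
      · exact le_rfl
      · exact h.point.le
    · intro S _ hS
      rcases ssuperset_pair_cases S hS with h' | h'
      · exact hF.mono' h'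
      · exact h.plane ▸ hF.mono' h'
    · rw [hF.rank]; rfl
    · rw [hF.rank]; rfl
  -- the plane `{1, 2, 3}` is moved away from the planes through the exceptional line
  refine plane_move h hF {1, 2, 3} (Or.inr rfl) {F {0, 1, 2}} (Set.toFinite _) fun P₀ hP₀ hF₁ => ?_
  have h₁ := h.update {1, 2, 3} (by decide) P₀
  have e₁ : Function.update F {1, 2, 3} P₀ {1, 2, 3} ≠
      Function.update F {1, 2, 3} P₀ {0, 1, 2} := by
    rw [Function.update_self, Function.update_of_ne (by decide)]; exact hP₀
  generalize Function.update F {1, 2, 3} P₀ = F₁ at h₁ hF₁ e₁ ⊢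
  -- the plane `{0, 2, 3}` is moved away from the other planes
  refine plane_move h₁ hF₁ {0, 2, 3} (Or.inl rfl) {F₁ {0, 1, 2}, F₁ {1, 2, 3}} (Set.toFinite _)
    fun P₁ hP₁ hF₂ => ?_
  simp only [Set.mem_insert_iff, Set.mem_singleton_iff, not_or] at hP₁
  have h₂ := h₁.update {0, 2, 3} (by decide) P₁
  have e₂ : Function.update F₁ {0, 2, 3} P₁ {1, 2, 3} ≠
      Function.update F₁ {0, 2, 3} P₁ {0, 1, 2} := by
    rwa [Function.update_of_ne (by decide), Function.update_of_ne (by decide)]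
  have e₂' : Function.update F₁ {0, 2, 3} P₁ {0, 2, 3} ≠
      Function.update F₁ {0, 2, 3} P₁ {0, 1, 2} := by
    rw [Function.update_self, Function.update_of_ne (by decide)]; exact hP₁.1
  have e₂'' : Function.update F₁ {0, 2, 3} P₁ {1, 2, 3} ≠
      Function.update F₁ {0, 2, 3} P₁ {0, 2, 3} := by
    rw [Function.update_self, Function.update_of_ne (by decide)]; exact Ne.symm hP₁.2
  generalize Function.update F₁ {0, 2, 3} P₁ = F₂ at h₂ hF₂ e₂ e₂' e₂'' ⊢
  -- the point `3` and then the point `2` are moved along the common line to separate the points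
  refine point_move h₂ hF₂ {3} (Or.inr rfl) {F₂ {0}} (Set.toFinite _) fun X₃ hX₃ hF₃ => ?_
  have h₃ := h₂.update {3} (by decide) X₃
  have e₃ : Function.update F₂ {3} X₃ {3} ≠ Function.update F₂ {3} X₃ {0} := by
    rw [Function.update_self, Function.update_of_ne (by decide)]; exact hX₃
  have n₃ : ∀ S : Finset (Fin 4), S.card = 3 → Function.update F₂ {3} X₃ S = F₂ S := fun S hS =>
    Function.update_of_ne (by rintro rfl; simp at hS) _ _
  rw [← n₃ _ rfl, ← n₃ {0, 1, 2} rfl] at e₂ e₂'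
  rw [← n₃ _ rfl, ← n₃ {0, 2, 3} rfl] at e₂''
  generalize Function.update F₂ {3} X₃ = F₃ at h₃ hF₃ e₂ e₂' e₂'' e₃ ⊢
  refine point_move h₃ hF₃ {2} (Or.inl rfl) {F₃ {0}, F₃ {3}} (Set.toFinite _) fun X₂ hX₂ hF₄ => ?_
  simp only [Set.mem_insert_iff, Set.mem_singleton_iff, not_or] at hX₂
  have h₄ := h₃.update {2} (by decide) X₂
  have e₄ : Function.update F₃ {2} X₂ {2} ≠ Function.update F₃ {2} X₂ {0} := by
    rw [Function.update_self, Function.update_of_ne (by decide)]; exact hX₂.1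
  have e₄' : Function.update F₃ {2} X₂ {2} ≠ Function.update F₃ {2} X₂ {3} := by
    rw [Function.update_self, Function.update_of_ne (by decide)]; exact hX₂.2
  have n₄ : ∀ S : Finset (Fin 4), S ≠ {2} → Function.update F₃ {2} X₂ S = F₃ S := fun S hS =>
    Function.update_of_ne hS _ _
  rw [← n₄ _ (by decide), ← n₄ {0, 1, 2} (by decide)] at e₂ e₂'
  rw [← n₄ _ (by decide), ← n₄ {0, 2, 3} (by decide)] at e₂''
  rw [← n₄ _ (by decide), ← n₄ {0} (by decide)] at e₃
  generalize Function.update F₃ {2} X₂ = F₄ at h₄ hF₄ e₂ e₂' e₂'' e₃ e₄ e₄' ⊢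
  -- the exceptional line is moved away from the common line
  refine line_move h₄ hF₄ {F₄ {2, 3}} (Set.toFinite _) fun L hL hF₅ => ?_
  have n₅ : ∀ S : Finset (Fin 4), S ≠ {0, 1} → Function.update F₄ {0, 1} L S = F₄ S := fun S hS =>
    Function.update_of_ne hS _ _
  refine (h₄.update {0, 1} (by decide) L).mem_closure_of_generic hF₅ ?_ ?_ ?_ ?_ ?_ ?_ ?_
  · rwa [n₅ _ (by decide), n₅ _ (by decide)]
  · rwa [n₅ _ (by decide), n₅ _ (by decide)]
  · rwa [n₅ _ (by decide), n₅ _ (by decide)]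
  · rw [Function.update_self, n₅ _ (by decide)]; exact hL
  · rwa [n₅ _ (by decide), n₅ _ (by decide)]
  · rwa [n₅ _ (by decide), n₅ _ (by decide)]
  · rwa [n₅ _ (by decide), n₅ _ (by decide)]

end OneLine

/-! ### Families whose points are not all equal -/

section PointsNotEqual

variable {K : Type*}

lemma relabel_singleton [NontriviallyNormedField K] (σ : Equiv.Perm (Fin 4)) (F : Family K) (i : Fin 4) :
    relabel σ F {i} = F {σ i} := by simp [relabel]

lemma relabel_pair [NontriviallyNormedField K] (σ : Equiv.Perm (Fin 4)) (F : Family K) (i j : Fin 4) :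
    relabel σ F {i, j} = F {σ i, σ j} := by simp [relabel, Finset.map_insert]

lemma exists_perm_of_distinct {a b c : Fin 4} (hab : a ≠ b) (hac : a ≠ c) (hbc : b ≠ c) :
    ∃ σ : Equiv.Perm (Fin 4), σ 0 = a ∧ σ 1 = b ∧ σ 2 = c := by
  have h₁ : ∀ a b c : Fin 4, ∃ d, a ≠ d ∧ b ≠ d ∧ c ≠ d := by decide
  have h₂ : ∀ a b c d : Fin 4, a ≠ b → a ≠ c → b ≠ c → a ≠ d → b ≠ d → c ≠ d →
      ∀ i j, ![a, b, c, d] i = ![a, b, c, d] j → i = j := by decide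
  obtain ⟨d, had, hbd, hcd⟩ := h₁ a b c
  exact ⟨Equiv.ofBijective _ (Finite.injective_iff_bijective.mp fun i j => h₂ a b c d hab hac hbc had hbd hcd i j),
    rfl, rfl, rfl⟩

lemma exists_pair_eq : ∀ S : Finset (Fin 4), S.card = 2 → ∃ a b, a ≠ b ∧ S = {a, b} := by decide

variable [NontriviallyNormedField K] [CompleteSpace K] {F : Family K}

/-- Three coinciding points, two different exceptional lines through them, and a plane that differs
from the plane of these lines: in suitable coordinates, this is the limit of
`mem_closure_of_two_lines_frame`. -/
lemma mem_closure_of_two_lines (hF : IsConfig Finset.univ F) (h1 : F {1} = F {0})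
    (h2 : F {2} = F {0}) (h3 : F {3} ≠ F {0}) (h12 : F {1, 2} = F {0, 3}) (h01 : F {0, 1} ≠ F {0, 3})
    (h02 : F {0, 2} ≠ F {0, 3}) (h : F {0, 1} ≠ F {0, 2}) (hp : F {1, 2, 3} ≠ F {0, 1, 2}) :
    F ∈ closure (frameFamilies K Finset.univ) := by
  have hu : ∀ S : Finset (Fin 4), S ⊆ Finset.univ := fun S => Finset.subset_univ S
  obtain ⟨x, hx0, hx⟩ := hF.exists_vec (Finset.mem_univ 0)
  obtain ⟨y, hy0, hy⟩ := hF.exists_vec (Finset.mem_univ 3)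
  have hx01 : x ∈ F {0, 1} := hF.mem_of_span (by decide) (hu _) hx
  have hx02 : x ∈ F {0, 2} := hF.mem_of_span (by decide) (hu _) hx
  have hxm : x ∈ F {0, 3} := hF.mem_of_span (by decide) (hu _) hx
  have hym : y ∈ F {0, 3} := hF.mem_of_span (by decide) (hu _) hy
  have hyx : y ∉ Submodule.span K {x} := by
    rw [← hx]
    exact fun hm => h3 (hF.point_eq_of_mem (Finset.mem_univ _) (Finset.mem_univ _) hy hm)
  have h13 : F {1, 3} = F {0, 3} := hF.line_eq (a := 0) (b := 3) (hu _) (hu _) (by decide)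
    (by decide) (Finset.mem_univ _) (Finset.mem_univ _) h3.symm (h1 ▸ hF.mono' (by decide))
    (hF.mono' (by decide)) (hF.mono' (by decide)) (hF.mono' (by decide))
  have h23 : F {2, 3} = F {0, 3} := hF.line_eq (a := 0) (b := 3) (hu _) (hu _) (by decide)
    (by decide) (Finset.mem_univ _) (Finset.mem_univ _) h3.symm (h2 ▸ hF.mono' (by decide))
    (hF.mono' (by decide)) (hF.mono' (by decide)) (hF.mono' (by decide))
  have hm := span_pair_eq hF (S := {0, 3}) (by decide) hxm hym hx0 hyx
  have hmQ : F {0, 3} ≤ F {0, 1, 2} := h12 ▸ hF.mono' (by decide)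
  -- the fourth point is spanned by the difference of vectors in the two exceptional lines
  have hsup : F {0, 1} ⊔ F {0, 2} = F {0, 1, 2} := by
    refine hF.eq_of_le (hu _) (sup_le (hF.mono' (by decide)) (hF.mono' (by decide))) ?_
    have hlt : F {0, 1} < F {0, 1} ⊔ F {0, 2} := by
      refine lt_of_le_of_ne le_sup_left fun e => h ?_
      exact (Submodule.eq_of_le_of_finrank_eq (e ▸ le_sup_right) (by rw [hF.rank, hF.rank]; rfl)).symm
    have h₁ := Submodule.finrank_lt_finrank_of_lt hlt
    have h₂ := Submodule.finrank_mono
      (sup_le (hF.mono' (by decide)) (hF.mono' (by decide)) : F {0, 1} ⊔ F {0, 2} ≤ F {0, 1, 2})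
    rw [hF.rank] at h₁ h₂
    exact le_antisymm h₂ h₁
  obtain ⟨v, hv, u, hu', hvu⟩ := Submodule.mem_sup.mp (hsup ▸ hmQ hym)
  have hvy : v - y ∈ F {0, 2} := by
    have := neg_mem hu'
    rwa [show -u = v - y by rw [← hvu]; abel] at this
  have line : ∀ S : Finset (Fin 4), S.card = 2 → x ∈ F S → y ∈ F S → F S = F {0, 3} :=
    fun S hS hxS hyS => (span_pair_eq hF hS hxS hyS hx0 hyx).trans hm.symm
  have hvm : v ∉ F {0, 3} := by
    intro h'
    by_cases hvx : v ∈ Submodule.span K {x}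
    · have hv2 : v ∈ F {0, 2} :=
        (Submodule.span_singleton_le_iff_mem _ _).mpr hx02 hvx
      exact h02 (line _ (by decide) hx02 (by simpa using sub_mem hv2 hvy))
    · exact h01 ((span_pair_eq hF (by decide) hx01 hv hx0 hvx).trans
        (span_pair_eq hF (by decide) hxm h' hx0 hvx).symm)
  have hvx : v ∉ Submodule.span K {x} := fun h' =>
    hvm ((Submodule.span_singleton_le_iff_mem _ _).mpr hxm h')
  have hvyx : v - y ∉ Submodule.span K {x} := fun h' => hvm <| by
    simpa using add_mem ((Submodule.span_singleton_le_iff_mem _ _).mpr hxm h') hym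
  have plane : ∀ S : Finset (Fin 4), S.card = 3 → F {0, 3} ≤ F S → v ∈ F S →
      F S = Submodule.span K {x, y, v} := fun S hS hmS hvS =>
    span_triple_eq hF (S := {0, 3}) (by decide) hS hm hmS hvS hvm
  obtain ⟨w, hw, hwQ⟩ : ∃ w ∈ F {1, 2, 3}, w ∉ F {0, 1, 2} := by
    by_contra! hn
    exact hp (hF.eq_of_le (hu _) hn (by rw [hF.rank]; rfl))
  have hQ := plane {0, 1, 2} (by decide) hmQ (hF.mono' (by decide) hv)
  have hm123 : F {0, 3} ≤ F {1, 2, 3} := h13 ▸ hF.mono' (by decide)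
  refine mem_closure_of_two_lines_frame hF (hF.top_le_span (by decide) hQ hwQ) hx (h1.trans hx)
    (h2.trans hx) hy ?_ ?_ hm (h12.trans hm) (h13.trans hm) (h23.trans hm) hQ ?_ ?_ ?_
  · exact span_pair_eq hF (by decide) hx01 hv hx0 hvx
  · exact span_pair_eq hF (by decide) hx02 hvy hx0 hvyx
  · exact plane _ (by decide) (hF.mono' (by decide)) (hF.mono' (by decide) hv)
  · refine plane _ (by decide) (hF.mono' (by decide)) ?_
    simpa using add_mem (hF.mono' (by decide : ({0, 2} : Finset (Fin 4)) ⊆ {0, 2, 3}) hvy)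
      (hF.mono' (by decide : ({0, 3} : Finset (Fin 4)) ⊆ {0, 2, 3}) hym)
  · exact span_triple_eq hF (S := {0, 3}) (by decide) (by decide) hm hm123 hw
      fun h' => hwQ (hmQ h')

/-- A family is a limit of apartments if one of its points can be moved, within the subspaces that
it does not generate, to a point outside of all lines of the opposite plane. -/
lemma IsConfig.mem_closure_of_move_off_lines (hF : IsConfig Finset.univ F) {i : Fin 4}
    {x v : Fin 4 → K} (hx : F {i} = Submodule.span K {x})
    (hv : ∀ S : Finset (Fin 4), i ∈ S → x ∈ F (S.erase i) → v ∈ F S)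
    (h : ∀ S : Finset (Fin 4), i ∉ S → S.card = 2 → x ∉ F S ∨ v ∉ F S) :
    F ∈ closure (frameFamilies K Finset.univ) := by
  refine hF.mem_closure_of_movePoint hx (fun S _ => hv S) ?_
  have h' : ∀ᶠ t : K in 𝓝[≠] 0, ∀ S : Finset (Fin 4), i ∉ S → S.card = 2 → x + t • v ∉ F S := by
    rw [Filter.eventually_all]
    intro S
    by_cases hS : i ∉ S ∧ S.card = 2
    · filter_upwards [eventually_add_smul_notMem (h S hS.1 hS.2)] with t ht _ _ using ht
    · exact Filter.Eventually.of_forall fun t h1 h2 => absurd ⟨h1, h2⟩ hS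
  filter_upwards [h'] with t ht hc
  refine mem_closure_of_notMem_lines hc
    (movePoint_singleton hF.eq_bot (hF.ne_zero (Finset.mem_univ _) hx)) fun S hS hc' => ?_
  rw [movePoint_of_notMem hS]
  exact ht S hS hc'

/-- All points lie on the line `m`, all planes contain it, not all points coincide, and the family
is not a limit of apartments. -/
structure OnLine (F : Family K) (m : Submodule K (Fin 4 → K)) : Prop where
  config : IsConfig Finset.univ F
  rank : finrank K m = 2
  point_le : ∀ i, F {i} ≤ m
  le_plane : ∀ S : Finset (Fin 4), S.card = 3 → m ≤ F S
  points_ne : ∃ i j, F {i} ≠ F {j}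
  notMem : F ∉ closure (frameFamilies K Finset.univ)

namespace OnLine

variable {m : Submodule K (Fin 4 → K)}

omit [CompleteSpace K] in
lemma relabel (h : OnLine F m) (σ : Equiv.Perm (Fin 4)) : OnLine (relabel σ F) m where
  config := h.config.relabel σ
  rank := h.rank
  point_le i := by rw [relabel_singleton]; exact h.point_le _
  le_plane S hS := h.le_plane _ (by rw [Finset.card_map, hS])
  points_ne := by
    obtain ⟨i, j, hij⟩ := h.points_ne
    exact ⟨σ.symm i, σ.symm j, by simpa [relabel_singleton] using hij⟩
  notMem h' := h.notMem (relabel_mem_closure σ h')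

omit [CompleteSpace K] in
lemma line_eq (h : OnLine F m) {S : Finset (Fin 4)} (hS : S.card = 2) {i j : Fin 4}
    (hij : F {i} ≠ F {j}) (hi : F {i} ≤ F S) (hj : F {j} ≤ F S) : F S = m := by
  obtain ⟨x, hx0, hx⟩ := h.config.exists_vec (Finset.mem_univ i)
  obtain ⟨y, hy0, hy⟩ := h.config.exists_vec (Finset.mem_univ j)
  have hyx : y ∉ Submodule.span K {x} := by
    rw [← hx]
    exact fun hm => hij (h.config.point_eq_of_mem (Finset.mem_univ _) (Finset.mem_univ _) hy hm).symm
  have hxS : x ∈ F S := hi (hx ▸ Submodule.mem_span_singleton_self x)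
  have hyS : y ∈ F S := hj (hy ▸ Submodule.mem_span_singleton_self y)
  have hxm : x ∈ m := h.point_le i (hx ▸ Submodule.mem_span_singleton_self x)
  have hym : y ∈ m := h.point_le j (hy ▸ Submodule.mem_span_singleton_self y)
  rw [span_pair_eq h.config hS hxS hyS hx0 hyx]
  refine Submodule.eq_of_le_of_finrank_eq (Submodule.span_le.mpr ?_) ?_
  · rintro z (rfl | rfl) <;> assumption
  · rw [← span_pair_eq h.config hS hxS hyS hx0 hyx, h.config.rank, hS, h.rank]

omit [CompleteSpace K] in
lemma point_eq (h : OnLine F m) {i j : Fin 4} (hij : i ≠ j) (hl : F {i, j} ≠ m) :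
    F {i} = F {j} := by
  by_contra hne
  exact hl (h.line_eq (Finset.card_pair hij) hne (h.config.mono' (by simp))
    (h.config.mono' (by simp)))

omit [CompleteSpace K] in
lemma exists_notMem (h : OnLine F m) {S : Finset (Fin 4)} (hS : S.card = 2) (hl : F S ≠ m) :
    ∃ v ∈ F S, v ∉ m := by
  by_contra! hn
  exact hl (Submodule.eq_of_le_of_finrank_eq hn (by rw [h.config.rank, hS, h.rank]))

/-- Two opposite lines cannot both differ from the line that carries the points. -/
lemma opposite (h : OnLine F m) (h01 : F {0, 1} ≠ m) : F {2, 3} = m := by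
  by_contra h23
  have hF := h.config
  have p01 := h.point_eq (by decide) h01
  have p23 := h.point_eq (by decide) h23
  have p02 : F {0} ≠ F {2} := by
    intro h02
    have hall : ∀ i, F {i} = F {0} := by
      intro i; fin_cases i
      exacts [rfl, p01.symm, h02.symm, p23.symm.trans h02.symm]
    obtain ⟨i, j, hij⟩ := h.points_ne
    exact hij ((hall i).trans (hall j).symm)
  have e02 : F {0, 2} = m := h.line_eq (by decide) p02 (hF.mono' (by decide)) (hF.mono' (by decide))
  have e03 : F {0, 3} = m := h.line_eq (by decide) (p23 ▸ p02) (hF.mono' (by decide))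
    (hF.mono' (by decide))
  obtain ⟨v, hv, hvm⟩ := h.exists_notMem (by decide) h01
  obtain ⟨x, hx0, hx⟩ := hF.exists_vec (Finset.mem_univ 1)
  have hx23 : x ∉ F {2, 3} := fun h' => h23 <| by
    refine h.line_eq (by decide) p02 ?_ (hF.mono' (by decide))
    rw [p01, hx]
    exact (Submodule.span_singleton_le_iff_mem _ _).mpr h'
  have hmem : ∀ S : Finset (Fin 4), {0, 1} ⊆ S → v ∈ F S := fun S hS => hF.mono' hS hv
  -- the point `1` is moved along `F {0, 1}`, which takes it off the line `m`
  refine h.notMem (hF.mem_closure_of_move_off_lines hx (v := v) ?_ ?_)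
  · have key : ∀ S : Finset (Fin 4), 1 ∈ S → {0, 1} ⊆ S ∨ S.erase 1 ⊆ {2, 3} := by decide
    intro S hS hxS
    rcases key S hS with h' | h'
    · exact hmem S h'
    · exact absurd (hF.mono' h' hxS) hx23
  · have key : ∀ S : Finset (Fin 4), 1 ∉ S → S.card = 2 → S = {0, 2} ∨ S = {0, 3} ∨ S = {2, 3} := by
      decide
    intro S hS hc
    rcases key S hS hc with rfl | rfl | rfl
    · rw [e02]; exact Or.inr hvm
    · rw [e03]; exact Or.inr hvm
    · exact Or.inl hx23

/-- Two adjacent lines cannot both differ from the line that carries the points. -/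
lemma adjacent (h : OnLine F m) (h01 : F {0, 1} ≠ m) : F {0, 2} = m := by
  by_contra h02
  have hF := h.config
  have p01 := h.point_eq (by decide) h01
  have p02 := h.point_eq (by decide) h02
  have p03 : F {0} ≠ F {3} := by
    intro h03
    have hall : ∀ i, F {i} = F {0} := by
      intro i; fin_cases i
      exacts [rfl, p01.symm, p02.symm, h03.symm]
    obtain ⟨i, j, hij⟩ := h.points_ne
    exact hij ((hall i).trans (hall j).symm)
  have e03 : F {0, 3} = m := h.line_eq (by decide) p03 (hF.mono' (by decide)) (hF.mono' (by decide))
  have e13 : F {1, 3} = m := h.line_eq (by decide) (p01 ▸ p03) (hF.mono' (by decide))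
    (hF.mono' (by decide))
  have e23 : F {2, 3} = m := h.line_eq (by decide) (p02 ▸ p03) (hF.mono' (by decide))
    (hF.mono' (by decide))
  have point3 : ∀ S : Finset (Fin 4), S.card = 2 → F {0} ≤ F S → F S ≠ m → ¬ F {3} ≤ F S :=
    fun S hS hle hne h3 => hne (h.line_eq hS p03 hle h3)
  -- The points `0`, `1`, `2` are equal, and all lines through the point `3` are equal to `m`. Three
  -- cases are left, according to the lines joining the first three points.
  by_cases e12 : F {1, 2} = m
  · by_cases hab : F {0, 1} = F {0, 2}
    -- if the two exceptional lines are equal, the point `0` is moved along them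
    · obtain ⟨v, hv, hvm⟩ := h.exists_notMem (by decide) h01
      obtain ⟨x, hx0, hx⟩ := hF.exists_vec (Finset.mem_univ 0)
      refine h.notMem (hF.mem_closure_of_move_off_lines hx (v := v) ?_ ?_)
      · have key : ∀ S : Finset (Fin 4), 0 ∈ S → {0, 1} ⊆ S ∨ {0, 2} ⊆ S ∨ S.erase 0 ⊆ {3} := by
          decide
        intro S hS hxS
        rcases key S hS with h' | h' | h'
        · exact hF.mono' h' hv
        · exact hF.mono' h' (hab ▸ hv)
        · exact absurd (hF.point_eq_of_mem (Finset.mem_univ _) (Finset.mem_univ _) hx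
            (hF.mono' h' hxS)) p03
      · have key : ∀ S : Finset (Fin 4), 0 ∉ S → S.card = 2 →
            S = {1, 2} ∨ S = {1, 3} ∨ S = {2, 3} := by decide
        intro S hS hc
        rcases key S hS hc with rfl | rfl | rfl
        · rw [e12]; exact Or.inr hvm
        · rw [e13]; exact Or.inr hvm
        · rw [e23]; exact Or.inr hvm
    -- if they are different, the plane `{1, 2, 3}` is first moved away from their plane
    · by_cases hp : F {1, 2, 3} = F {0, 1, 2}
      · refine h.notMem (hF.mem_closure_of_pencil (S₀ := {1, 2, 3}) (A := m) (B := ⊤)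
          (Finset.subset_univ _) ?_ ?_ (h.le_plane _ (by decide)) le_top ?_ ?_ {F {0, 1, 2}}
          (Set.toFinite _) fun U _ _ _ hU hc => ?_)
        · intro S hS
          rcases ssubset_plane_cases' S hS with h' | h' | h'
          · exact e12 ▸ hF.mono' h'
          · exact e13 ▸ hF.mono' h'
          · exact e23 ▸ hF.mono' h'
        · intro S _ hS
          rw [ssuperset_plane S (Or.inr hS), hF.univ_eq_top]
        · rw [h.rank]; rfl
        · simp
        · have n : ∀ S : Finset (Fin 4), S ≠ {1, 2, 3} → Function.update F {1, 2, 3} U S = F S :=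
            fun S hS => Function.update_of_ne hS _ _
          refine mem_closure_of_two_lines hc ?_ ?_ ?_ ?_ ?_ ?_ ?_ ?_
          · rw [n _ (by decide), n _ (by decide), p01]
          · rw [n _ (by decide), n _ (by decide), p02]
          · rw [n _ (by decide), n _ (by decide)]; exact p03.symm
          · rw [n _ (by decide), n _ (by decide), e12, e03]
          · rwa [n _ (by decide), n _ (by decide), e03]
          · rwa [n _ (by decide), n _ (by decide), e03]
          · rwa [n _ (by decide), n _ (by decide)]
          · rw [Function.update_self, n _ (by decide)]; exact hU
      · exact h.notMem (mem_closure_of_two_lines hF p01.symm p02.symm p03.symm (e12.trans e03.symm)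
          (e03 ▸ h01) (e03 ▸ h02) hab hp)
  -- if all three lines differ from `m`, the point `3` is on none of them
  · obtain ⟨x, hx0, hx⟩ := hF.exists_vec (Finset.mem_univ 3)
    refine h.notMem (mem_closure_of_notMem_lines hF hx fun S hS hc => ?_)
    have key : ∀ S : Finset (Fin 4), 3 ∉ S → S.card = 2 →
        S = {0, 1} ∨ S = {0, 2} ∨ S = {1, 2} := by decide
    rw [← Submodule.span_singleton_le_iff_mem, ← hx]
    rcases key S hS hc with rfl | rfl | rfl
    · exact point3 _ (by decide) (hF.mono' (by decide)) h01
    · exact point3 _ (by decide) (hF.mono' (by decide)) h02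
    · exact point3 _ (by decide) (p01 ▸ hF.mono' (by decide)) e12

/-- By the two preceding lemmas, at most one line differs from `m`, and such families are limits of
apartments. -/
lemma false_of_line_ne (h : OnLine F m) (h01 : F {0, 1} ≠ m) : False := by
  have hF := h.config
  have adj : ∀ a b c : Fin 4, a ≠ b → a ≠ c → b ≠ c → F {a, b} ≠ m → F {a, c} = m := by
    intro a b c hab hac hbc hl
    obtain ⟨σ, rfl, rfl, rfl⟩ := exists_perm_of_distinct hab hac hbc
    have := (h.relabel σ).adjacent (by rwa [relabel_pair])
    rwa [relabel_pair] at this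
  have e23 := h.opposite h01
  have h10 : F {1, 0} ≠ m := by rwa [Finset.pair_comm]
  refine h.notMem (OneLine.mem_closure ⟨(h.point_eq (by decide) h01).symm, ?_, ?_, ?_, ?_, ?_⟩ hF)
  · obtain ⟨v, hv, hvm⟩ := h.exists_notMem (by decide) h01
    have key : ∀ S : Finset (Fin 4), S.card = 3 → {0, 1} ⊆ S → m ⊔ Submodule.span K {v} = F S := by
      intro S hS hS'
      refine hF.eq_of_le (Finset.subset_univ _) (sup_le (h.le_plane S hS) ?_) ?_
      · exact (Submodule.span_singleton_le_iff_mem _ _).mpr (hF.mono' hS' hv)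
      · rw [Submodule.finrank_sup_span_singleton hvm, h.rank, hS]
    rw [← key _ (by decide) (by decide), ← key {0, 1, 2} (by decide) (by decide)]
  · rw [e23, adj 0 1 2 (by decide) (by decide) (by decide) h01]
  · rw [e23, adj 0 1 3 (by decide) (by decide) (by decide) h01]
  · rw [e23, adj 1 0 2 (by decide) (by decide) (by decide) h10]
  · rw [e23, adj 1 0 3 (by decide) (by decide) (by decide) h10]

end OnLine

/-- If two of the first three points are distinct and `F {2}` is not on the line joining them, then
the family is a limit of apartments: otherwise, each of the three points would lie on a line of
the opposite plane, and this forces the fourth point to lie on all sides of the triangle. -/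
lemma point_le_line_of_notMem_closure (hF : IsConfig Finset.univ F)
    (hC : F ∉ closure (frameFamilies K Finset.univ)) (h01 : F {0} ≠ F {1}) : F {2} ≤ F {0, 1} := by
  by_contra h2
  have hu : ∀ S : Finset (Fin 4), S ⊆ Finset.univ := fun S => Finset.subset_univ S
  have mu : ∀ i : Fin 4, i ∈ Finset.univ := fun i => Finset.mem_univ i
  -- each point is on a line of the opposite plane, since it could be moved out of the plane otherwise
  have cone : ∀ i : Fin 4, ∃ S : Finset (Fin 4), i ∉ S ∧ S.card = 2 ∧ F {i} ≤ F S := by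
    intro i
    by_contra! hn
    obtain ⟨x, hx0, hx⟩ := hF.exists_vec (Finset.mem_univ i)
    refine hC (mem_closure_of_notMem_lines hF hx fun S hS hc => ?_)
    rw [← Submodule.span_singleton_le_iff_mem, ← hx]
    exact hn S hS hc
  have le : ∀ {i : Fin 4} {S : Finset (Fin 4)}, i ∈ S → F {i} ≤ F S := fun hi =>
    hF.mono' (Finset.singleton_subset_iff.mpr hi)
  have h02 : F {0} ≠ F {2} := fun e => h2 (e ▸ le (by decide))
  have h12 : F {1} ≠ F {2} := fun e => h2 (e ▸ le (by decide))
  have l01 : ∀ S : Finset (Fin 4), S.card = 2 → F {0} ≤ F S → F {1} ≤ F S → F S = F {0, 1} :=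
    fun S hS h0 h1 => hF.line_eq (hu _) (hu _) hS (by decide) (mu 0) (mu 1) h01 h0 (le (by decide))
      h1 (le (by decide))
  have l02 : ∀ S : Finset (Fin 4), S.card = 2 → F {0} ≤ F S → F {2} ≤ F S → F S = F {0, 2} :=
    fun S hS h0 h1 => hF.line_eq (hu _) (hu _) hS (by decide) (mu 0) (mu 2) h02 h0 (le (by decide))
      h1 (le (by decide))
  have l12 : ∀ S : Finset (Fin 4), S.card = 2 → F {1} ≤ F S → F {2} ≤ F S → F S = F {1, 2} :=
    fun S hS h0 h1 => hF.line_eq (hu _) (hu _) hS (by decide) (mu 1) (mu 2) h12 h0 (le (by decide))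
      h1 (le (by decide))
  have n1 : F {0, 1} ≠ F {0, 2} := fun e => h2 (e ▸ le (by decide))
  have n2 : F {0, 1} ≠ F {1, 2} := fun e => h2 (e ▸ le (by decide))
  have n3 : F {0, 2} ≠ F {1, 2} := fun e => n1 (l01 {0, 2} (by decide) (le (by decide))
    (e ▸ le (by decide))).symm
  have c0 : F {1, 3} = F {0, 1} ∨ F {2, 3} = F {0, 2} := by
    have key : ∀ S : Finset (Fin 4), 0 ∉ S → S.card = 2 → S = {1, 2} ∨ S = {1, 3} ∨ S = {2, 3} := by
      decide
    obtain ⟨S, hS, hc, h⟩ := cone 0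
    rcases key S hS hc with rfl | rfl | rfl
    · exact absurd (l01 _ (by decide) h (le (by decide))).symm n2
    · exact Or.inl (l01 _ (by decide) h (le (by decide)))
    · exact Or.inr (l02 _ (by decide) h (le (by decide)))
  have c1 : F {0, 3} = F {0, 1} ∨ F {2, 3} = F {1, 2} := by
    have key : ∀ S : Finset (Fin 4), 1 ∉ S → S.card = 2 → S = {0, 2} ∨ S = {0, 3} ∨ S = {2, 3} := by
      decide
    obtain ⟨S, hS, hc, h⟩ := cone 1
    rcases key S hS hc with rfl | rfl | rfl
    · exact absurd (l01 _ (by decide) (le (by decide)) h).symm n1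
    · exact Or.inl (l01 _ (by decide) (le (by decide)) h)
    · exact Or.inr (l12 _ (by decide) h (le (by decide)))
  have c2 : F {0, 3} = F {0, 2} ∨ F {1, 3} = F {1, 2} := by
    have key : ∀ S : Finset (Fin 4), 2 ∉ S → S.card = 2 → S = {0, 1} ∨ S = {0, 3} ∨ S = {1, 3} := by
      decide
    obtain ⟨S, hS, hc, h⟩ := cone 2
    rcases key S hS hc with rfl | rfl | rfl
    · exact absurd h h2
    · exact Or.inl (l02 _ (by decide) (le (by decide)) h)
    · exact Or.inr (l12 _ (by decide) (le (by decide)) h)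
  have h3 : F {3} ≤ F {0, 1} ∧ F {3} ≤ F {0, 2} ∧ F {3} ≤ F {1, 2} := by
    have t03 : F {3} ≤ F {0, 3} := le (by decide)
    have t13 : F {3} ≤ F {1, 3} := le (by decide)
    have t23 : F {3} ≤ F {2, 3} := le (by decide)
    rcases c0 with c0 | c0
    · have d2 := c2.resolve_right fun e => n2 (c0.symm.trans e)
      have d1 := c1.resolve_left fun e => n1 (e.symm.trans d2)
      exact ⟨c0 ▸ t13, d2 ▸ t03, d1 ▸ t23⟩
    · have d1 := c1.resolve_right fun e => n3 (c0.symm.trans e)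
      have d2 := c2.resolve_left fun e => n1 (d1.symm.trans e)
      exact ⟨d1 ▸ t03, c0 ▸ t23, d2 ▸ t13⟩
  have e0 : F {3} = F {0} := hF.point_eq_of_mem_lines (hu _) (hu _) (S := {0, 1}) (S' := {0, 2})
    (by decide) (by decide) n1 (mu _) (mu _) h3.1 h3.2.1 (le (by decide)) (le (by decide))
  have e1 : F {3} = F {1} := hF.point_eq_of_mem_lines (hu _) (hu _) (S := {0, 1}) (S' := {1, 2})
    (by decide) (by decide) n2 (mu _) (mu _) h3.1 h3.2.2 (le (by decide)) (le (by decide))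
  exact h01 (e0.symm.trans e1)

/-- A family whose points are not all equal and whose lines are not all equal is a limit of
apartments. -/
theorem mem_closure_of_points_ne (hF : IsConfig Finset.univ F) (hp : ∃ i j, F {i} ≠ F {j})
    (hl : ∃ S S' : Finset (Fin 4), S.card = 2 ∧ S'.card = 2 ∧ F S ≠ F S') :
    F ∈ closure (frameFamilies K Finset.univ) := by
  by_contra hC
  obtain ⟨i, j, hij⟩ := hp
  have hij' : i ≠ j := fun e => hij (e ▸ rfl)
  have hline : OnLine F (F {i, j}) := by
    refine ⟨hF, by rw [hF.rank, Finset.card_pair hij'], fun k => ?_, fun S hS => ?_, ⟨i, j, hij⟩, hC⟩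
    · rcases eq_or_ne k i with rfl | hki
      · exact hF.mono' (by simp)
      rcases eq_or_ne k j with rfl | hkj
      · exact hF.mono' (by simp)
      obtain ⟨σ, rfl, rfl, rfl⟩ := exists_perm_of_distinct hij' hki.symm hkj.symm
      have := point_le_line_of_notMem_closure (hF.relabel σ)
        (fun h' => hC (relabel_mem_closure σ h')) (by rwa [relabel_singleton, relabel_singleton])
      rwa [relabel_singleton, relabel_pair] at this
    · -- each plane contains all points, as the missing one lies on a line of the plane
      have key : ∀ k, F {k} ≤ F S := by
        intro k
        by_cases hk : k ∈ S
        · exact hF.mono' (Finset.singleton_subset_iff.mpr hk)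
        · by_contra hn
          obtain ⟨x, hx0, hx⟩ := hF.exists_vec (Finset.mem_univ k)
          refine hC (mem_closure_of_notMem_lines hF hx fun S' hS' _ hxS' => hn ?_)
          rw [hx]
          have sub : ∀ (k : Fin 4) (S S' : Finset (Fin 4)), S.card = 3 → k ∉ S → k ∉ S' → S' ⊆ S := by
            decide
          exact (Submodule.span_singleton_le_iff_mem _ _).mpr
            (hF.mono' (sub k S S' hS hk hS') hxS')
      obtain ⟨x, hx0, hx⟩ := hF.exists_vec (Finset.mem_univ i)
      obtain ⟨y, hy0, hy⟩ := hF.exists_vec (Finset.mem_univ j)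
      have hyx : y ∉ Submodule.span K {x} := by
        rw [← hx]
        exact fun hm => hij (hF.point_eq_of_mem (Finset.mem_univ _) (Finset.mem_univ _) hy hm).symm
      rw [span_pair_eq hF (Finset.card_pair hij')
        (hF.mem_of_span (by simp) (Finset.subset_univ _) hx)
        (hF.mem_of_span (by simp) (Finset.subset_univ _) hy) hx0 hyx, Submodule.span_le]
      rintro z (rfl | rfl)
      · exact key i (hx ▸ Submodule.mem_span_singleton_self z)
      · exact key j (hy ▸ Submodule.mem_span_singleton_self z)
  obtain ⟨S, hS, hne⟩ : ∃ S : Finset (Fin 4), S.card = 2 ∧ F S ≠ F {i, j} := by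
    by_contra! hn
    obtain ⟨S, S', hS, hS', hne⟩ := hl
    exact hne ((hn S hS).trans (hn S' hS').symm)
  obtain ⟨a, b, hab, rfl⟩ := exists_pair_eq S hS
  have ex : ∀ a b : Fin 4, ∃ c, a ≠ c ∧ b ≠ c := by decide
  obtain ⟨c, hac, hbc⟩ := ex a b
  obtain ⟨σ, rfl, rfl, rfl⟩ := exists_perm_of_distinct hab hac hbc
  exact (hline.relabel σ).false_of_line_ne (by rwa [relabel_pair])

end PointsNotEqual

/-! ### Families whose planes are not all equal -/

section Dual

variable {K : Type*} [NontriviallyNormedField K] {F : Family K}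

lemma perp_injective : Function.Injective (perp : Submodule K (Fin 4 → K) → _) := fun U W h => by
  rw [← perp_perp U, h, perp_perp]

variable [CompleteSpace K]

/-- A family whose planes are not all equal and whose lines are not all equal is a limit of
apartments. -/
theorem mem_closure_of_planes_ne (hF : IsConfig Finset.univ F) (hp : ∃ i j, F {i}ᶜ ≠ F {j}ᶜ)
    (hl : ∃ S S' : Finset (Fin 4), S.card = 2 ∧ S'.card = 2 ∧ F S ≠ F S') :
    F ∈ closure (frameFamilies K Finset.univ) := by
  refine dualFamily_mem_closure (mem_closure_of_points_ne hF.dualFamily ?_ ?_)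
  · obtain ⟨i, j, hij⟩ := hp
    exact ⟨i, j, fun h => hij (perp_injective h)⟩
  · obtain ⟨S, S', hS, hS', hne⟩ := hl
    refine ⟨Sᶜ, S'ᶜ, by rw [Finset.card_compl, hS]; rfl, by rw [Finset.card_compl, hS']; rfl,
      fun h => hne (perp_injective ?_)⟩
    simpa only [dualFamily, compl_compl] using h

end Dual

/-! ### Families with a common line -/

section LineFamily

variable {K : Type*}

section Field

variable [Field K]

lemma bracket_comm (a b : Fin 2 → K) : bracket b a = -bracket a b := by
  simp only [bracket]; ring

lemma bracket_self (a : Fin 2 → K) : bracket a a = 0 := by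
  simp only [bracket]; ring

lemma bracket_smul_left (r : K) (a b : Fin 2 → K) : bracket (r • a) b = r * bracket a b := by
  simp only [bracket, Pi.smul_apply, smul_eq_mul]; ring

lemma bracket_smul_right (r : K) (a b : Fin 2 → K) : bracket a (r • b) = r * bracket a b := by
  simp only [bracket, Pi.smul_apply, smul_eq_mul]; ring

/-- Two vectors of the plane with vanishing determinant are proportional. -/
lemma exists_smul_of_bracket_eq_zero {a b : Fin 2 → K} (ha : a ≠ 0) (hb : b ≠ 0)
    (h : bracket a b = 0) : ∃ r : K, r ≠ 0 ∧ b = r • a := by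
  have h' : a 0 * b 1 = a 1 * b 0 := sub_eq_zero.mp h
  have key : ∃ r : K, b = r • a := by
    by_cases h0 : a 0 = 0
    · have h1 : a 1 ≠ 0 := fun h1 => ha (by ext i; fin_cases i <;> assumption)
      refine ⟨b 1 / a 1, ?_⟩
      ext i; fin_cases i
      · rw [h0, zero_mul, zero_eq_mul] at h'
        simp [h0, h'.resolve_left h1]
      · simp [h1]
    · refine ⟨b 0 / a 0, ?_⟩
      ext i; fin_cases i
      · simp [h0]
      · simp only [Fin.mk_one, Pi.smul_apply, smul_eq_mul]
        field_simp
        linear_combination h'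
  obtain ⟨r, rfl⟩ := key
  exact ⟨r, fun hr => hb (by rw [hr, zero_smul]), rfl⟩

/-- The vector of the line spanned by `g 0` and `g 1` with given coordinates. -/
def lineVec (g : Fin 4 → (Fin 4 → K)) (a : Fin 2 → K) : Fin 4 → K := a 0 • g 0 + a 1 • g 1

/-- The vector of the line spanned by `g 2` and `g 3` with given coordinates. -/
def normalVec (g : Fin 4 → (Fin 4 → K)) (a : Fin 2 → K) : Fin 4 → K := a 0 • g 2 + a 1 • g 3

variable {g : Fin 4 → (Fin 4 → K)} {u n : Fin 4 → Fin 2 → K}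

lemma lineVec_mem (a : Fin 2 → K) : lineVec g a ∈ Submodule.span K {g 0, g 1} :=
  Submodule.mem_span_pair.mpr ⟨_, _, rfl⟩

lemma lineVec_smul (r : K) (a : Fin 2 → K) : lineVec g (r • a) = r • lineVec g a := by
  simp [lineVec, smul_smul]

lemma normalVec_smul (r : K) (a : Fin 2 → K) : normalVec g (r • a) = r • normalVec g a := by
  simp [normalVec, smul_smul]

lemma lineVec_ne_zero (hg : LinearIndependent K g) {a : Fin 2 → K} (ha : a ≠ 0) :
    lineVec g a ≠ 0 := by
  intro h
  have h' : ∑ i, ![a 0, a 1, 0, 0] i • g i = 0 := by simpa [Fin.sum_univ_four, lineVec] using h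
  have := Fintype.linearIndependent_iff.mp hg _ h'
  exact ha (by ext i; fin_cases i; exacts [this 0, this 1])

lemma normalVec_notMem (hg : LinearIndependent K g) {a : Fin 2 → K} (ha : a ≠ 0) :
    normalVec g a ∉ Submodule.span K {g 0, g 1} := by
  intro h
  obtain ⟨r, s, hrs⟩ := Submodule.mem_span_pair.mp h
  have h' : ∑ i, ![-r, -s, a 0, a 1] i • g i = 0 := by
    simp only [Fin.sum_univ_four, Matrix.cons_val]
    rw [add_assoc, ← normalVec, ← hrs, neg_smul, neg_smul]
    abel
  have := Fintype.linearIndependent_iff.mp hg _ h'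
  exact ha (by ext i; fin_cases i; exacts [this 2, this 3])

lemma finrank_span_line (hg : LinearIndependent K g) :
    finrank K (Submodule.span K {g 0, g 1}) = 2 := by
  have h := finrank_span_image (c := g) (S := {0, 1})
    ((linearIndepOn_univ_iff.mpr hg).mono (Set.subset_univ _))
  rw [Finset.coe_insert, Finset.coe_singleton, Set.image_pair] at h
  exact h

lemma bracket_smul_fst (a b : Fin 2 → K) :
    bracket a b • g 0 = b 1 • lineVec g a - a 1 • lineVec g b := by
  simp only [bracket, lineVec]; module

lemma bracket_smul_snd (a b : Fin 2 → K) :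
    bracket a b • g 1 = a 0 • lineVec g b - b 0 • lineVec g a := by
  simp only [bracket, lineVec]; module

/-- The relation between three vectors of a plane. -/
lemma bracket_relation (a b c : Fin 2 → K) :
    bracket b c • lineVec g a + bracket c a • lineVec g b + bracket a b • lineVec g c = 0 := by
  simp only [bracket, lineVec]; module

lemma mem_of_lineVec_mem {U : Submodule K (Fin 4 → K)} {a b : Fin 2 → K} (h : bracket a b ≠ 0)
    (ha : lineVec g a ∈ U) (hb : lineVec g b ∈ U) : g 0 ∈ U ∧ g 1 ∈ U := by
  refine ⟨(Submodule.smul_mem_iff U h).mp ?_, (Submodule.smul_mem_iff U h).mp ?_⟩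
  · rw [bracket_smul_fst]
    exact sub_mem (U.smul_mem _ ha) (U.smul_mem _ hb)
  · rw [bracket_smul_snd]
    exact sub_mem (U.smul_mem _ hb) (U.smul_mem _ ha)

open Classical in
/-- The family of a morphism of type (L), in coordinates with respect to a basis `g`: the common
line is spanned by `g 0` and `g 1`, the points are given by their coordinates `u i` on this line,
and the planes `F {i}ᶜ` by the coordinates `n i` of a vector which together with the line spans the
plane. -/
noncomputable def lineFamily (g : Fin 4 → (Fin 4 → K)) (u n : Fin 4 → Fin 2 → K) : Family K :=
  fun S =>
    if S.card = 0 then ⊥ else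
    if S.card = 1 then Submodule.span K ((fun i => lineVec g (u i)) '' (S : Set (Fin 4))) else
    if S.card = 2 then Submodule.span K {g 0, g 1} else
    if S.card = 4 then ⊤ else
    Submodule.span K {g 0, g 1} ⊔
      Submodule.span K ((fun i => normalVec g (n i)) '' ((Sᶜ : Finset (Fin 4)) : Set (Fin 4)))

lemma lineFamily_empty : lineFamily g u n ∅ = ⊥ := by simp [lineFamily]

lemma lineFamily_univ : lineFamily g u n Finset.univ = ⊤ := by simp [lineFamily]

lemma lineFamily_singleton (i : Fin 4) :
    lineFamily g u n {i} = Submodule.span K {lineVec g (u i)} := by simp [lineFamily]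

lemma lineFamily_line {S : Finset (Fin 4)} (hS : S.card = 2) :
    lineFamily g u n S = Submodule.span K {g 0, g 1} := by simp [lineFamily, hS]

lemma lineFamily_plane (i : Fin 4) : lineFamily g u n {i}ᶜ =
    Submodule.span K {g 0, g 1} ⊔ Submodule.span K {normalVec g (n i)} := by
  have h : ({i}ᶜ : Finset (Fin 4)).card = 3 := by rw [Finset.card_compl]; simp
  simp only [lineFamily, h]
  simp

lemma subset_cases : ∀ S : Finset (Fin 4),
    S = ∅ ∨ (∃ i, S = {i}) ∨ S.card = 2 ∨ (∃ i, S = {i}ᶜ) ∨ S = Finset.univ := by decide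

lemma finrank_lineFamily (hg : LinearIndependent K g) (hu : ∀ i, u i ≠ 0) (hn : ∀ i, n i ≠ 0)
    (S : Finset (Fin 4)) : finrank K (lineFamily g u n S) = S.card := by
  rcases subset_cases S with rfl | ⟨i, rfl⟩ | hS | ⟨i, rfl⟩ | rfl
  · rw [lineFamily_empty]; simp
  · rw [lineFamily_singleton, finrank_span_singleton (lineVec_ne_zero hg (hu i))]; rfl
  · rw [lineFamily_line hS, finrank_span_line hg, hS]
  · rw [lineFamily_plane, Submodule.finrank_sup_span_singleton (normalVec_notMem hg (hn i)),
      finrank_span_line hg, Finset.card_compl]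
    simp
  · rw [lineFamily_univ]; simp

lemma lineFamily_mono {S S' : Finset (Fin 4)} (h : S ⊆ S') :
    lineFamily g u n S ≤ lineFamily g u n S' := by
  have low : S.card ≤ 2 → lineFamily g u n S ≤ Submodule.span K {g 0, g 1} := by
    intro hc
    rcases subset_cases S with rfl | ⟨i, rfl⟩ | hS | ⟨i, rfl⟩ | rfl
    · rw [lineFamily_empty]; exact bot_le
    · rw [lineFamily_singleton, Submodule.span_singleton_le_iff_mem]; exact lineVec_mem _
    · rw [lineFamily_line hS]
    · rw [Finset.card_compl] at hc; simp at hc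
    · simp at hc
  have high : 2 ≤ S'.card → Submodule.span K {g 0, g 1} ≤ lineFamily g u n S' := by
    intro hc
    rcases subset_cases S' with rfl | ⟨i, rfl⟩ | hS | ⟨i, rfl⟩ | rfl
    · simp at hc
    · simp at hc
    · rw [lineFamily_line hS]
    · rw [lineFamily_plane]; exact le_sup_left
    · rw [lineFamily_univ]; exact le_top
  rcases eq_or_ne S S' with rfl | hne
  · exact le_rfl
  have hlt := Finset.card_lt_card (Finset.ssubset_iff_subset_ne.mpr ⟨h, hne⟩)
  have h4 : S'.card ≤ 4 := by simpa using Finset.card_le_univ S'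
  by_cases h1 : S.card ≤ 2 ∧ 2 ≤ S'.card
  · exact (low h1.1).trans (high h1.2)
  · by_cases h0 : S.card = 0
    · rw [Finset.card_eq_zero.mp h0, lineFamily_empty]; exact bot_le
    · rw [(Finset.card_eq_iff_eq_univ S').mp (by rw [Fintype.card_fin]; omega), lineFamily_univ]
      exact le_top

lemma isConfig_lineFamily (hg : LinearIndependent K g) (hu : ∀ i, u i ≠ 0) (hn : ∀ i, n i ≠ 0) :
    IsConfig Finset.univ (lineFamily g u n) :=
  ⟨fun S _ => finrank_lineFamily hg hu hn S, fun _ _ h _ => lineFamily_mono h⟩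

lemma eq_lineFamily {F : Family K} (hF : IsConfig Finset.univ F)
    (h1 : ∀ i, F {i} = Submodule.span K {lineVec g (u i)})
    (h2 : ∀ S : Finset (Fin 4), S.card = 2 → F S = Submodule.span K {g 0, g 1})
    (h3 : ∀ i, F {i}ᶜ = Submodule.span K {g 0, g 1} ⊔ Submodule.span K {normalVec g (n i)}) :
    F = lineFamily g u n := by
  funext S
  rcases subset_cases S with rfl | ⟨i, rfl⟩ | hS | ⟨i, rfl⟩ | rfl
  · rw [lineFamily_empty, hF.eq_bot]
  · rw [lineFamily_singleton, h1]
  · rw [lineFamily_line hS, h2 S hS]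
  · rw [lineFamily_plane, h3]
  · rw [lineFamily_univ, hF.univ_eq_top]

/-- The family only depends on the projective points with the given coordinates. -/
lemma lineFamily_smul {a b : Fin 4 → K} (ha : ∀ i, a i ≠ 0) (hb : ∀ i, b i ≠ 0)
    (hg : LinearIndependent K g) (hu : ∀ i, u i ≠ 0) (hn : ∀ i, n i ≠ 0) :
    lineFamily g (fun i => a i • u i) (fun i => b i • n i) = lineFamily g u n := by
  refine (eq_lineFamily (isConfig_lineFamily hg hu hn) (fun i => ?_)
    (fun S hS => lineFamily_line hS) fun i => ?_).symm
  · rw [lineFamily_singleton, lineVec_smul, Submodule.span_singleton_smul_eq (IsUnit.mk0 _ (ha i))]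
  · rw [lineFamily_plane, normalVec_smul,
      Submodule.span_singleton_smul_eq (IsUnit.mk0 _ (hb i))]

end Field

section Closure

variable [NontriviallyNormedField K] [CompleteSpace K] {g : Fin 4 → (Fin 4 → K)}
  {u n : Fin 4 → Fin 2 → K}

omit [CompleteSpace K] in
lemma relabel_lineFamily (hg : LinearIndependent K g) (hu : ∀ i, u i ≠ 0) (hn : ∀ i, n i ≠ 0)
    (σ : Equiv.Perm (Fin 4)) : relabel σ (lineFamily g u n) = lineFamily g (u ∘ σ) (n ∘ σ) := by
  refine eq_lineFamily ((isConfig_lineFamily hg hu hn).relabel σ) (fun i => ?_) (fun S hS => ?_)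
    fun i => ?_
  · rw [relabel_singleton, lineFamily_singleton]; rfl
  · exact lineFamily_line (by rw [Finset.card_map, hS])
  · have : ({i}ᶜ : Finset (Fin 4)).map σ.toEmbedding = {σ i}ᶜ := by
      ext j
      simp [Finset.mem_map_equiv, Equiv.symm_apply_eq]
    rw [relabel, this, lineFamily_plane]; rfl

omit [CompleteSpace K] in
lemma continuous_lineVec {f : K → Fin 2 → K} (hf : Continuous f) :
    Continuous fun t => lineVec g (f t) := by
  unfold lineVec; fun_prop

omit [CompleteSpace K] in
lemma continuous_normalVec {f : K → Fin 2 → K} (hf : Continuous f) :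
    Continuous fun t => normalVec g (f t) := by
  unfold normalVec; fun_prop

/-- Being a limit of apartments is a closed condition on the coordinates. -/
lemma lineFamily_mem_closure_of_path (hg : LinearIndependent K g) (u n : K → Fin 4 → Fin 2 → K)
    (hu : Continuous u) (hn : Continuous n) (hu0 : ∀ i, u 0 i ≠ 0) (hn0 : ∀ i, n 0 i ≠ 0)
    (h : ∀ᶠ t : K in 𝓝[≠] 0, lineFamily g (u t) (n t) ∈ closure (frameFamilies K Finset.univ)) :
    lineFamily g (u 0) (n 0) ∈ closure (frameFamilies K Finset.univ) := by
  refine mem_closure_of_tendsto_family (l := 𝓝[≠] (0 : K)) (fun t => lineFamily g (u t) (n t)) h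
    fun S _ => ?_
  have hcu : ∀ i, Continuous fun t => u t i := fun i => (continuous_apply i).comp hu
  have hcn : ∀ i, Continuous fun t => n t i := fun i => (continuous_apply i).comp hn
  rcases subset_cases S with rfl | ⟨i, rfl⟩ | hS | ⟨i, rfl⟩ | rfl
  · simp only [lineFamily_empty]; exact tendsto_const_nhds
  · simp only [lineFamily_singleton]
    exact tendsto_of_vec (fun t => lineVec g (u t i)) (continuous_lineVec (hcu i))
      (fun t _ => Submodule.mem_span_singleton_self _) (fun t => (finrank_span_le_card _).trans_eq (by simp))
      le_rfl (finrank_span_singleton (lineVec_ne_zero hg (hu0 i)))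
  · simp only [lineFamily_line hS]; exact tendsto_const_nhds
  · have e : ∀ w, Submodule.span K {g 0, g 1} ⊔ Submodule.span K {w} =
        Submodule.span K {g 0, g 1, w} := by
      intro w
      rw [← Submodule.span_union]
      congr 1
      ext z; simp; tauto
    have hd := finrank_lineFamily hg hu0 hn0 {i}ᶜ
    rw [lineFamily_plane, e, Finset.card_compl] at hd
    simp only [lineFamily_plane, e]
    refine tendsto_of_three_vecs (fun _ => g 0) (fun _ => g 1) (fun t => normalVec g (n t i))
      continuous_const continuous_const (continuous_normalVec (hcn i))
      (fun t _ => ⟨Submodule.subset_span (by simp), Submodule.subset_span (by simp),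
        Submodule.subset_span (by simp)⟩) (fun t => ?_) le_rfl (by simpa using hd)
    rw [← e]
    refine (Submodule.finrank_add_le_finrank_add_finrank _ _).trans ?_
    rw [finrank_span_line hg]
    have h1 : finrank K (Submodule.span K {normalVec g (n t i)}) ≤ 1 :=
      (finrank_span_le_card _).trans_eq (by simp)
    omega
  · simp only [lineFamily_univ]; exact tendsto_const_nhds

lemma compl_singleton_cases : ∀ i j k l : Fin 4, ({l}ᶜ : Finset (Fin 4)) = {i, j, k} →
    i ≠ j ∧ j ≠ k ∧ i ≠ k := by decide

/-- Points in general position on the line are moved out of the line along the vectors `w i`; the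
limits of the planes are then determined by the relations between the points. -/
lemma lineFamily_mem_closure_of_weights (hg : LinearIndependent K g)
    (hu : ∀ i j, i ≠ j → bracket (u i) (u j) ≠ 0) (hn : ∀ i j, i ≠ j → bracket (n i) (n j) ≠ 0)
    (w : Fin 4 → Fin 2 → K)
    (hw : ∀ l, ∃ i j k, ({l}ᶜ : Finset (Fin 4)) = {i, j, k} ∧ ∃ a : K, a ≠ 0 ∧
      bracket (u j) (u k) • w i + bracket (u k) (u i) • w j + bracket (u i) (u j) • w k =
        a • n l) :
    lineFamily g u n ∈ closure (frameFamilies K Finset.univ) := by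
  have nz : ∀ v : Fin 4 → Fin 2 → K, (∀ i j, i ≠ j → bracket (v i) (v j) ≠ 0) → ∀ i, v i ≠ 0 := by
    intro v hv i hi
    obtain ⟨j, hj⟩ := exists_ne i
    exact hv i j hj.symm (by simp [hi, bracket])
  have hF := isConfig_lineFamily hg (nz u hu) (nz n hn)
  let c : K → Fin 4 → (Fin 4 → K) := fun t i => lineVec g (u i) + t • normalVec g (w i)
  have hcc : ∀ i, Continuous fun t => c t i := fun i => by fun_prop
  have c0 : ∀ i, c 0 i = lineVec g (u i) := fun i => by simp [c]
  -- The relation between three points of the line eliminates the components on the line, and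
  -- leaves the multiple `t a` of the normal vector of the plane.
  have normal_mem : ∀ (U : Submodule K (Fin 4 → K)) (l : Fin 4) (t : K), t ≠ 0 →
      (∀ i ∈ ({l}ᶜ : Finset (Fin 4)), c t i ∈ U) → normalVec g (n l) ∈ U := by
    intro U l t ht hU
    obtain ⟨i, j, k, e, a, ha, hN⟩ := hw l
    have h1 : (t * a) • normalVec g (n l) = bracket (u j) (u k) • c t i +
        bracket (u k) (u i) • c t j + bracket (u i) (u j) • c t k := by
      rw [mul_smul, ← normalVec_smul, ← hN, ← sub_eq_zero]
      have h2 := bracket_relation (g := g) (u i) (u j) (u k)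
      rw [← neg_eq_zero.mpr h2]
      simp only [c, normalVec, Pi.add_apply, Pi.smul_apply, smul_eq_mul]
      module
    refine (Submodule.smul_mem_iff U (mul_ne_zero ht ha)).mp ?_
    rw [h1]
    exact add_mem (add_mem (U.smul_mem _ (hU i (by rw [e]; simp)))
      (U.smul_mem _ (hU j (by rw [e]; simp)))) (U.smul_mem _ (hU k (by rw [e]; simp)))
  refine mem_closure_of_path hF c (fun t ht => ?_) fun S hS hS' => ?_
  · have hmem : ∀ i, c t i ∈ Submodule.span K (Set.range (c t)) := fun i =>
      Submodule.subset_span ⟨i, rfl⟩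
    have hnm : ∀ l, normalVec g (n l) ∈ Submodule.span K (Set.range (c t)) := fun l =>
      normal_mem _ l t ht fun i _ => hmem i
    have h23 := mem_of_lineVec_mem (g := ![g 2, g 3, 0, 0]) (hn 0 1 (by decide)) (hnm 0) (hnm 1)
    have hall : ∀ a, normalVec g a ∈ Submodule.span K (Set.range (c t)) := fun a =>
      add_mem (Submodule.smul_mem _ _ h23.1) (Submodule.smul_mem _ _ h23.2)
    have hl : ∀ i, lineVec g (u i) ∈ Submodule.span K (Set.range (c t)) := fun i => by
      have := sub_mem (hmem i) (Submodule.smul_mem _ t (hall (w i)))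
      rwa [add_sub_cancel_right] at this
    have h01 := mem_of_lineVec_mem (hu 0 1 (by decide)) (hl 0) (hl 1)
    rw [← hg.span_eq_top_of_card_eq_finrank' (by simp), Submodule.span_le]
    rintro _ ⟨i, rfl⟩
    fin_cases i
    exacts [h01.1, h01.2, h23.1, h23.2]
  · have hmem : ∀ (t : K) (i : Fin 4), i ∈ S → c t i ∈ Submodule.span K (c t '' (S : Set (Fin 4))) :=
      fun t i hi => Submodule.subset_span ⟨i, hi, rfl⟩
    have hrank := finrank_lineFamily hg (nz u hu) (nz n hn) S
    rcases subset_cases S with rfl | ⟨i, rfl⟩ | hc | ⟨l, rfl⟩ | rfl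
    · simp at hS
    · refine tendsto_of_vec (fun t => c t i) (hcc i) (fun t _ => hmem t i (by simp))
        (fun t => finrank_span_image_le _ _) ?_ hrank
      rw [c0, lineFamily_singleton]
    · obtain ⟨i, j, hij, rfl⟩ := exists_pair_eq S hc
      refine tendsto_of_two_vecs (fun t => c t i) (fun t => c t j) (hcc i) (hcc j)
        (fun t _ => ⟨hmem t i (by simp), hmem t j (by simp)⟩)
        (fun t => (finrank_span_image_le _ _).trans_eq hc) ?_ (hrank.trans hc)
      simp only [c0]
      rw [lineFamily_line hc, Submodule.span_le]
      obtain ⟨h0, h1⟩ := mem_of_lineVec_mem (g := g) (hu i j hij)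
        (Submodule.subset_span (Set.mem_insert (lineVec g (u i)) {lineVec g (u j)}))
        (Submodule.subset_span (Set.mem_insert_of_mem _ rfl))
      rintro z (rfl | rfl) <;> assumption
    · obtain ⟨i, j, k, e, -⟩ := hw l
      obtain ⟨hij, -, -⟩ := compl_singleton_cases i j k l e
      have h3 : ({l}ᶜ : Finset (Fin 4)).card = 3 := by rw [Finset.card_compl]; simp
      refine tendsto_of_three_vecs (fun t => c t i) (fun t => c t j) (fun _ => normalVec g (n l))
        (hcc i) (hcc j) continuous_const
        (fun t ht => ⟨hmem t i (by rw [e]; simp), hmem t j (by rw [e]; simp),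
          normal_mem _ l t ht fun i hi => hmem t i hi⟩)
        (fun t => (finrank_span_image_le _ _).trans_eq h3) ?_ (hrank.trans h3)
      simp only [c0]
      rw [lineFamily_plane]
      refine sup_le (Submodule.span_le.mpr ?_) ?_
      · obtain ⟨h0, h1⟩ := mem_of_lineVec_mem (g := g)
          (U := Submodule.span K {lineVec g (u i), lineVec g (u j), normalVec g (n l)}) (hu i j hij)
          (Submodule.subset_span (by simp)) (Submodule.subset_span (by simp))
        rintro z (rfl | rfl) <;> assumption
      · rw [Submodule.span_singleton_le_iff_mem]
        exact Submodule.subset_span (by simp)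
    · exact absurd rfl hS'

/-- Four distinct points and four distinct planes with the same cross-ratio. -/
lemma lineFamily_mem_closure_of_distinct (hg : LinearIndependent K g)
    (hu : ∀ i j, i ≠ j → bracket (u i) (u j) ≠ 0) (hn : ∀ i j, i ≠ j → bracket (n i) (n j) ≠ 0)
    (h : bracket (u 3) (u 1) * bracket (u 2) (u 0) * (bracket (n 3) (n 0) * bracket (n 2) (n 1)) =
      bracket (n 3) (n 1) * bracket (n 2) (n 0) * (bracket (u 3) (u 0) * bracket (u 2) (u 1))) :
    lineFamily g u n ∈ closure (frameFamilies K Finset.univ) := by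
  let α := bracket (n 0) (n 3) * bracket (u 3) (u 1)
  let β := -(bracket (n 0) (n 2) * bracket (u 1) (u 2))
  have hα : α ≠ 0 := mul_ne_zero (hn _ _ (by decide)) (hu _ _ (by decide))
  have hβ : β ≠ 0 := neg_ne_zero.mpr (mul_ne_zero (hn _ _ (by decide)) (hu _ _ (by decide)))
  -- If the first two weights vanish, the planes `2` and `3` force the other two to be multiples of
  -- `n 3` and `n 2`. The factors `β` and `α` are chosen for the plane `0`; then the plane `1` is the
  -- right one because of the equality of the cross-ratios.
  refine lineFamily_mem_closure_of_weights hg hu hn ![0, 0, β • n 3, α • n 2] fun l => ?_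
  have h23 := hn 2 3 (by decide)
  fin_cases l
  · refine ⟨1, 2, 3, by decide, bracket (u 3) (u 1) * bracket (u 1) (u 2) * bracket (n 2) (n 3),
      mul_ne_zero (mul_ne_zero (hu _ _ (by decide)) (hu _ _ (by decide))) h23, ?_⟩
    ext i
    fin_cases i <;> simp [α, β, bracket] <;> ring
  · refine ⟨0, 2, 3, by decide, bracket (u 3) (u 0) * bracket (u 1) (u 2) * bracket (n 0) (n 2) *
      bracket (n 2) (n 3) / bracket (n 1) (n 2), ?_, ?_⟩
    · refine div_ne_zero (mul_ne_zero (mul_ne_zero (mul_ne_zero ?_ ?_) ?_) h23) ?_ <;>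
        first | exact hu _ _ (by decide) | exact hn _ _ (by decide)
    · have h12 := hn 1 2 (by decide)
      simp only [bracket] at h h12
      ext i
      fin_cases i
      · simp [α, β, bracket]
        rw [div_mul_eq_mul_div, eq_div_iff h12]
        linear_combination (-n 2 0) * h
      · simp [α, β, bracket]
        rw [div_mul_eq_mul_div, eq_div_iff h12]
        linear_combination (-n 2 1) * h
  · refine ⟨0, 1, 3, by decide, bracket (u 0) (u 1) * α,
      mul_ne_zero (hu _ _ (by decide)) hα, ?_⟩
    ext i
    fin_cases i <;> simp <;> ring
  · refine ⟨0, 1, 2, by decide, bracket (u 0) (u 1) * β,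
      mul_ne_zero (hu _ _ (by decide)) hβ, ?_⟩
    ext i
    fin_cases i <;> simp <;> ring

end Closure

end LineFamily

/-! ### Equal cross-ratios are sufficient -/

section LineFamilyClosure

variable {K : Type*}

section Field

variable [Field K] {g : Fin 4 → (Fin 4 → K)} {u n : Fin 4 → Fin 2 → K}

/-- The determinant of the four tensors `u i ⊗ n i` of `K² ⊗ K²`, up to sign. It vanishes if and
only if the `u i` and the `n i` have the same cross-ratio, provided that these are defined. -/
def crossDet (u n : Fin 4 → Fin 2 → K) : K :=
  bracket (u 3) (u 1) * bracket (u 2) (u 0) * (bracket (n 3) (n 0) * bracket (n 2) (n 1)) -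
    bracket (n 3) (n 1) * bracket (n 2) (n 0) * (bracket (u 3) (u 0) * bracket (u 2) (u 1))

lemma crossDet_comm : crossDet n u = -crossDet u n := by simp only [crossDet]; ring

lemma crossDet_perm (h : crossDet u n = 0) (σ : Equiv.Perm (Fin 4)) :
    crossDet (u ∘ σ) (n ∘ σ) = 0 := by
  have hσ : σ ∈ Submonoid.closure
      (Set.range fun i : Fin 3 => Equiv.swap i.castSucc i.succ) := by
    rw [Equiv.Perm.mclosure_swap_castSucc_succ]; trivial
  induction hσ using Submonoid.closure_induction generalizing u n with
  | mem τ hτ =>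
    obtain ⟨i, rfl⟩ := hτ
    have e : crossDet (u ∘ Equiv.swap i.castSucc i.succ) (n ∘ Equiv.swap i.castSucc i.succ) =
        -crossDet u n := by
      fin_cases i
      · have h0 : Equiv.swap (0 : Fin 4) 1 0 = 1 := by decide
        have h1 : Equiv.swap (0 : Fin 4) 1 1 = 0 := by decide
        have h2 : Equiv.swap (0 : Fin 4) 1 2 = 2 := by decide
        have h3 : Equiv.swap (0 : Fin 4) 1 3 = 3 := by decide
        change crossDet (u ∘ Equiv.swap (0 : Fin 4) 1) (n ∘ Equiv.swap (0 : Fin 4) 1) = _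
        simp only [crossDet, bracket, Function.comp_apply, h0, h1, h2, h3]
        ring
      · have h0 : Equiv.swap (1 : Fin 4) 2 0 = 0 := by decide
        have h1 : Equiv.swap (1 : Fin 4) 2 1 = 2 := by decide
        have h2 : Equiv.swap (1 : Fin 4) 2 2 = 1 := by decide
        have h3 : Equiv.swap (1 : Fin 4) 2 3 = 3 := by decide
        change crossDet (u ∘ Equiv.swap (1 : Fin 4) 2) (n ∘ Equiv.swap (1 : Fin 4) 2) = _
        simp only [crossDet, bracket, Function.comp_apply, h0, h1, h2, h3]
        ring
      · have h0 : Equiv.swap (2 : Fin 4) 3 0 = 0 := by decide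
        have h1 : Equiv.swap (2 : Fin 4) 3 1 = 1 := by decide
        have h2 : Equiv.swap (2 : Fin 4) 3 2 = 3 := by decide
        have h3 : Equiv.swap (2 : Fin 4) 3 3 = 2 := by decide
        change crossDet (u ∘ Equiv.swap (2 : Fin 4) 3) (n ∘ Equiv.swap (2 : Fin 4) 3) = _
        simp only [crossDet, bracket, Function.comp_apply, h0, h1, h2, h3]
        ring
    rw [e, h, neg_zero]
  | one => exact h
  | mul τ τ' _ _ hτ hτ' =>
    exact hτ' (u := u ∘ τ) (n := n ∘ τ) (hτ h)

lemma exists_bracket_ne_zero {x : Fin 2 → K} (hx : x ≠ 0) : ∃ z, bracket x z ≠ 0 := by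
  by_cases h0 : x 0 = 0
  · have h1 : x 1 ≠ 0 := fun h1 => hx (by ext i; fin_cases i <;> assumption)
    exact ⟨![1, 0], by simpa [bracket] using h1⟩
  · exact ⟨![0, 1], by simpa [bracket] using h0⟩

/-- The relation between three vectors of the plane. -/
lemma bracket_relation' (a b c : Fin 2 → K) :
    bracket b c • a + bracket c a • b + bracket a b • c = 0 := by
  ext i
  fin_cases i <;> simp [bracket] <;> ring

/-- The vanishing of the determinants of pairs is symmetric. -/
lemma bracket_ne_zero_of_six {v : Fin 4 → Fin 2 → K} (h01 : bracket (v 0) (v 1) ≠ 0)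
    (h02 : bracket (v 0) (v 2) ≠ 0) (h03 : bracket (v 0) (v 3) ≠ 0) (h12 : bracket (v 1) (v 2) ≠ 0)
    (h13 : bracket (v 1) (v 3) ≠ 0) (h23 : bracket (v 2) (v 3) ≠ 0) :
    ∀ i j, i ≠ j → bracket (v i) (v j) ≠ 0 := by
  have hlt : ∀ i j, i < j → bracket (v i) (v j) ≠ 0 := by
    intro i j hij
    have key : ∀ i j : Fin 4, i < j → (i = 0 ∧ j = 1) ∨ (i = 0 ∧ j = 2) ∨ (i = 0 ∧ j = 3) ∨
      (i = 1 ∧ j = 2) ∨ (i = 1 ∧ j = 3) ∨ (i = 2 ∧ j = 3) := by decide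
    rcases key i j hij with ⟨rfl, rfl⟩ | ⟨rfl, rfl⟩ | ⟨rfl, rfl⟩ | ⟨rfl, rfl⟩ | ⟨rfl, rfl⟩ |
      ⟨rfl, rfl⟩ <;> assumption
  intro i j hij
  rcases lt_or_gt_of_ne hij with h | h
  · exact hlt i j h
  · rw [bracket_comm]; exact neg_ne_zero.mpr (hlt j i h)

lemma exists_coords (hg : LinearIndependent K g) (v : Fin 4 → K) :
    ∃ a b, v = lineVec g a + normalVec g b := by
  have hv : v ∈ Submodule.span K (Set.range g) := by
    rw [hg.span_eq_top_of_card_eq_finrank' (by simp)]; trivial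
  obtain ⟨c, rfl⟩ := (Submodule.mem_span_range_iff_exists_fun K).mp hv
  refine ⟨![c 0, c 1], ![c 2, c 3], ?_⟩
  simp only [Fin.sum_univ_four, lineVec, normalVec, Matrix.cons_val]
  abel

/-- Every line is spanned by the first two vectors of a basis. -/
lemma exists_adapted_basis {m : Submodule K (Fin 4 → K)} (hm : finrank K m = 2) :
    ∃ g : Fin 4 → (Fin 4 → K), LinearIndependent K g ∧ m = Submodule.span K {g 0, g 1} := by
  obtain ⟨W, hW⟩ := Submodule.exists_isCompl m
  have hWr : finrank K W = 2 := by
    have := Submodule.finrank_add_eq_of_isCompl hW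
    rw [hm, finrank_fintype_fun_eq_card, Fintype.card_fin] at this
    omega
  let bm := finBasisOfFinrankEq K m hm
  let bW := finBasisOfFinrankEq K W hWr
  let B := (bm.prod bW).map (Submodule.prodEquivOfIsCompl m W hW)
  let e : Fin 4 ≃ Fin 2 ⊕ Fin 2 := (finSumFinEquiv (m := 2) (n := 2)).symm
  refine ⟨B ∘ e, B.linearIndependent.comp e e.injective, ?_⟩
  have e0 : e 0 = Sum.inl 0 := by decide
  have e1 : e 1 = Sum.inl 1 := by decide
  have hb : ∀ i, B (Sum.inl i) = bm i := fun i => by simp [B]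
  rw [Function.comp_apply, Function.comp_apply, e0, e1, hb, hb]
  have h1 := congrArg (Submodule.map m.subtype) bm.span_eq
  rw [Submodule.map_span, Submodule.map_top, Submodule.range_subtype] at h1
  refine h1.symm.trans (congrArg _ ?_)
  ext v
  simp [Fin.exists_fin_two, eq_comm]

/-- A family whose lines are all equal has coordinates with respect to each basis adapted to the
common line. -/
lemma exists_eq_lineFamily {F : Family K} (hF : IsConfig Finset.univ F)
    (hg : LinearIndependent K g)
    (hl : ∀ S : Finset (Fin 4), S.card = 2 → F S = Submodule.span K {g 0, g 1}) :
    ∃ u n, (∀ i, u i ≠ 0) ∧ (∀ i, n i ≠ 0) ∧ F = lineFamily g u n := by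
  have hpoint : ∀ i, ∃ a, a ≠ 0 ∧ F {i} = Submodule.span K {lineVec g a} := by
    intro i
    obtain ⟨v, hv0, hv⟩ := hF.exists_vec (Finset.mem_univ i)
    obtain ⟨j, hj⟩ := exists_ne i
    have hvm : v ∈ F {i, j} := hF.mem_of_span (by simp) (Finset.subset_univ _) hv
    rw [hl _ (Finset.card_pair hj.symm)] at hvm
    obtain ⟨a, b, rfl⟩ := Submodule.mem_span_pair.mp hvm
    refine ⟨![a, b], fun h => hv0 ?_, hv⟩
    have h0 : a = 0 := congrFun h 0
    have h1 : b = 0 := congrFun h 1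
    rw [h0, h1, zero_smul, zero_smul, zero_add]
  have hplane : ∀ i, ∃ b, b ≠ 0 ∧ F {i}ᶜ =
      Submodule.span K {g 0, g 1} ⊔ Submodule.span K {normalVec g b} := by
    intro i
    have hc : ({i}ᶜ : Finset (Fin 4)).card = 3 := by rw [Finset.card_compl]; simp
    obtain ⟨v, hv, hvm⟩ := hF.exists_notMem (Finset.subset_univ ({i}ᶜ : Finset (Fin 4)))
      (U := Submodule.span K {g 0, g 1}) (by rw [hc, finrank_span_line hg]; norm_num)
    obtain ⟨a, b, rfl⟩ := exists_coords hg v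
    have hle : Submodule.span K {g 0, g 1} ≤ F {i}ᶜ := by
      have key : ∀ i : Fin 4, ∃ S : Finset (Fin 4), S.card = 2 ∧ S ⊆ {i}ᶜ := by decide
      obtain ⟨S, hS, hSi⟩ := key i
      rw [← hl S hS]; exact hF.mono' hSi
    have hb : normalVec g b ∈ F {i}ᶜ := by
      have := sub_mem hv (hle (lineVec_mem a))
      rwa [add_sub_cancel_left] at this
    have hb0 : b ≠ 0 := by
      rintro rfl
      exact hvm (by simpa [normalVec] using lineVec_mem a)
    refine ⟨b, hb0, (hF.eq_of_le (Finset.subset_univ _)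
      (sup_le hle ((Submodule.span_singleton_le_iff_mem _ _).mpr hb)) ?_).symm⟩
    rw [Submodule.finrank_sup_span_singleton (normalVec_notMem hg hb0), finrank_span_line hg, hc]
  choose u hu0 hu using hpoint
  choose n hn0 hn using hplane
  exact ⟨u, n, hu0, hn0, eq_lineFamily hF hu hl hn⟩

end Field

variable [NontriviallyNormedField K] {g : Fin 4 → (Fin 4 → K)} {u n : Fin 4 → Fin 2 → K}

lemma eventually_eval_ne_zero {p : Polynomial K} (hp : p ≠ 0) :
    ∀ᶠ s : K in 𝓝[≠] 0, p.eval s ≠ 0 := by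
  have h := (Polynomial.finite_setOfPred_isRoot hp).eventually_cofinite_notMem
  exact (h.filter_mono (nhdsNE_le_cofinite 0)).mono fun s hs => hs

lemma eventually_linear_ne_zero (a : K) {b : K} (hb : b ≠ 0) :
    ∀ᶠ s : K in 𝓝[≠] 0, a + s * b ≠ 0 := by
  have hp : (Polynomial.C b * Polynomial.X + Polynomial.C a) ≠ 0 := fun h => hb <| by
    simpa using congrArg (fun p => Polynomial.coeff p 1) h
  filter_upwards [eventually_eval_ne_zero hp] with s hs
  rw [add_comm, mul_comm]
  simpa using hs

/-- Vectors of the plane can be moved to pairwise independent ones. -/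
lemma exists_eventually_bracket_ne_zero (n : Fin 4 → Fin 2 → K) :
    ∃ z : Fin 4 → Fin 2 → K, ∀ᶠ s : K in 𝓝[≠] 0,
      ∀ i j, i ≠ j → bracket (n i + s • z i) (n j + s • z j) ≠ 0 := by
  have : Infinite K := NontriviallyNormedField.infinite K
  let a : Fin 4 → K := fun i => Infinite.natEmbedding K i
  have ha : Function.Injective a := fun i j h => Fin.ext ((Infinite.natEmbedding K).injective h)
  refine ⟨fun i => ![1, a i], ?_⟩
  simp only [Filter.eventually_all]
  intro i j hij
  let p : Polynomial K := Polynomial.C (a j - a i) * Polynomial.X ^ 2 +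
    Polynomial.C (bracket (n i) ![1, a j] + bracket ![1, a i] (n j)) * Polynomial.X +
    Polynomial.C (bracket (n i) (n j))
  have hc : a j - a i ≠ 0 := sub_ne_zero.mpr (ha.ne hij.symm)
  have hp : p ≠ 0 := fun h => hc <| by
    rw [← Polynomial.leadingCoeff_quadratic (b := bracket (n i) ![1, a j] + bracket ![1, a i] (n j))
      (c := bracket (n i) (n j)) hc]
    exact Polynomial.leadingCoeff_eq_zero.mpr h
  filter_upwards [eventually_eval_ne_zero hp] with s hs h
  refine hs ?_
  rw [← h]
  simp [p, bracket]
  ring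

variable [CompleteSpace K]

/-- Three equal points, and four distinct planes: the three points can be separated with any
cross-ratio. -/
lemma lineFamily_mem_closure_of_three_eq_of_distinct (hg : LinearIndependent K g)
    {x y : Fin 2 → K} (hxy : bracket x y ≠ 0) (hn : ∀ i j, i ≠ j → bracket (n i) (n j) ≠ 0) :
    lineFamily g ![x, x, x, y] n ∈ closure (frameFamilies K Finset.univ) := by
  have hn0 : ∀ i, n i ≠ 0 := fun i hi => by
    obtain ⟨j, hj⟩ := exists_ne i
    exact hn i j hj.symm (by simp [hi, bracket])
  have hx : x ≠ 0 := by rintro rfl; simp [bracket] at hxy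
  have hy : y ≠ 0 := by rintro rfl; simp [bracket] at hxy
  -- with respect to `x` and `y`, the points have the coordinates `s` times numerator and denominator
  -- of the cross-ratio of the planes, `0` and `∞`
  have h := lineFamily_mem_closure_of_path hg
    (fun s => ![x + s • (bracket (n 3) (n 1) * bracket (n 2) (n 0)) • y,
      x + s • (bracket (n 3) (n 0) * bracket (n 2) (n 1)) • y, x, y])
    (fun _ => n) ?_ continuous_const ?_ hn0 ?_
  · simpa using h
  · refine continuous_pi fun i => ?_
    fin_cases i <;> simp <;> fun_prop
  · intro i; fin_cases i <;> simpa
  · filter_upwards [self_mem_nhdsWithin] with s hs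
    have hs : s ≠ 0 := hs
    refine lineFamily_mem_closure_of_distinct hg (bracket_ne_zero_of_six ?_ ?_ ?_ ?_ ?_ ?_) hn ?_
    · have e : bracket (n 3) (n 0) * bracket (n 2) (n 1) - bracket (n 3) (n 1) * bracket (n 2) (n 0)
          = bracket (n 2) (n 3) * bracket (n 1) (n 0) := by simp only [bracket]; ring
      have h1 : s * (bracket (n 2) (n 3) * bracket (n 1) (n 0)) * bracket x y ≠ 0 :=
        mul_ne_zero (mul_ne_zero hs (mul_ne_zero (hn _ _ (by decide)) (hn _ _ (by decide)))) hxy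
      rw [← e] at h1
      intro h2
      refine h1 ?_
      rw [← h2]
      simp [bracket]
      ring
    · have h1 : s * (bracket (n 3) (n 1) * bracket (n 2) (n 0)) * bracket x y ≠ 0 :=
        mul_ne_zero (mul_ne_zero hs (mul_ne_zero (hn _ _ (by decide)) (hn _ _ (by decide)))) hxy
      intro h2
      refine h1 ?_
      rw [← neg_eq_zero, ← h2]
      simp [bracket]
      ring
    · intro h2
      refine hxy ?_
      rw [← h2]
      simp [bracket]
      ring
    · have h1 : s * (bracket (n 3) (n 0) * bracket (n 2) (n 1)) * bracket x y ≠ 0 :=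
        mul_ne_zero (mul_ne_zero hs (mul_ne_zero (hn _ _ (by decide)) (hn _ _ (by decide)))) hxy
      intro h2
      refine h1 ?_
      rw [← neg_eq_zero, ← h2]
      simp [bracket]
      ring
    · intro h2
      refine hxy ?_
      rw [← h2]
      simp [bracket]
      ring
    · exact hxy
    · simp [bracket]
      ring

/-- Three equal points: the planes are moved apart and the fourth point is moved away from the
other ones. -/
lemma lineFamily_mem_closure_of_three_eq (hg : LinearIndependent K g)
    {x y : Fin 2 → K} (hx : x ≠ 0) (hy : y ≠ 0) (hn : ∀ i, n i ≠ 0) :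
    lineFamily g ![x, x, x, y] n ∈ closure (frameFamilies K Finset.univ) := by
  obtain ⟨z, hz⟩ := exists_bracket_ne_zero hx
  obtain ⟨w, hw⟩ := exists_eventually_bracket_ne_zero n
  have h := lineFamily_mem_closure_of_path hg (fun s => ![x, x, x, y + s • z])
    (fun s i => n i + s • w i) ?_ ?_ ?_ ?_ ?_
  · simpa using h
  · refine continuous_pi fun i => ?_
    fin_cases i <;> simp <;> fun_prop
  · fun_prop
  · intro i; fin_cases i <;> simpa
  · simpa using hn
  · filter_upwards [hw, eventually_linear_ne_zero (bracket x y) hz] with s h1 h2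
    refine lineFamily_mem_closure_of_three_eq_of_distinct hg (fun h3 => h2 ?_) h1
    rw [← h3]
    simp [bracket]
    ring

/-- If all lines are equal and three points are equal, then the family is a limit of apartments. -/
lemma mem_closure_of_lines_eq_of_three_points {F : Family K} (hF : IsConfig Finset.univ F)
    (hl : ∀ S S' : Finset (Fin 4), S.card = 2 → S'.card = 2 → F S = F S') {i j k : Fin 4}
    (hij : i ≠ j) (hik : i ≠ k) (hjk : j ≠ k) (h1 : F {i} = F {j}) (h2 : F {j} = F {k}) :
    F ∈ closure (frameFamilies K Finset.univ) := by
  obtain ⟨σ, rfl, rfl, rfl⟩ := exists_perm_of_distinct hij hik hjk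
  refine relabel_mem_closure σ ?_
  rw [← relabel_singleton σ F, ← relabel_singleton σ F] at h1 h2
  replace hF := hF.relabel σ
  replace hl : ∀ S S' : Finset (Fin 4), S.card = 2 → S'.card = 2 → relabel σ F S = relabel σ F S' :=
    fun S S' hS hS' => hl _ _ (by rwa [Finset.card_map]) (by rwa [Finset.card_map])
  generalize relabel σ F = F at *
  obtain ⟨g, hg, hm⟩ := exists_adapted_basis (K := K) (m := F {0, 1}) (by rw [hF.rank]; rfl)
  obtain ⟨u, n, hu, hn, rfl⟩ := exists_eq_lineFamily hF hg fun S hS =>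
    (hl S {0, 1} hS (by decide)).trans hm
  have prop : ∀ i j, lineFamily g u n {i} = lineFamily g u n {j} →
      ∃ r : K, r ≠ 0 ∧ u j = r • u i := by
    intro i j h
    refine exists_smul_of_bracket_eq_zero (hu i) (hu j) ?_
    by_contra hne
    rw [lineFamily_singleton, lineFamily_singleton] at h
    have hmem := mem_of_lineVec_mem (g := g) hne (Submodule.mem_span_singleton_self _)
      (h ▸ Submodule.mem_span_singleton_self _)
    have h2 : finrank K (Submodule.span K {g 0, g 1}) ≤ 1 := by
      refine (Submodule.finrank_mono (t := Submodule.span K {lineVec g (u i)})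
        (Submodule.span_le.mpr ?_)).trans_eq (finrank_span_singleton (lineVec_ne_zero hg (hu i)))
      rintro z (rfl | rfl)
      exacts [hmem.1, hmem.2]
    rw [finrank_span_line hg] at h2
    omega
  obtain ⟨r, hr0, hr⟩ := prop 0 1 h1
  obtain ⟨s, hs0, hs⟩ := prop 0 2 (h1.trans h2)
  have e : u = fun i => (![1, r, s, 1] : Fin 4 → K) i • (![u 0, u 0, u 0, u 3] : Fin 4 → _) i := by
    funext i
    fin_cases i <;> simp [hr, hs]
  have e' : n = fun i => (1 : K) • n i := by simp
  have hu' : ∀ i, (![u 0, u 0, u 0, u 3] : Fin 4 → _) i ≠ 0 := by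
    intro i; fin_cases i; exacts [hu 0, hu 0, hu 0, hu 3]
  rw [e, e', lineFamily_smul (a := ![1, r, s, 1]) (b := fun _ => 1) ?_ (by simp) hg hu' hn]
  · exact lineFamily_mem_closure_of_three_eq hg (hu 0) (hu 3) hn
  · intro i; fin_cases i <;> simp [hr0, hs0]

/-- If all lines are equal and three planes are equal, then the family is a limit of
apartments. -/
lemma mem_closure_of_lines_eq_of_three_planes {F : Family K} (hF : IsConfig Finset.univ F)
    (hl : ∀ S S' : Finset (Fin 4), S.card = 2 → S'.card = 2 → F S = F S') {i j k : Fin 4}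
    (hij : i ≠ j) (hik : i ≠ k) (hjk : j ≠ k) (h1 : F {i}ᶜ = F {j}ᶜ) (h2 : F {j}ᶜ = F {k}ᶜ) :
    F ∈ closure (frameFamilies K Finset.univ) := by
  refine dualFamily_mem_closure (mem_closure_of_lines_eq_of_three_points hF.dualFamily
    (fun S S' hS hS' => ?_) hij hik hjk (congrArg perp h1) (congrArg perp h2))
  exact congrArg perp (hl _ _ (by rw [Finset.card_compl, hS]; rfl)
    (by rw [Finset.card_compl, hS']; rfl))

/-- Two equal points, and two equal planes with complementary labels. -/
lemma lineFamily_mem_closure_of_opposite (hg : LinearIndependent K g) (hu : ∀ i, u i ≠ 0)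
    (hn : ∀ i, n i ≠ 0) (h01 : bracket (u 0) (u 1) = 0) (h23 : bracket (n 2) (n 3) = 0) :
    lineFamily g u n ∈ closure (frameFamilies K Finset.univ) := by
  have line : ∀ S : Finset (Fin 4), S.card = 2 → lineFamily g u n S = lineFamily g u n {2, 3} :=
    fun S hS => by rw [lineFamily_line hS, lineFamily_line (by decide)]
  refine OneLine.mem_closure ⟨?_, ?_, line _ (by decide), line _ (by decide), line _ (by decide),
    line _ (by decide)⟩ (isConfig_lineFamily hg hu hn)
  · obtain ⟨r, hr, h⟩ := exists_smul_of_bracket_eq_zero (hu 0) (hu 1) h01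
    rw [lineFamily_singleton, lineFamily_singleton, h, lineVec_smul,
      Submodule.span_singleton_smul_eq (IsUnit.mk0 _ hr)]
  · obtain ⟨r, hr, h⟩ := exists_smul_of_bracket_eq_zero (hn 2) (hn 3) h23
    rw [show ({0, 1, 3} : Finset (Fin 4)) = {2}ᶜ by decide,
      show ({0, 1, 2} : Finset (Fin 4)) = {3}ᶜ by decide, lineFamily_plane, lineFamily_plane, h,
      normalVec_smul, Submodule.span_singleton_smul_eq (IsUnit.mk0 _ hr)]

/-- Two equal points, and two equal planes with the same labels: both pairs are separated
simultaneously, with the same coordinates on the two lines. -/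
lemma lineFamily_mem_closure_of_double (hg : LinearIndependent K g) {p q r t : Fin 2 → K}
    (hpq : bracket p q ≠ 0) (hrt : bracket r t ≠ 0) :
    lineFamily g ![p + q, p + q, p, q] ![r + t, r + t, r, t] ∈
      closure (frameFamilies K Finset.univ) := by
  have nz : ∀ p q : Fin 2 → K, bracket p q ≠ 0 → ∀ i, ![p + q, p + (1 + (0 : K)) • q, p, q] i ≠ 0 := by
    intro p q hpq i hi
    refine hpq ?_
    fin_cases i
    · simp only [Fin.zero_eta, Matrix.cons_val_zero] at hi
      rw [← sub_eq_zero.mpr (bracket_self p).symm]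
      rw [eq_neg_of_add_eq_zero_right hi]
      simp [bracket]; ring
    · simp only [Fin.mk_one, Matrix.cons_val_one, Matrix.cons_val_zero, add_zero, one_smul] at hi
      rw [eq_neg_of_add_eq_zero_right hi]
      simp [bracket]; ring
    · have : p = 0 := hi
      simp [this, bracket]
    · have : q = 0 := hi
      simp [this, bracket]
  have h := lineFamily_mem_closure_of_path hg (fun s => ![p + q, p + (1 + s) • q, p, q])
    (fun s => ![r + t, r + (1 + s) • t, r, t]) ?_ ?_ (nz p q hpq) (nz r t hrt) ?_
  · simpa using h
  · refine continuous_pi fun i => ?_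
    fin_cases i <;> simp <;> fun_prop
  · refine continuous_pi fun i => ?_
    fin_cases i <;> simp <;> fun_prop
  · filter_upwards [self_mem_nhdsWithin, eventually_linear_ne_zero (1 : K) one_ne_zero] with s hs h1
    have hs : s ≠ 0 := hs
    rw [mul_one] at h1
    have dist : ∀ p q : Fin 2 → K, bracket p q ≠ 0 →
        ∀ i j, i ≠ j → bracket (![p + q, p + (1 + s) • q, p, q] i)
          (![p + q, p + (1 + s) • q, p, q] j) ≠ 0 := by
      intro p q hpq
      have e1 := mul_ne_zero hs hpq
      have e2 := mul_ne_zero h1 hpq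
      refine bracket_ne_zero_of_six (fun h => e1 ?_) (fun h => hpq ?_) (fun h => hpq ?_)
        (fun h => e2 ?_) (fun h => hpq ?_) hpq
      · rw [← h]; simp [bracket]; ring
      · rw [← neg_eq_zero, ← h]; simp [bracket]; ring
      · rw [← h]; simp [bracket]; ring
      · rw [← neg_eq_zero, ← h]; simp [bracket]; ring
      · rw [← h]; simp [bracket]; ring
    refine lineFamily_mem_closure_of_distinct hg (dist p q hpq) (dist r t hrt) ?_
    simp [bracket]
    ring

omit [CompleteSpace K] in
/-- Rescaling of coordinate vectors of three distinct points, one of which is taken twice. -/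
lemma exists_double_coords {v : Fin 4 → Fin 2 → K} (h0 : ∀ i, v i ≠ 0)
    (h01 : bracket (v 0) (v 1) = 0) (h02 : bracket (v 0) (v 2) ≠ 0) (h03 : bracket (v 0) (v 3) ≠ 0)
    (h23 : bracket (v 2) (v 3) ≠ 0) : ∃ (a : Fin 4 → K) (p q : Fin 2 → K), (∀ i, a i ≠ 0) ∧
      bracket p q ≠ 0 ∧ v = fun i => a i • (![p + q, p + q, p, q] : Fin 4 → Fin 2 → K) i := by
  obtain ⟨r, hr, h1⟩ := exists_smul_of_bracket_eq_zero (h0 0) (h0 1) h01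
  let α := bracket (v 0) (v 3) / bracket (v 2) (v 3)
  let β := -bracket (v 0) (v 2) / bracket (v 2) (v 3)
  have hα : α ≠ 0 := div_ne_zero h03 h23
  have hβ : β ≠ 0 := div_ne_zero (neg_ne_zero.mpr h02) h23
  have hv0 : v 0 = α • v 2 + β • v 3 := by
    refine smul_right_injective _ h23 ?_
    simp only [smul_add, smul_smul, α, β, mul_div_cancel₀ _ h23]
    ext i
    fin_cases i <;> simp [bracket] <;> ring
  refine ⟨![1, r, α⁻¹, β⁻¹], α • v 2, β • v 3, ?_, ?_, ?_⟩
  · intro i; fin_cases i <;> simp [hr, hα, hβ]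
  · rw [bracket_smul_left, bracket_smul_right]
    exact mul_ne_zero hα (mul_ne_zero hβ h23)
  · funext i
    fin_cases i
    · simpa using hv0
    · simpa [← hv0] using h1
    · simp [smul_smul, hα]
    · simp [smul_smul, hβ]

/-- If all lines are equal and the points and the planes have the same cross-ratio, then the family
is a limit of apartments. -/
theorem lineFamily_mem_closure_of_crossDet (hg : LinearIndependent K g) (hu : ∀ i, u i ≠ 0)
    (hn : ∀ i, n i ≠ 0)
    (hu3 : ∀ i j k, i ≠ j → i ≠ k → j ≠ k → bracket (u i) (u j) = 0 → bracket (u i) (u k) ≠ 0)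
    (hn3 : ∀ i j k, i ≠ j → i ≠ k → j ≠ k → bracket (n i) (n j) = 0 → bracket (n i) (n k) ≠ 0)
    (h : crossDet u n = 0) :
    lineFamily g u n ∈ closure (frameFamilies K Finset.univ) := by
  -- two equal points force two equal planes, with the same or with complementary labels
  have force : ∀ {u n : Fin 4 → Fin 2 → K},
      (∀ i j k, i ≠ j → i ≠ k → j ≠ k → bracket (u i) (u j) = 0 → bracket (u i) (u k) ≠ 0) →
      crossDet u n = 0 → bracket (u 0) (u 1) = 0 →
        bracket (n 2) (n 3) = 0 ∨ bracket (n 0) (n 1) = 0 := by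
    intro u n hu3 h h01
    have h10 : bracket (u 1) (u 0) = 0 := by rw [bracket_comm, h01, neg_zero]
    have hne : bracket (u 0) (u 3) * bracket (u 1) (u 2) ≠ 0 :=
      mul_ne_zero (hu3 0 1 3 (by decide) (by decide) (by decide) h01)
        (hu3 1 0 2 (by decide) (by decide) (by decide) h10)
    refine mul_eq_zero.mp ((mul_eq_zero.mp ?_).resolve_left hne)
    simp only [crossDet, bracket] at h h01 ⊢
    linear_combination -h + (u 2 0 * u 3 1 - u 2 1 * u 3 0) * ((n 3 0 * n 0 1 - n 3 1 * n 0 0) *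
      (n 2 0 * n 1 1 - n 2 1 * n 1 0)) * h01
  have perm3 : ∀ {v : Fin 4 → Fin 2 → K} (σ : Equiv.Perm (Fin 4)),
      (∀ i j k, i ≠ j → i ≠ k → j ≠ k → bracket (v i) (v j) = 0 → bracket (v i) (v k) ≠ 0) →
      ∀ i j k, i ≠ j → i ≠ k → j ≠ k → bracket ((v ∘ σ) i) ((v ∘ σ) j) = 0 →
        bracket ((v ∘ σ) i) ((v ∘ σ) k) ≠ 0 :=
    fun σ hv i j k hij hik hjk => hv _ _ _ (σ.injective.ne hij) (σ.injective.ne hik)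
      (σ.injective.ne hjk)
  have move : ∀ {i j : Fin 4}, i ≠ j → ∃ σ : Equiv.Perm (Fin 4), σ 0 = i ∧ σ 1 = j := by
    intro i j hij
    have ex : ∀ a b : Fin 4, ∃ c, a ≠ c ∧ b ≠ c := by decide
    obtain ⟨k, hik, hjk⟩ := ex i j
    obtain ⟨σ, h0, h1, -⟩ := exists_perm_of_distinct hij hik hjk
    exact ⟨σ, h0, h1⟩
  by_cases hud : ∀ i j, i ≠ j → bracket (u i) (u j) ≠ 0
  · refine lineFamily_mem_closure_of_distinct hg hud (fun i j hij h0 => ?_) (sub_eq_zero.mp h)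
    obtain ⟨σ, rfl, rfl⟩ := move hij
    have h' : crossDet (n ∘ σ) (u ∘ σ) = 0 := by rw [crossDet_comm, crossDet_perm h, neg_zero]
    rcases force (perm3 σ hn3) h' h0 with h1 | h1
    · exact hud _ _ (σ.injective.ne (by decide)) h1
    · exact hud _ _ (σ.injective.ne (by decide)) h1
  · push Not at hud
    obtain ⟨i, j, hij, h01⟩ := hud
    obtain ⟨σ, rfl, rfl⟩ := move hij
    refine relabel_mem_closure σ ?_
    rw [relabel_lineFamily hg hu hn]
    replace h := crossDet_perm h σ
    replace hu3 := perm3 σ hu3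
    replace hn3 := perm3 σ hn3
    replace hu : ∀ i, (u ∘ σ) i ≠ 0 := fun i => hu _
    replace hn : ∀ i, (n ∘ σ) i ≠ 0 := fun i => hn _
    change bracket ((u ∘ σ) 0) ((u ∘ σ) 1) = 0 at h01
    generalize u ∘ σ = u at *
    generalize n ∘ σ = n at *
    -- Now the first two points are equal. Complementary pairs of equal points and equal planes are
    -- covered by the families with one exceptional line.
    by_cases n23 : bracket (n 2) (n 3) = 0
    · exact lineFamily_mem_closure_of_opposite hg hu hn h01 n23
    have n01 := (force hu3 h h01).resolve_left n23
    by_cases u23 : bracket (u 2) (u 3) = 0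
    · let τ : Equiv.Perm (Fin 4) := Equiv.swap 0 2 * Equiv.swap 1 3
      have t0 : τ 0 = 2 := by decide
      have t1 : τ 1 = 3 := by decide
      have t2 : τ 2 = 0 := by decide
      have t3 : τ 3 = 1 := by decide
      refine relabel_mem_closure τ ?_
      rw [relabel_lineFamily hg hu hn]
      refine lineFamily_mem_closure_of_opposite hg (fun i => hu _) (fun i => hn _) ?_ ?_
      · rwa [Function.comp_apply, Function.comp_apply, t0, t1]
      · rwa [Function.comp_apply, Function.comp_apply, t2, t3]
    -- otherwise the first two points and the first two planes are the only equal ones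
    obtain ⟨a, p, q, ha, hpq, eu⟩ := exists_double_coords hu h01
      (hu3 0 1 2 (by decide) (by decide) (by decide) h01)
      (hu3 0 1 3 (by decide) (by decide) (by decide) h01) u23
    obtain ⟨b, r, t, hb, hrt, en⟩ := exists_double_coords hn n01
      (hn3 0 1 2 (by decide) (by decide) (by decide) n01)
      (hn3 0 1 3 (by decide) (by decide) (by decide) n01) n23
    have nz : ∀ {v v' : Fin 4 → Fin 2 → K} {a : Fin 4 → K}, (∀ i, v i ≠ 0) →
        v = (fun i => a i • v' i) → ∀ i, v' i ≠ 0 := fun hv e i h0 =>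
      hv i (by rw [e]; simp [h0])
    have nu := nz hu eu
    have nn := nz hn en
    rw [eu, en, lineFamily_smul ha hb hg nu nn]
    exact lineFamily_mem_closure_of_double hg hpq hrt

end LineFamilyClosure

/-! ### Equal cross-ratios are necessary -/

section Necessity

variable {K : Type*} [NontriviallyNormedField K]

/-- Frames of finitely many subspaces determined by a limit of families can be approximated by
frames of the corresponding subspaces of the families. -/
lemma frames_mem_closure [CompleteSpace K] {ι : Type*} [Finite ι] {X : Set (Family K)}
    {F : Family K} (hF : F ∈ closure X) (A : ι → Family K → Submodule K (Fin 4 → K))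
    (hA : ∀ i, Continuous (A i)) {k : ℕ} (u : ι → Fin k → (Fin 4 → K))
    (hu : ∀ i, LinearIndependent K (u i)) (huF : ∀ i, Submodule.span K (Set.range (u i)) = A i F) :
    u ∈ closure {w : ι → Fin k → (Fin 4 → K) | (∀ i, LinearIndependent K (w i)) ∧
      ∃ G ∈ X, ∀ i, Submodule.span K (Set.range (w i)) = A i G} := by
  rw [mem_closure_iff_nhds]
  intro O hO
  rw [nhds_pi, Filter.mem_pi'] at hO
  obtain ⟨I, O', hO', hsub⟩ := hO
  have h : ∀ᶠ G in 𝓝 F, ∀ i, ∃ w : Fin k → (Fin 4 → K), w ∈ O' i ∧ LinearIndependent K w ∧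
      Submodule.span K (Set.range w) = A i G := by
    rw [Filter.eventually_all]
    intro i
    have h1 := (hA i).tendsto F
    rw [← huF i, nhds_span (hu i)] at h1
    refine h1.eventually (p := fun U => ∃ w : Fin k → (Fin 4 → K), w ∈ O' i ∧
      LinearIndependent K w ∧ Submodule.span K (Set.range w) = U) ?_
    rw [Filter.eventually_map]
    have h2 : Tendsto (Subtype.val : {w : Fin k → (Fin 4 → K) // LinearIndependent K w} → _)
      (𝓝 ⟨u i, hu i⟩) (𝓝 (u i)) := continuous_subtype_val.tendsto _
    filter_upwards [h2 (hO' i)] with w hw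
    exact ⟨w.1, hw, w.2, rfl⟩
  obtain ⟨G, hG, hGX⟩ := mem_closure_iff_nhds.mp hF _ h
  choose w hwO hw hwG using hG
  exact ⟨w, hsub fun i _ => hwO i, hw, G, hGX, hwG⟩

/-- The expansion of a vector with respect to a frame, in terms of vectors spanning the points of
the frame and of vectors orthogonal to its planes. -/
lemma expansion_of_mem_frameFamilies {G : Family K} (hG : G ∈ frameFamilies K Finset.univ)
    {w q : Fin 4 → (Fin 4 → K)} (hw : ∀ i, G {i} = Submodule.span K {w i})
    (hq : ∀ i, perp (G {i}ᶜ) = Submodule.span K {q i}) (hq0 : ∀ i, q i ≠ 0) :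
    (∀ i, w i ⬝ᵥ q i ≠ 0) ∧
      ∀ y, y = ∑ i, ((y ⬝ᵥ q i) / (w i ⬝ᵥ q i)) • w i := by
  have hC := frameFamilies_isConfig hG
  have hspan : Submodule.span K (Set.range w) = ⊤ := by
    obtain ⟨c, hc, h⟩ := hG
    rw [eq_top_iff, ← hC.univ_eq_top, h _ subset_rfl, Submodule.span_le]
    rintro _ ⟨i, -, rfl⟩
    have h1 : c i ∈ G {i} := by
      rw [h _ (Finset.subset_univ _)]; exact Submodule.subset_span ⟨i, by simp, rfl⟩
    rw [hw] at h1
    exact Submodule.span_mono (Set.singleton_subset_iff.mpr (Set.mem_range_self i)) h1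
  have h0 : ∀ i j, j ≠ i → w j ⬝ᵥ q i = 0 := by
    intro i j hji
    have hqi : q i ∈ perp (G {i}ᶜ) := by rw [hq]; exact Submodule.mem_span_singleton_self _
    exact mem_perp.mp hqi _ (hC.mem_of_span (by simpa using hji) (Finset.subset_univ _) (hw j))
  have hne : ∀ i, w i ⬝ᵥ q i ≠ 0 := by
    intro i hi
    refine hq0 i (dotProduct_eq_zero _ fun y => ?_)
    have hy : y ∈ Submodule.span K (Set.range w) := hspan ▸ Submodule.mem_top
    obtain ⟨a, rfl⟩ := (Submodule.mem_span_range_iff_exists_fun K).mp hy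
    rw [dotProduct_comm, sum_dotProduct]
    refine Finset.sum_eq_zero fun j _ => ?_
    rw [smul_dotProduct]
    rcases eq_or_ne j i with rfl | hj
    · rw [hi, smul_zero]
    · rw [h0 i j hj, smul_zero]
  refine ⟨hne, fun y => ?_⟩
  have hy : y ∈ Submodule.span K (Set.range w) := hspan ▸ Submodule.mem_top
  obtain ⟨a, rfl⟩ := (Submodule.mem_span_range_iff_exists_fun K).mp hy
  refine Finset.sum_congr rfl fun i _ => ?_
  congr 1
  rw [sum_dotProduct, Finset.sum_eq_single i, smul_dotProduct, smul_eq_mul,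
    mul_div_cancel_right₀ _ (hne i)]
  · intro j _ hj
    rw [smul_dotProduct, h0 i j hj, smul_zero]
  · simp

/-- Linearly dependent tensors have vanishing determinant. -/
lemma crossDet_eq_zero_of_sum {u v : Fin 4 → Fin 2 → K} {c : Fin 4 → K} (hc : c ≠ 0)
    (h : ∀ a b, ∑ i, u i a * v i b * c i = 0) : crossDet u v = 0 := by
  let M : Matrix (Fin 4) (Fin 4) K :=
    Matrix.of ![fun i => u i 0 * v i 0, fun i => u i 0 * v i 1, fun i => u i 1 * v i 0,
      fun i => u i 1 * v i 1]
  have hM : M.det = 0 := by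
    refine Matrix.exists_mulVec_eq_zero_iff.mp ⟨c, hc, ?_⟩
    ext i
    fin_cases i
    exacts [h 0 0, h 0 1, h 1 0, h 1 1]
  have e : M.det = -crossDet u v := by
    simp [M, Matrix.det_succ_row_zero, Fin.sum_univ_succ, Fin.succAbove, crossDet, bracket]
    ring
  rw [← neg_eq_zero, ← e, hM]

/-- In a limit of apartments with a common line, the points and the planes have the same
cross-ratio: the identity is a linear combination of the four tensors given by the points and the
planes of an apartment, and its components that map a complement of the line to the line vanish. -/
theorem crossDet_eq_zero_of_mem_closure [CompleteSpace K] {g : Fin 4 → (Fin 4 → K)}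
    {u n : Fin 4 → Fin 2 → K} (hg : LinearIndependent K g) (hu : ∀ i, u i ≠ 0)
    (hn : ∀ i, n i ≠ 0) (h : lineFamily g u n ∈ closure (frameFamilies K Finset.univ)) :
    crossDet u n = 0 := by
  have hC := isConfig_lineFamily hg hu hn
  choose q hq0 hq using fun i => hC.dualFamily.exists_vec (Finset.mem_univ i)
  let B : Basis (Fin 4) K (Fin 4 → K) := basisOfLinearIndependentOfCardEqFinrank hg (by simp)
  have hB : ∀ i, B i = g i := fun i => by simp [B]
  let ξ : (Fin 4 → K) → Fin 2 → K := fun y => ![B.coord 0 y, B.coord 1 y]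
  let η : (Fin 4 → K) → Fin 2 → K := fun z => ![g 2 ⬝ᵥ z, g 3 ⬝ᵥ z]
  have hξ : Continuous ξ := by
    refine continuous_pi fun i => ?_
    fin_cases i
    exacts [LinearMap.continuous_of_finiteDimensional _, LinearMap.continuous_of_finiteDimensional _]
  have hη : Continuous η := by
    refine continuous_pi fun i => ?_
    fin_cases i <;> simp [η, dotProduct] <;> fun_prop
  let Φ : (Fin 4 ⊕ Fin 4 → Fin 1 → (Fin 4 → K)) → K := fun w =>
    crossDet (fun i => ξ (w (Sum.inl i) 0)) (fun i => η (w (Sum.inr i) 0))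
  have hΦ : Continuous Φ := by
    have h1 : ∀ i a, Continuous fun w : Fin 4 ⊕ Fin 4 → Fin 1 → (Fin 4 → K) =>
        ξ (w (Sum.inl i) 0) a := fun i a => (continuous_apply a).comp (hξ.comp (by fun_prop))
    have h2 : ∀ i a, Continuous fun w : Fin 4 ⊕ Fin 4 → Fin 1 → (Fin 4 → K) =>
        η (w (Sum.inr i) 0) a := fun i a => (continuous_apply a).comp (hη.comp (by fun_prop))
    simp only [Φ, crossDet, bracket]
    fun_prop
  have hcl := frames_mem_closure h
    (Sum.elim (fun i G => G {i}) (fun i G => perp (G {i}ᶜ)))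
    (by
      rintro (i | i)
      · exact continuous_apply _
      · exact continuous_perp.comp (continuous_apply _))
    (k := 1) (Sum.elim (fun i _ => lineVec g (u i)) (fun i _ => q i)) (by
      rintro (i | i)
      · exact (LinearIndependent.of_subsingleton 0 (lineVec_ne_zero hg (hu i)))
      · exact (LinearIndependent.of_subsingleton 0 (hq0 i)))
    (by
      rintro (i | i)
      · simp only [Sum.elim_inl, Set.range_const, lineFamily_singleton]
      · simp only [Sum.elim_inr, Set.range_const]
        exact (hq i).symm)
  have hzero : Φ (Sum.elim (fun i _ => lineVec g (u i)) (fun i _ => q i)) = 0 := by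
    refine (closure_minimal ?_ (isClosed_singleton.preimage hΦ) hcl : _ ∈ Φ ⁻¹' {0})
    rintro w ⟨hw, G, hG, hwG⟩
    have rg : ∀ v : Fin 1 → (Fin 4 → K), Set.range v = {v 0} := fun v =>
      Set.range_unique
    have hexp := expansion_of_mem_frameFamilies hG (w := fun i => w (Sum.inl i) 0)
      (q := fun i => w (Sum.inr i) 0)
      (fun i => by rw [← rg]; exact (hwG (Sum.inl i)).symm)
      (fun i => by rw [← rg]; exact (hwG (Sum.inr i)).symm)
      (fun i => (hw (Sum.inr i)).ne_zero 0)
    refine crossDet_eq_zero_of_sum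
      (c := fun i => (w (Sum.inl i) 0 ⬝ᵥ w (Sum.inr i) 0)⁻¹)
      (fun h => inv_ne_zero (hexp.1 0) (congrFun h 0)) ?_
    -- apply `f` to the expansion of `y`
    have key : ∀ (f : (Fin 4 → K) →ₗ[K] K) (y : Fin 4 → K), f y = 0 →
        ∑ i, f (w (Sum.inl i) 0) * (y ⬝ᵥ w (Sum.inr i) 0) *
          (w (Sum.inl i) 0 ⬝ᵥ w (Sum.inr i) 0)⁻¹ = 0 := by
      intro f y hy
      have := congrArg f (hexp.2 y)
      rw [hy, map_sum] at this
      rw [this]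
      refine Finset.sum_congr rfl fun i _ => ?_
      rw [map_smul, smul_eq_mul]
      ring
    have h02 : B.coord 0 (g 2) = 0 := by rw [← hB]; simp
    have h03 : B.coord 0 (g 3) = 0 := by rw [← hB]; simp
    have h12 : B.coord 1 (g 2) = 0 := by rw [← hB]; simp
    have h13 : B.coord 1 (g 3) = 0 := by rw [← hB]; simp
    intro a b
    fin_cases a <;> fin_cases b
    exacts [key _ _ h02, key _ _ h03, key _ _ h12, key _ _ h13]
  have hξu : ∀ a, ξ (lineVec g a) = a := by
    intro a
    have c0 : ∀ i j, B.coord i (g j) = if j = i then 1 else 0 := fun i j => by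
      rw [← hB]; simp [Finsupp.single_apply]
    ext i
    fin_cases i <;> simp [ξ, lineVec, c0, -Basis.coord_apply]
  -- the functional that vanishes on a plane kills the vector with coordinates `n i`
  have hηq : ∀ i, ∃ r : K, r ≠ 0 ∧ η (q i) = r • ![-n i 1, n i 0] := by
    intro i
    have hqi : ∀ y ∈ lineFamily g u n {i}ᶜ, y ⬝ᵥ q i = 0 := by
      have : q i ∈ perp (lineFamily g u n {i}ᶜ) := by
        change q i ∈ dualFamily (lineFamily g u n) {i}
        rw [hq]; exact Submodule.mem_span_singleton_self _
      exact mem_perp.mp this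
    rw [lineFamily_plane] at hqi
    have h0 : g 0 ⬝ᵥ q i = 0 :=
      hqi _ (Submodule.mem_sup_left (Submodule.subset_span (by simp)))
    have h1 : g 1 ⬝ᵥ q i = 0 :=
      hqi _ (Submodule.mem_sup_left (Submodule.subset_span (by simp)))
    have h2 := hqi _ (Submodule.mem_sup_right (Submodule.mem_span_singleton_self _))
    refine exists_smul_of_bracket_eq_zero ?_ ?_ ?_
    · intro h0
      exact hn i (by ext j; fin_cases j; exacts [congrFun h0 1, neg_eq_zero.mp (congrFun h0 0)])
    · intro h3
      refine hq0 i (dotProduct_eq_zero _ fun y => ?_)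
      have hy : y ∈ Submodule.span K (Set.range g) := by
        rw [hg.span_eq_top_of_card_eq_finrank' (by simp)]; trivial
      obtain ⟨a, rfl⟩ := (Submodule.mem_span_range_iff_exists_fun K).mp hy
      have h32 : g 2 ⬝ᵥ q i = 0 := congrFun h3 0
      have h33 : g 3 ⬝ᵥ q i = 0 := congrFun h3 1
      rw [dotProduct_comm, sum_dotProduct]
      simp [Fin.sum_univ_four, h0, h1, h32, h33]
    · simp only [normalVec, add_dotProduct, smul_dotProduct, smul_eq_mul] at h2
      simp [bracket, η]
      linear_combination -h2
  choose r hr0 hr using hηq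
  simp only [Φ, Sum.elim_inl, Sum.elim_inr, hξu, hr] at hzero
  have e : crossDet u (fun i => r i • ![-n i 1, n i 0]) = r 0 * r 1 * r 2 * r 3 * crossDet u n := by
    simp [crossDet, bracket]
    ring
  rw [e] at hzero
  exact (mul_eq_zero.mp hzero).resolve_left (mul_ne_zero (mul_ne_zero (mul_ne_zero (hr0 0) (hr0 1))
    (hr0 2)) (hr0 3))

end Necessity

/-! ### Morphisms of type (L) -/

section TypeL

section Field

variable {K : Type*} [Field K] {b : Basis (Fin 4) K (Fin 4 → K)} {f : Mor (apartment b)}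

lemma Mor.family_singleton (f : Mor (apartment b)) (i : Fin 4) :
    f.family {i} = (f.point i).carrier := f.family_eq _

lemma Mor.family_compl (f : Mor (apartment b)) (i : Fin 4) :
    f.family {i}ᶜ = (f.plane i).carrier := f.family_eq _

lemma Mor.family_pair (f : Mor (apartment b)) (a : Pair) :
    f.family a.1 = (f.line a).carrier := f.family_eq _

lemma Mor.isTypeL_iff : f.IsTypeL ↔
    ∀ S S' : Finset (Fin 4), S.card = 2 → S'.card = 2 → f.family S = f.family S' := by
  constructor
  · rintro ⟨l, hl⟩ S S' hS hS'
    rw [f.family_pair ⟨S, hS⟩, f.family_pair ⟨S', hS'⟩, hl, hl]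
  · intro h
    refine ⟨f.line ⟨{0, 1}, by decide⟩, fun a => Vertex.ext ?_⟩
    rw [← f.family_pair, ← f.family_pair]
    exact h _ _ a.2 (by decide)

lemma crossRatio_eq_of_crossDet {u v : Fin 4 → Fin 2 → K}
    (hu : ∀ i j k, i ≠ j → i ≠ k → j ≠ k → bracket (u i) (u j) = 0 → bracket (u i) (u k) ≠ 0)
    (hv : ∀ i j k, i ≠ j → i ≠ k → j ≠ k → bracket (v i) (v j) = 0 → bracket (v i) (v k) ≠ 0)
    (h : crossDet u v = 0) : crossRatio u = crossRatio v := by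
  have nz : ∀ {u : Fin 4 → Fin 2 → K},
      (∀ i j k, i ≠ j → i ≠ k → j ≠ k → bracket (u i) (u j) = 0 → bracket (u i) (u k) ≠ 0) →
      bracket (u 3) (u 0) * bracket (u 2) (u 1) = 0 →
      bracket (u 3) (u 1) * bracket (u 2) (u 0) ≠ 0 := by
    intro u hu h0
    have sw : ∀ i j, bracket (u i) (u j) ≠ 0 → bracket (u j) (u i) ≠ 0 := fun i j h => by
      rw [bracket_comm]; exact neg_ne_zero.mpr h
    have sw0 : ∀ i j, bracket (u i) (u j) = 0 → bracket (u j) (u i) = 0 := fun i j h => by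
      rw [bracket_comm, h, neg_zero]
    rcases mul_eq_zero.mp h0 with h1 | h1
    · exact mul_ne_zero (hu 3 0 1 (by decide) (by decide) (by decide) h1)
        (sw _ _ (hu 0 3 2 (by decide) (by decide) (by decide) (sw0 _ _ h1)))
    · exact mul_ne_zero (sw _ _ (hu 1 2 3 (by decide) (by decide) (by decide) (sw0 _ _ h1)))
        (hu 2 1 0 (by decide) (by decide) (by decide) h1)
  rw [crossDet, sub_eq_zero] at h
  by_cases h1 : bracket (u 3) (u 0) * bracket (u 2) (u 1) = 0
  · rw [h1, mul_zero] at h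
    have h2 := (mul_eq_zero.mp h).resolve_left (nz hu h1)
    rw [crossRatio, crossRatio, if_pos h1, if_pos h2]
  · by_cases h2 : bracket (v 3) (v 0) * bracket (v 2) (v 1) = 0
    · rw [h2, mul_zero] at h
      exact absurd h.symm (mul_ne_zero (nz hv h2) h1)
    · rw [crossRatio, crossRatio, if_neg h1, if_neg h2]
      congr 1
      exact (div_eq_div_iff h1 h2).mpr h

lemma crossDet_eq_zero_of_crossRatio {u v : Fin 4 → Fin 2 → K} (h : crossRatio u = crossRatio v) :
    crossDet u v = 0 := by
  rw [crossDet, sub_eq_zero]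
  by_cases h1 : bracket (u 3) (u 0) * bracket (u 2) (u 1) = 0 <;>
    by_cases h2 : bracket (v 3) (v 0) * bracket (v 2) (v 1) = 0
  · rw [h1, h2, mul_zero, mul_zero]
  · rw [crossRatio, crossRatio, if_pos h1, if_neg h2] at h
    exact absurd h (OnePoint.infty_ne_coe _)
  · rw [crossRatio, crossRatio, if_neg h1, if_pos h2] at h
    exact absurd h (OnePoint.coe_ne_infty _)
  · rw [crossRatio, crossRatio, if_neg h1, if_neg h2] at h
    exact (div_eq_div_iff h1 h2).mp (OnePoint.coe_injective h)

lemma span_eq_of_bracket_eq_zero {E : Type*} [AddCommGroup E] [Module K E]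
    (φ : (Fin 2 → K) →ₗ[K] E) {x y : Fin 2 → K} (hx : x ≠ 0) (hy : y ≠ 0) (h : bracket x y = 0) :
    Submodule.span K {φ x} = Submodule.span K {φ y} := by
  obtain ⟨r, hr, rfl⟩ := exists_smul_of_bracket_eq_zero hx hy h
  rw [map_smul, Submodule.span_singleton_smul_eq (IsUnit.mk0 r hr)]

lemma bracket_ne_zero_of_not_threeCoincide {E : Type*} [AddCommGroup E] [Module K E]
    {y : Fin 4 → Submodule K E} (h : ¬ ThreeCoincide y) {φ : (Fin 2 → K) →ₗ[K] E}
    {u : Fin 4 → Fin 2 → K} (hu : ∀ i, u i ≠ 0 ∧ y i = Submodule.span K {φ (u i)}) (i j k : Fin 4)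
    (hij : i ≠ j) (hik : i ≠ k) (hjk : j ≠ k) (h0 : bracket (u i) (u j) = 0) :
    bracket (u i) (u k) ≠ 0 := by
  intro h1
  have e1 : y i = y j := by
    rw [(hu i).2, (hu j).2, span_eq_of_bracket_eq_zero φ (hu i).1 (hu j).1 h0]
  have e2 : y i = y k := by
    rw [(hu i).2, (hu k).2, span_eq_of_bracket_eq_zero φ (hu i).1 (hu k).1 h1]
  exact h ⟨i, j, k, hij, hjk, hik, e1, e1.symm.trans e2⟩

/-- If a subspace contains the points with the given coordinates, no three of which coincide, then
it contains the whole line. -/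
lemma map_mem_of_coords {E : Type*} [AddCommGroup E] [Module K E] {φ : (Fin 2 → K) →ₗ[K] E}
    {u : Fin 4 → Fin 2 → K} {U : Submodule K E}
    (hu : ∀ i j k, i ≠ j → i ≠ k → j ≠ k → bracket (u i) (u j) = 0 → bracket (u i) (u k) ≠ 0)
    (h : ∀ i, φ (u i) ∈ U) (a : Fin 2 → K) : φ a ∈ U := by
  obtain ⟨j, hj⟩ : ∃ j, bracket (u 0) (u j) ≠ 0 := by
    by_contra! hn
    exact hu 0 1 2 (by decide) (by decide) (by decide) (hn 1) (hn 2)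
  refine (Submodule.smul_mem_iff U hj).mp ?_
  have e := bracket_relation' (u 0) (u j) a
  rw [← map_smul, eq_neg_of_add_eq_zero_right e, map_neg, map_add, map_smul, map_smul]
  exact neg_mem (add_mem (U.smul_mem _ (h 0)) (U.smul_mem _ (h j)))

/-- The linear functionals on `K⁴` parametrised by an injective linear map from `K²` have a dual
pair of vectors. -/
lemma exists_dual_pair {ψ : (Fin 2 → K) →ₗ[K] Dual K (Fin 4 → K)} (hψ : Function.Injective ψ) :
    ∃ f₀ f₁ : Fin 4 → K, ∀ w, ψ w f₀ = w 0 ∧ ψ w f₁ = w 1 := by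
  have hs : Function.Surjective ψ.flip := LinearMap.flip_surjective_iff₁.mpr hψ
  obtain ⟨f₀, h₀⟩ := hs (LinearMap.proj 0)
  obtain ⟨f₁, h₁⟩ := hs (LinearMap.proj 1)
  exact ⟨f₀, f₁, fun w => ⟨LinearMap.congr_fun h₀ w, LinearMap.congr_fun h₁ w⟩⟩

/-- A morphism of type (L) with cross-ratios has coordinates with these cross-ratios. -/
lemma Mor.exists_lineFamily_of_hasCrossRatio (hL : f.IsTypeL) {c c' : OnePoint K}
    (h : HasCrossRatio (fun i => (f.point i).carrier) c)
    (h' : HasCrossRatio (fun i => (f.plane i).carrier.dualAnnihilator) c') :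
    ∃ (g : Fin 4 → (Fin 4 → K)) (u v : Fin 4 → Fin 2 → K), LinearIndependent K g ∧
      (∀ i, u i ≠ 0) ∧ (∀ i, v i ≠ 0) ∧
      (∀ i j k, i ≠ j → i ≠ k → j ≠ k → bracket (u i) (u j) = 0 → bracket (u i) (u k) ≠ 0) ∧
      (∀ i j k, i ≠ j → i ≠ k → j ≠ k → bracket (v i) (v j) = 0 → bracket (v i) (v k) ≠ 0) ∧
      c = crossRatio u ∧ c' = crossRatio v ∧
      f.family = lineFamily g u fun i => ![-v i 1, v i 0] := by
  obtain ⟨h3, φ, u, hφ, hu, hc⟩ := h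
  obtain ⟨h3', ψ, v, hψ, hv, hc'⟩ := h'
  have hF := f.isConfig_family
  have hl := Mor.isTypeL_iff.mp hL
  have hu3 := bracket_ne_zero_of_not_threeCoincide h3 hu
  have hv3 := bracket_ne_zero_of_not_threeCoincide h3' hv
  replace hu : ∀ i, u i ≠ 0 ∧ (f.point i).carrier = Submodule.span K {φ (u i)} := hu
  replace hv : ∀ i, v i ≠ 0 ∧ (f.plane i).carrier.dualAnnihilator =
    Submodule.span K {ψ (v i)} := hv
  obtain ⟨f₀, f₁, hf⟩ := exists_dual_pair hψ
  let m := f.family {0, 1}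
  have hm : finrank K m = 2 := hF.rank _
  have key : ∀ i : Fin 4, ∃ S : Finset (Fin 4), S.card = 2 ∧ i ∈ S := by decide
  have key' : ∀ i : Fin 4, ∃ S : Finset (Fin 4), S.card = 2 ∧ S ⊆ {i}ᶜ := by decide
  have hpm : ∀ i, f.family {i} ≤ m := fun i => by
    obtain ⟨S, hS, hi⟩ := key i
    exact (hF.mono' (Finset.singleton_subset_iff.mpr hi)).trans (hl S {0, 1} hS (by decide)).le
  have hmp : ∀ i, m ≤ f.family {i}ᶜ := fun i => by
    obtain ⟨S, hS, hi⟩ := key' i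
    exact (hl {0, 1} S (by decide) hS).le.trans (hF.mono' hi)
  have hφm : ∀ a, φ a ∈ m := map_mem_of_coords hu3 fun i => hpm i <| by
    rw [f.family_singleton, (hu i).2]; exact Submodule.mem_span_singleton_self _
  have hψm : ∀ a, ψ a ∈ m.dualAnnihilator := map_mem_of_coords hv3 fun i =>
    Submodule.dualAnnihilator_anti (hmp i) <| by
      rw [f.family_compl, (hv i).2]; exact Submodule.mem_span_singleton_self _
  let g : Fin 4 → (Fin 4 → K) := ![φ ![1, 0], φ ![0, 1], f₀, f₁]
  have hgφ : ∀ a, φ a = lineVec g a := fun a => by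
    have : a = a 0 • ![1, 0] + a 1 • ![0, 1] := by ext i; fin_cases i <;> simp
    rw [this, map_add, map_smul, map_smul]
    simp [lineVec, g]
  have hgψ : ∀ a w, ψ w (normalVec g a) = a 0 * w 0 + a 1 * w 1 := fun a w => by
    simp [normalVec, g, hf]
  have hg : LinearIndependent K g := by
    rw [Fintype.linearIndependent_iff]
    intro a ha
    have e : lineVec g ![a 0, a 1] + normalVec g ![a 2, a 3] = 0 := by
      rw [← ha]
      simp only [Fin.sum_univ_four, lineVec, normalVec, Matrix.cons_val]
      abel
    have h23 : ∀ w : Fin 2 → K, a 2 * w 0 + a 3 * w 1 = 0 := fun w => by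
      have e1 := congrArg (ψ w) e
      rw [map_add, map_zero, ← hgφ, (Submodule.mem_dualAnnihilator _).mp (hψm w) _ (hφm _), zero_add,
        hgψ] at e1
      simpa using e1
    have h2 : a 2 = 0 := by simpa using h23 ![1, 0]
    have h3 : a 3 = 0 := by simpa using h23 ![0, 1]
    have e2 : normalVec g ![a 2, a 3] = 0 := by simp [normalVec, h2, h3]
    rw [e2, add_zero, ← hgφ] at e
    have e3 := (map_eq_zero_iff φ hφ).mp e
    intro i
    fin_cases i
    exacts [congrFun e3 0, congrFun e3 1, h2, h3]
  have hn : ∀ i, (![-v i 1, v i 0] : Fin 2 → K) ≠ 0 := fun i h0 => (hv i).1 <| by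
    ext j; fin_cases j
    exacts [congrFun h0 1, neg_eq_zero.mp (congrFun h0 0)]
  have hms : m = Submodule.span K {g 0, g 1} := by
    refine (Submodule.eq_of_le_of_finrank_eq (Submodule.span_le.mpr ?_) ?_).symm
    · rintro z (rfl | rfl)
      exacts [hφm _, hφm _]
    · rw [hm, finrank_span_line hg]
  refine ⟨g, u, v, hg, fun i => (hu i).1, fun i => (hv i).1, hu3, hv3, hc, hc',
    eq_lineFamily hF (fun i => ?_) (fun S hS => ?_) fun i => ?_⟩
  · rw [f.family_singleton, (hu i).2, hgφ]
  · rw [← hms]; exact hl S {0, 1} hS (by decide)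
  · refine (hF.eq_of_le (Finset.subset_univ _) (sup_le (hms ▸ hmp i) ?_) ?_).symm
    · rw [Submodule.span_singleton_le_iff_mem, f.family_compl,
        ← Subspace.forall_mem_dualAnnihilator_apply_eq_zero_iff]
      intro ξ hξ
      rw [(hv i).2] at hξ
      obtain ⟨r, rfl⟩ := Submodule.mem_span_singleton.mp hξ
      rw [LinearMap.smul_apply, hgψ]
      simp
      right
      ring
    · rw [Submodule.finrank_sup_span_singleton (normalVec_notMem hg (hn i)), finrank_span_line hg,
        Finset.card_compl]
      simp

/-- The points and the planes of a morphism of type (L) with given coordinates have the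
cross-ratios of these coordinates. -/
lemma Mor.hasCrossRatio_of_lineFamily {g : Fin 4 → (Fin 4 → K)} {u n : Fin 4 → Fin 2 → K}
    (hg : LinearIndependent K g) (hu : ∀ i, u i ≠ 0) (hn : ∀ i, n i ≠ 0)
    (hF : f.family = lineFamily g u n) (h3 : ¬ ThreeCoincide f.point)
    (h3' : ¬ ThreeCoincide f.plane) (h : crossDet u n = 0) :
    ∃ c, HasCrossRatio (fun i => (f.point i).carrier) c ∧
      HasCrossRatio (fun i => (f.plane i).carrier.dualAnnihilator) c := by
  let B : Basis (Fin 4) K (Fin 4 → K) := basisOfLinearIndependentOfCardEqFinrank hg (by simp)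
  have hB : ∀ i, B i = g i := fun i => by simp [B]
  have hc : ∀ i j, B.coord i (g j) = if j = i then 1 else 0 := fun i j => by
    rw [← hB]; simp [Finsupp.single_apply]
  let φ : (Fin 2 → K) →ₗ[K] (Fin 4 → K) :=
    (LinearMap.proj 0).smulRight (g 0) + (LinearMap.proj 1).smulRight (g 1)
  let ψ : (Fin 2 → K) →ₗ[K] Dual K (Fin 4 → K) :=
    (LinearMap.proj 0).smulRight (B.coord 2) + (LinearMap.proj 1).smulRight (B.coord 3)
  let v : Fin 4 → Fin 2 → K := fun i => ![n i 1, -n i 0]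
  have hv : ∀ i, v i ≠ 0 := fun i h0 => hn i <| by
    ext j; fin_cases j
    exacts [neg_eq_zero.mp (congrFun h0 1), congrFun h0 0]
  have hφ : Function.Injective φ := by
    rw [injective_iff_map_eq_zero]
    intro a ha
    by_contra h0
    exact lineVec_ne_zero hg h0 ha
  have hψa : ∀ w, ψ w = w 0 • B.coord 2 + w 1 • B.coord 3 := fun w => rfl
  have hψ : Function.Injective ψ := by
    rw [injective_iff_map_eq_zero]
    intro w hw
    rw [hψa] at hw
    have e2 := LinearMap.congr_fun hw (g 2)
    have e3 := LinearMap.congr_fun hw (g 3)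
    simp only [LinearMap.add_apply, LinearMap.smul_apply, hc] at e2 e3
    ext j; fin_cases j
    · simpa using e2
    · simpa using e3
  have hpt : ∀ i, (f.point i).carrier = Submodule.span K {φ (u i)} := fun i => by
    rw [← f.family_singleton, hF, lineFamily_singleton]; rfl
  have hpl : ∀ i, (f.plane i).carrier.dualAnnihilator = Submodule.span K {ψ (v i)} := by
    intro i
    have hψv : ψ (v i) ≠ 0 := fun h0 => hv i ((map_eq_zero_iff ψ hψ).mp h0)
    refine (Submodule.eq_of_le_of_finrank_eq ?_ ?_).symm
    · rw [Submodule.span_singleton_le_iff_mem, ← f.family_compl, hF, lineFamily_plane,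
        Submodule.mem_dualAnnihilator]
      have hle : Submodule.span K {g 0, g 1} ⊔ Submodule.span K {normalVec g (n i)} ≤
          LinearMap.ker (ψ (v i)) := by
        refine sup_le (Submodule.span_le.mpr ?_) ((Submodule.span_singleton_le_iff_mem _ _).mpr ?_)
        · rintro z (rfl | rfl) <;>
          simp [hψa, hc, -Basis.coord_apply]
        · rw [LinearMap.mem_ker, hψa, normalVec]
          simp [hc, v, -Basis.coord_apply]
          ring
      exact fun w hw => hle hw
    · have h1 := Subspace.finrank_add_finrank_dualAnnihilator_eq (f.plane i).carrier
      rw [← f.family_compl, f.isConfig_family.rank, Finset.card_compl,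
        finrank_fintype_fun_eq_card] at h1
      rw [finrank_span_singleton hψv, ← f.family_compl]
      simp at h1
      omega
  have nt : ¬ ThreeCoincide fun i => (f.point i).carrier := by
    rintro ⟨i, j, k, hij, hjk, hik, h1, h2⟩
    exact h3 ⟨i, j, k, hij, hjk, hik, Vertex.ext h1, Vertex.ext h2⟩
  have nt' : ¬ ThreeCoincide fun i => (f.plane i).carrier.dualAnnihilator := by
    rintro ⟨i, j, k, hij, hjk, hik, h1, h2⟩
    exact h3' ⟨i, j, k, hij, hjk, hik, Vertex.ext (Subspace.dualAnnihilator_inj.mp h1),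
      Vertex.ext (Subspace.dualAnnihilator_inj.mp h2)⟩
  have hu' : ∀ i, u i ≠ 0 ∧ (f.point i).carrier = Submodule.span K {φ (u i)} :=
    fun i => ⟨hu i, hpt i⟩
  have hv' : ∀ i, v i ≠ 0 ∧ (f.plane i).carrier.dualAnnihilator = Submodule.span K {ψ (v i)} :=
    fun i => ⟨hv i, hpl i⟩
  have hd : crossDet u v = 0 := by
    rw [← h]
    simp [crossDet, bracket, v]
    ring
  exact ⟨crossRatio u, ⟨nt, φ, u, hφ, hu', rfl⟩, nt', ψ, v, hψ, hv',
    crossRatio_eq_of_crossDet (bracket_ne_zero_of_not_threeCoincide nt hu')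
      (bracket_ne_zero_of_not_threeCoincide nt' hv') hd⟩

end Field

variable {K : Type*} [NontriviallyNormedField K] [CompleteSpace K]
  {b : Basis (Fin 4) K (Fin 4 → K)} {f : Mor (apartment b)}

/-- The tensors of points and planes are taken with respect to a basis adapted to the common line;
their determinant `crossDet` vanishes if and only if the cross-ratios agree. -/
theorem Mor.mem_closure_iff_isSymmetricL (hL : f.IsTypeL) :
    f ∈ closure {h : Mor (apartment b) | h.IsMarkedApartment} ↔ f.IsSymmetricL := by
  rw [mem_closure_marked_iff]
  have hF := f.isConfig_family
  have hl := Mor.isTypeL_iff.mp hL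
  constructor
  · intro h
    by_cases h3 : ThreeCoincide f.point
    · exact Or.inl h3
    by_cases h3' : ThreeCoincide f.plane
    · exact Or.inr (Or.inl h3')
    obtain ⟨g, hg, hm⟩ := exists_adapted_basis (K := K) (m := f.family {0, 1}) (by rw [hF.rank]; rfl)
    obtain ⟨u, n, hu, hn, e⟩ := exists_eq_lineFamily hF hg fun S hS =>
      (hl S {0, 1} hS (by decide)).trans hm
    exact Or.inr (Or.inr (hasCrossRatio_of_lineFamily hg hu hn e h3 h3'
      (crossDet_eq_zero_of_mem_closure hg hu hn (e ▸ h))))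
  · rintro (⟨i, j, k, hij, hjk, hik, h1, h2⟩ | ⟨i, j, k, hij, hjk, hik, h1, h2⟩ | ⟨c, h, h'⟩)
    · refine mem_closure_of_lines_eq_of_three_points hF hl hij hik hjk ?_ ?_
      · rw [f.family_singleton, f.family_singleton, h1]
      · rw [f.family_singleton, f.family_singleton, h2]
    · refine mem_closure_of_lines_eq_of_three_planes hF hl hij hik hjk ?_ ?_
      · rw [f.family_compl, f.family_compl, h1]
      · rw [f.family_compl, f.family_compl, h2]
    · obtain ⟨g, u, v, hg, hu, hv, hu3, hv3, hc, hc', e⟩ :=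
        exists_lineFamily_of_hasCrossRatio hL h h'
      -- a functional on `K²` is turned into a vector that it kills, which preserves `bracket`
      have hb : ∀ i j, bracket (![-v i 1, v i 0] : Fin 2 → K) ![-v j 1, v j 0] =
          bracket (v i) (v j) := fun i j => by simp [bracket]; ring
      rw [e]
      refine lineFamily_mem_closure_of_crossDet hg hu (fun i h0 => hv i ?_) hu3
        (by simpa only [hb] using hv3) ?_
      · ext j; fin_cases j
        exacts [congrFun h0 1, neg_eq_zero.mp (congrFun h0 0)]
      · have hd := crossDet_eq_zero_of_crossRatio (hc.symm.trans hc')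
        simpa only [crossDet, hb] using hd

end TypeL

/-! ### Families with a common point and a common plane -/

section Pencil

variable {K : Type*}

section Field

variable [Field K] {g : Fin 4 → (Fin 4 → K)}

/-- The line through the point `⟨g 2⟩` in the plane `⟨g 0, g 1, g 2⟩` with given coordinates. -/
def pencilLine (g : Fin 4 → (Fin 4 → K)) (a : Fin 2 → K) : Submodule K (Fin 4 → K) :=
  Submodule.span K {g 2, lineVec g a}

lemma lineVec_add (a c : Fin 2 → K) : lineVec g (a + c) = lineVec g a + lineVec g c := by
  simp only [lineVec, Pi.add_apply]; module

lemma lineVec_sub (a c : Fin 2 → K) : lineVec g (a - c) = lineVec g a - lineVec g c := by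
  simp only [lineVec, Pi.sub_apply]; module

lemma eq_zero_of_lineVec_add_smul (hg : LinearIndependent K g) {a : Fin 2 → K} {r : K}
    (h : lineVec g a + r • g 2 = 0) : a = 0 ∧ r = 0 := by
  have h' : ∑ i, ![a 0, a 1, r, 0] i • g i = 0 := by
    simpa [Fin.sum_univ_four, lineVec] using h
  have := Fintype.linearIndependent_iff.mp hg _ h'
  exact ⟨by ext i; fin_cases i; exacts [this 0, this 1], this 2⟩

lemma smul_add_lineVec_mem_pencilLine_iff (hg : LinearIndependent K g) {a : Fin 2 → K} (ha : a ≠ 0)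
    (r : K) (c : Fin 2 → K) : r • g 2 + lineVec g c ∈ pencilLine g a ↔ bracket a c = 0 := by
  constructor
  · intro h
    obtain ⟨s, t, hst⟩ := Submodule.mem_span_pair.mp h
    have := (eq_zero_of_lineVec_add_smul hg (a := c - t • a) (r := r - s) (by
      rw [lineVec_sub, lineVec_smul, sub_smul, ← sub_eq_zero.mpr hst.symm]; abel)).1
    rw [sub_eq_zero.mp this, bracket_smul_right, bracket_self, mul_zero]
  · intro h
    have hc : ∃ t : K, c = t • a := by
      by_cases hc : c = 0
      · exact ⟨0, by rw [hc, zero_smul]⟩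
      · obtain ⟨t, -, ht⟩ := exists_smul_of_bracket_eq_zero ha hc h
        exact ⟨t, ht⟩
    obtain ⟨t, rfl⟩ := hc
    exact Submodule.mem_span_pair.mpr ⟨r, t, by rw [lineVec_smul]⟩

lemma lineVec_mem_pencilLine_iff (hg : LinearIndependent K g) {a c : Fin 2 → K} (ha : a ≠ 0) :
    lineVec g c ∈ pencilLine g a ↔ bracket a c = 0 := by
  simpa using smul_add_lineVec_mem_pencilLine_iff hg ha 0 c

lemma lineVec_notMem_span (hg : LinearIndependent K g) {a : Fin 2 → K} (ha : a ≠ 0)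
    (c : Fin 2 → K) : lineVec g a ∉ Submodule.span K {g 2 + lineVec g c} := by
  intro h
  obtain ⟨t, ht⟩ := Submodule.mem_span_singleton.mp h
  obtain ⟨h1, h2⟩ := eq_zero_of_lineVec_add_smul hg (a := a - t • c) (r := -t) (by
    rw [lineVec_sub, lineVec_smul, ← ht]; module)
  rw [neg_eq_zero.mp h2, zero_smul, sub_zero] at h1
  exact ha h1

lemma ne_zero_of_add_lineVec (hg : LinearIndependent K g) (c : Fin 2 → K) :
    g 2 + lineVec g c ≠ 0 := by
  intro h
  exact one_ne_zero (eq_zero_of_lineVec_add_smul hg (a := c) (r := (1 : K))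
    (by rw [one_smul, add_comm]; exact h)).2

lemma pencilLine_eq_sup (a : Fin 2 → K) :
    pencilLine g a = Submodule.span K {g 2} ⊔ Submodule.span K {lineVec g a} := by
  rw [pencilLine, Set.insert_eq, Submodule.span_union]

lemma finrank_pencilLine (hg : LinearIndependent K g) {a : Fin 2 → K} (ha : a ≠ 0) :
    finrank K (pencilLine g a) = 2 := by
  have h := lineVec_notMem_span hg ha 0
  have h0 := ne_zero_of_add_lineVec hg 0
  have e : lineVec g 0 = 0 := by simp [lineVec]
  rw [e, add_zero] at h h0
  rw [pencilLine_eq_sup, Submodule.finrank_sup_span_singleton h, finrank_span_singleton h0]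

lemma pencilLine_eq_iff (hg : LinearIndependent K g) {a c : Fin 2 → K} (ha : a ≠ 0) (hc : c ≠ 0) :
    pencilLine g a = pencilLine g c ↔ bracket a c = 0 := by
  constructor
  · intro h
    rw [← lineVec_mem_pencilLine_iff hg ha, h]
    exact Submodule.subset_span (by simp)
  · intro h
    obtain ⟨r, hr, rfl⟩ := exists_smul_of_bracket_eq_zero ha hc h
    rw [pencilLine_eq_sup, pencilLine_eq_sup, lineVec_smul,
      Submodule.span_singleton_smul_eq (IsUnit.mk0 r hr)]

lemma finrank_span_plane (hg : LinearIndependent K g) :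
    finrank K (Submodule.span K {g 0, g 1, g 2}) = 3 := by
  have h := finrank_span_image (c := g) (S := {0, 1, 2})
    ((linearIndepOn_univ_iff.mpr hg).mono (Set.subset_univ _))
  rw [Finset.coe_insert, Finset.coe_insert, Finset.coe_singleton, Set.image_insert_eq,
    Set.image_pair] at h
  exact h

lemma lineVec_mem_plane (a : Fin 2 → K) : lineVec g a ∈ Submodule.span K {g 0, g 1, g 2} :=
  Submodule.span_mono (by intro z; simp; tauto) (lineVec_mem a)

/-- The lines of the pencil are given by coordinates. -/
lemma exists_eq_pencilLine (hg : LinearIndependent K g) {l : Submodule K (Fin 4 → K)}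
    (h2 : finrank K l = 2) (hx : g 2 ∈ l) (hl : l ≤ Submodule.span K {g 0, g 1, g 2}) :
    ∃ a, a ≠ 0 ∧ l = pencilLine g a := by
  have h0 : g 2 ≠ 0 := hg.ne_zero 2
  obtain ⟨y, hy, hy2⟩ : ∃ y ∈ l, y ∉ Submodule.span K {g 2} := by
    by_contra! hn
    have := Submodule.finrank_mono (show l ≤ Submodule.span K {g 2} from hn)
    rw [h2, finrank_span_singleton h0] at this
    omega
  obtain ⟨r, z, hz, rfl⟩ := Submodule.mem_span_insert.mp (hl hy)
  obtain ⟨s, t, rfl⟩ := Submodule.mem_span_pair.mp hz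
  have e : r • g 0 + (s • g 1 + t • g 2) = lineVec g ![r, s] + t • g 2 := by
    simp [lineVec]; abel
  rw [e] at hy hy2
  have ha : (![r, s] : Fin 2 → K) ≠ 0 := by
    intro h
    refine hy2 ?_
    rw [h]
    simpa [lineVec] using Submodule.smul_mem _ t (Submodule.mem_span_singleton_self (g 2))
  refine ⟨![r, s], ha, (Submodule.eq_of_le_of_finrank_eq ?_ ?_).symm⟩
  · refine Submodule.span_le.mpr ?_
    rintro z (rfl | rfl)
    · exact hx
    · have := sub_mem hy (l.smul_mem t hx)
      rwa [add_sub_cancel_right] at this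
  · rw [finrank_pencilLine hg ha, h2]

/-- The family with points `g 2 + Q i`, where `Q i` is a vector of the line `⟨g 0, g 1⟩`, with lines
that meet this line in the points with coordinates `m S`, and with all planes equal. -/
noncomputable def pencilFamily (g : Fin 4 → (Fin 4 → K)) (Q : Fin 4 → Fin 2 → K)
    (m : Finset (Fin 4) → Fin 2 → K) : Family K := fun S =>
  if S.card ≤ 1 then Submodule.span K ((fun i => g 2 + lineVec g (Q i)) '' (S : Set (Fin 4))) else
  if S.card = 2 then Submodule.span K ((fun i => g 2 + lineVec g (Q i)) '' (S : Set (Fin 4))) ⊔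
    Submodule.span K {lineVec g (m S)} else
  if S.card = 3 then Submodule.span K {g 0, g 1, g 2} else ⊤

variable {Q : Fin 4 → Fin 2 → K} {m : Finset (Fin 4) → Fin 2 → K}

lemma pencilFamily_empty : pencilFamily g Q m ∅ = ⊥ := by simp [pencilFamily]

lemma pencilFamily_singleton (i : Fin 4) :
    pencilFamily g Q m {i} = Submodule.span K {g 2 + lineVec g (Q i)} := by simp [pencilFamily]

lemma pencilFamily_pair (hm : ∀ S : Finset (Fin 4), S.card = 2 → m S ≠ 0)
    (hQ : ∀ i j, i ≠ j → bracket (m {i, j}) (Q j - Q i) = 0) {i j : Fin 4} (hij : i ≠ j) :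
    pencilFamily g Q m {i, j} = Submodule.span K {g 2 + lineVec g (Q i)} ⊔
      Submodule.span K {lineVec g (m {i, j})} := by
  have hc := Finset.card_pair hij
  simp only [pencilFamily, hc, Finset.coe_insert, Finset.coe_singleton, Set.image_pair]
  rw [if_neg (by norm_num), if_pos trivial]
  refine le_antisymm (sup_le (Submodule.span_le.mpr ?_) le_sup_right)
    (sup_le_sup (Submodule.span_mono (by simp)) le_rfl)
  have hi : g 2 + lineVec g (Q i) ∈ Submodule.span K {g 2 + lineVec g (Q i)} ⊔
      Submodule.span K {lineVec g (m {i, j})} :=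
    Submodule.mem_sup_left (Submodule.mem_span_singleton_self _)
  rintro z (rfl | rfl)
  · exact hi
  · have hd : lineVec g (Q j - Q i) ∈ Submodule.span K {lineVec g (m {i, j})} := by
      by_cases h0 : Q j - Q i = 0
      · rw [h0]; simp [lineVec]
      · obtain ⟨r, -, hr⟩ := exists_smul_of_bracket_eq_zero (hm _ hc) h0 (hQ i j hij)
        rw [hr, lineVec_smul]
        exact Submodule.smul_mem _ _ (Submodule.mem_span_singleton_self _)
    have := add_mem hi (Submodule.mem_sup_right (S := Submodule.span K {g 2 + lineVec g (Q i)}) hd)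
    rw [lineVec_sub] at this
    simpa using this

lemma pencilFamily_plane {S : Finset (Fin 4)} (hS : S.card = 3) :
    pencilFamily g Q m S = Submodule.span K {g 0, g 1, g 2} := by simp [pencilFamily, hS]

lemma pencilFamily_univ : pencilFamily g Q m Finset.univ = ⊤ := by simp [pencilFamily]

lemma isConfig_pencilFamily (hg : LinearIndependent K g)
    (hm : ∀ S : Finset (Fin 4), S.card = 2 → m S ≠ 0)
    (hQ : ∀ i j, i ≠ j → bracket (m {i, j}) (Q j - Q i) = 0) :
    IsConfig Finset.univ (pencilFamily g Q m) := by
  have hc3 : ∀ i : Fin 4, ({i}ᶜ : Finset (Fin 4)).card = 3 := by decide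
  constructor
  · intro S _
    rcases subset_cases S with rfl | ⟨i, rfl⟩ | hS | ⟨i, rfl⟩ | rfl
    · rw [pencilFamily_empty]; simp
    · rw [pencilFamily_singleton, finrank_span_singleton (ne_zero_of_add_lineVec hg _)]; rfl
    · obtain ⟨i, j, hij, rfl⟩ := exists_pair_eq S hS
      rw [pencilFamily_pair hm hQ hij,
        Submodule.finrank_sup_span_singleton (lineVec_notMem_span hg (hm _ hS) _),
        finrank_span_singleton (ne_zero_of_add_lineVec hg _), hS]
    · rw [pencilFamily_plane (hc3 i), finrank_span_plane hg, hc3]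
    · rw [pencilFamily_univ]; simp
  · intro S S' h _
    have hpl : ∀ S : Finset (Fin 4), S.card ≤ 3 →
        pencilFamily g Q m S ≤ Submodule.span K {g 0, g 1, g 2} := by
      intro S hS
      have hpt : ∀ i, g 2 + lineVec g (Q i) ∈ Submodule.span K {g 0, g 1, g 2} := fun i =>
        add_mem (Submodule.subset_span (by simp)) (lineVec_mem_plane _)
      rcases subset_cases S with rfl | ⟨i, rfl⟩ | hS | ⟨i, rfl⟩ | rfl
      · rw [pencilFamily_empty]; exact bot_le
      · rw [pencilFamily_singleton, Submodule.span_singleton_le_iff_mem]; exact hpt i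
      · obtain ⟨i, j, hij, rfl⟩ := exists_pair_eq S hS
        rw [pencilFamily_pair hm hQ hij]
        exact sup_le ((Submodule.span_singleton_le_iff_mem _ _).mpr (hpt i))
          ((Submodule.span_singleton_le_iff_mem _ _).mpr (lineVec_mem_plane _))
      · rw [pencilFamily_plane (hc3 i)]
      · simp at hS
    rcases eq_or_ne S S' with rfl | hne
    · exact le_rfl
    have hlt := Finset.card_lt_card (Finset.ssubset_iff_subset_ne.mpr ⟨h, hne⟩)
    rcases subset_cases S' with rfl | ⟨i, rfl⟩ | hS' | ⟨i, rfl⟩ | rfl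
    · simp at hlt
    · rw [Finset.card_singleton, Nat.lt_one_iff] at hlt
      rw [Finset.card_eq_zero.mp hlt, pencilFamily_empty]; exact bot_le
    · have hS : S.card ≤ 1 := by omega
      simp only [pencilFamily, hS, hS', if_true]
      rw [if_neg (by norm_num)]
      exact (Submodule.span_mono (Set.image_mono (by exact_mod_cast h))).trans le_sup_left
    · rw [pencilFamily_plane (hc3 i)]
      exact hpl S (by rw [hc3] at hlt; omega)
    · rw [pencilFamily_univ]; exact le_top

lemma eq_pencilFamily {F : Family K} (hF : IsConfig Finset.univ F)
    (h1 : ∀ i, F {i} = Submodule.span K {g 2})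
    (h2 : ∀ S : Finset (Fin 4), S.card = 2 → F S = pencilLine g (m S))
    (h3 : ∀ i, F {i}ᶜ = Submodule.span K {g 0, g 1, g 2}) (hm : ∀ S : Finset (Fin 4), S.card = 2 → m S ≠ 0) :
    F = pencilFamily g 0 m := by
  have e : lineVec g 0 = 0 := by simp [lineVec]
  have hc3 : ∀ i : Fin 4, ({i}ᶜ : Finset (Fin 4)).card = 3 := by decide
  funext S
  rcases subset_cases S with rfl | ⟨i, rfl⟩ | hS | ⟨i, rfl⟩ | rfl
  · rw [pencilFamily_empty, hF.eq_bot]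
  · rw [pencilFamily_singleton, h1, Pi.zero_apply, e, add_zero]
  · rw [h2 S hS]
    obtain ⟨i, j, hij, rfl⟩ := exists_pair_eq S hS
    rw [pencilFamily_pair hm (by simp [bracket]) hij, Pi.zero_apply, e, add_zero, pencilLine_eq_sup]
  · rw [pencilFamily_plane (hc3 i), h3]
  · rw [pencilFamily_univ, hF.univ_eq_top]

end Field

variable [NontriviallyNormedField K] [CompleteSpace K] {g : Fin 4 → (Fin 4 → K)}
  {m : Finset (Fin 4) → Fin 2 → K}

/-- If four points of the affine plane, not all equal, are joined by lines in the directions `m S`,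
then the points of the family can be moved apart within the common plane. -/
theorem pencilFamily_mem_closure (hg : LinearIndependent K g)
    (hm : ∀ S : Finset (Fin 4), S.card = 2 → m S ≠ 0) {Q : Fin 4 → Fin 2 → K}
    (hQ : ∀ i j, i ≠ j → bracket (m {i, j}) (Q j - Q i) = 0) (hne : ∃ i j, Q i ≠ Q j) :
    pencilFamily g 0 m ∈ closure (frameFamilies K Finset.univ) := by
  have hQs : ∀ s : K, ∀ i j, i ≠ j → bracket (m {i, j}) ((s • Q) j - (s • Q) i) = 0 := by
    intro s i j hij
    rw [Pi.smul_apply, Pi.smul_apply, ← smul_sub, bracket_smul_right, hQ i j hij, mul_zero]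
  have hc3 : ∀ i : Fin 4, ({i}ᶜ : Finset (Fin 4)).card = 3 := by decide
  have e0 : ((0 : K) • Q) = 0 := zero_smul _ _
  refine mem_closure_of_tendsto_family (l := 𝓝[≠] (0 : K)) (fun s => pencilFamily g (s • Q) m) ?_
    fun S _ => ?_
  · filter_upwards [self_mem_nhdsWithin] with s hs
    have hs : s ≠ 0 := hs
    have hF := isConfig_pencilFamily hg hm (hQs s)
    by_cases hl : ∃ S S' : Finset (Fin 4), S.card = 2 ∧ S'.card = 2 ∧
        pencilFamily g (s • Q) m S ≠ pencilFamily g (s • Q) m S'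
    · refine mem_closure_of_points_ne hF ?_ hl
      obtain ⟨i, j, hij⟩ := hne
      refine ⟨i, j, fun h => hij ?_⟩
      rw [pencilFamily_singleton, pencilFamily_singleton] at h
      by_contra hij
      have h1 : g 2 + lineVec g ((s • Q) i) ∈ Submodule.span K {g 2 + lineVec g ((s • Q) j)} :=
        h ▸ Submodule.mem_span_singleton_self _
      have h2 := sub_mem h1 (Submodule.mem_span_singleton_self _)
      rw [add_sub_add_left_eq_sub, ← lineVec_sub, Pi.smul_apply, Pi.smul_apply, ← smul_sub] at h2
      exact lineVec_notMem_span hg (smul_ne_zero hs (sub_ne_zero.mpr hij)) _ h2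
    · push Not at hl
      refine mem_closure_of_lines_eq_of_three_planes hF (fun S S' => hl S S') (i := 0) (j := 1)
        (k := 2) (by decide) (by decide) (by decide) ?_ ?_ <;>
      rw [pencilFamily_plane (hc3 _), pencilFamily_plane (hc3 _)]
  · have hr := (isConfig_pencilFamily hg hm (Q := 0) (by simp [bracket])).rank S
    have hcont : ∀ i, Continuous fun s : K => g 2 + lineVec g ((s • Q) i) := fun i =>
      continuous_const.add (continuous_lineVec (by fun_prop))
    have hc0 : ∀ i, g 2 + lineVec g (((0 : K) • Q) i) =
        g 2 + lineVec g ((0 : Fin 4 → Fin 2 → K) i) := fun i => by rw [e0]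
    rcases subset_cases S with rfl | ⟨i, rfl⟩ | hS | ⟨i, rfl⟩ | rfl
    · simp only [pencilFamily_empty]; exact tendsto_const_nhds
    · rw [pencilFamily_singleton] at hr ⊢
      simp only [pencilFamily_singleton]
      exact tendsto_of_vec (fun s => g 2 + lineVec g ((s • Q) i)) (hcont i)
        (fun s _ => Submodule.mem_span_singleton_self _)
        (fun s => (finrank_span_le_card _).trans_eq (by simp)) (by rw [hc0]) hr
    · obtain ⟨i, j, hij, rfl⟩ := exists_pair_eq S hS
      have hr' := fun s => ((isConfig_pencilFamily hg hm (hQs s)).rank {i, j}).trans hS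
      refine tendsto_of_two_vecs (fun s => g 2 + lineVec g ((s • Q) i))
        (fun _ => lineVec g (m {i, j})) (hcont i) continuous_const (fun s _ => ?_)
        (fun s => (hr' s).le) ?_ (hr.trans hS)
      · rw [pencilFamily_pair hm (hQs s) hij]
        exact ⟨Submodule.mem_sup_left (Submodule.mem_span_singleton_self _),
          Submodule.mem_sup_right (Submodule.mem_span_singleton_self _)⟩
      · rw [hc0, pencilFamily_pair hm (by simp [bracket]) hij, Set.insert_eq, Submodule.span_union]
    · simp only [pencilFamily_plane (hc3 i)]; exact tendsto_const_nhds
    · simp only [pencilFamily_univ]; exact tendsto_const_nhds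

end Pencil

/-! ### Plane quadrangles with given directions -/

section Shift

variable {K : Type*} [Field K]

/-- The points `Q i` of the affine plane are not all equal and are joined by lines in the
directions `μ i j`. -/
def IsShift (μ : Fin 4 → Fin 4 → Fin 2 → K) (Q : Fin 4 → Fin 2 → K) : Prop :=
  (∀ i j, i ≠ j → bracket (μ i j) (Q j - Q i) = 0) ∧ ∃ i j, Q i ≠ Q j

variable {μ : Fin 4 → Fin 4 → Fin 2 → K} {Q : Fin 4 → Fin 2 → K}

lemma IsShift.of_perm (σ : Equiv.Perm (Fin 4)) (h : IsShift (fun i j => μ (σ i) (σ j)) Q) :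
    IsShift μ (Q ∘ σ.symm) := by
  obtain ⟨h1, i, j, hij⟩ := h
  refine ⟨fun i j hij => ?_, σ i, σ j, by simpa using hij⟩
  have := h1 (σ.symm i) (σ.symm j) (σ.symm.injective.ne hij)
  simpa using this

lemma isShift_of_six (hμ : ∀ i j, μ i j = μ j i) (h01 : bracket (μ 0 1) (Q 1 - Q 0) = 0)
    (h02 : bracket (μ 0 2) (Q 2 - Q 0) = 0) (h03 : bracket (μ 0 3) (Q 3 - Q 0) = 0)
    (h12 : bracket (μ 1 2) (Q 2 - Q 1) = 0) (h13 : bracket (μ 1 3) (Q 3 - Q 1) = 0)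
    (h23 : bracket (μ 2 3) (Q 3 - Q 2) = 0) (hne : ∃ i j, Q i ≠ Q j) : IsShift μ Q := by
  have hlt : ∀ i j, i < j → bracket (μ i j) (Q j - Q i) = 0 := by
    intro i j hij
    have key : ∀ i j : Fin 4, i < j → (i = 0 ∧ j = 1) ∨ (i = 0 ∧ j = 2) ∨ (i = 0 ∧ j = 3) ∨
      (i = 1 ∧ j = 2) ∨ (i = 1 ∧ j = 3) ∨ (i = 2 ∧ j = 3) := by decide
    rcases key i j hij with ⟨rfl, rfl⟩ | ⟨rfl, rfl⟩ | ⟨rfl, rfl⟩ | ⟨rfl, rfl⟩ | ⟨rfl, rfl⟩ |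
      ⟨rfl, rfl⟩ <;> assumption
  refine ⟨fun i j hij => ?_, hne⟩
  rcases lt_or_gt_of_ne hij with h | h
  · exact hlt i j h
  · have := hlt j i h
    rw [hμ, ← neg_sub, ← neg_one_smul K, bracket_smul_right, this, mul_zero]

/-- If the three directions at `i` agree, then the point with label `i` can be moved in this
direction. -/
lemma exists_isShift_of_star (hμ : ∀ i j, μ i j = μ j i) (h0 : ∀ i j, i ≠ j → μ i j ≠ 0) {i : Fin 4}
    (h : ∀ j k, j ≠ i → k ≠ i → bracket (μ i j) (μ i k) = 0) : ∃ Q, IsShift μ Q := by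
  classical
  obtain ⟨l, hl⟩ := exists_ne i
  refine ⟨Pi.single i (μ i l), fun j k hjk => ?_, i, l, ?_⟩
  · rcases eq_or_ne j i with rfl | hj
    · rw [Pi.single_eq_same, Pi.single_eq_of_ne hjk.symm, zero_sub, ← neg_one_smul K,
        bracket_smul_right, h k l hjk.symm hl, mul_zero]
    · rcases eq_or_ne k i with rfl | hk
      · rw [Pi.single_eq_same, Pi.single_eq_of_ne hj, sub_zero, hμ, h j l hj hl]
      · rw [Pi.single_eq_of_ne hj, Pi.single_eq_of_ne hk, sub_zero]
        simp [bracket]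
  · rw [Pi.single_eq_same, Pi.single_eq_of_ne hl]
    exact h0 i l hl.symm

/-- If the three directions in a triangle agree, then either the directions at one of its vertices
agree, or its vertices can be moved to a line, the fourth point being fixed. -/
lemma exists_isShift_of_triangle (hμ : ∀ i j, μ i j = μ j i) (h0 : ∀ i j, i ≠ j → μ i j ≠ 0)
    {i j k : Fin 4} (hij : i ≠ j) (hik : i ≠ k) (hjk : j ≠ k) (h1 : bracket (μ i j) (μ i k) = 0)
    (h2 : bracket (μ i j) (μ j k) = 0) : ∃ Q, IsShift μ Q := by
  obtain ⟨σ, rfl, rfl, rfl⟩ := exists_perm_of_distinct hij hik hjk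
  suffices h : ∃ Q, IsShift (fun i j => μ (σ i) (σ j)) Q by
    obtain ⟨Q, hQ⟩ := h
    exact ⟨_, hQ.of_perm σ⟩
  replace hμ : ∀ i j, μ (σ i) (σ j) = μ (σ j) (σ i) := fun i j => hμ _ _
  replace h0 : ∀ i j, i ≠ j → μ (σ i) (σ j) ≠ 0 := fun i j h => h0 _ _ (σ.injective.ne h)
  clear hij hik hjk
  revert hμ h0 h1 h2
  generalize hν : (fun i j => μ (σ i) (σ j)) = ν
  have hν' : ∀ i j, μ (σ i) (σ j) = ν i j := fun i j => by rw [← hν]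
  simp only [hν']
  intro h1 h2 hμ h0
  clear hν hν'
  obtain ⟨r, hr, e1⟩ := exists_smul_of_bracket_eq_zero (h0 0 1 (by decide)) (h0 0 2 (by decide)) h1
  obtain ⟨s, hs, e2⟩ := exists_smul_of_bracket_eq_zero (h0 0 1 (by decide)) (h0 1 2 (by decide)) h2
  -- two agreeing directions at a vertex of the triangle, and the third one
  have star : ∀ i a b l : Fin 4, (∀ j, j ≠ i → j = a ∨ j = b ∨ j = l) →
      (∃ t : K, ν i a = t • ν 0 1) → (∃ t : K, ν i b = t • ν 0 1) →
      bracket (ν 0 1) (ν i l) = 0 → ∃ Q, IsShift ν Q := by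
    intro i a b l hcov ha hb hl
    refine exists_isShift_of_star hμ h0 (i := i) ?_
    have hall : ∀ j, j ≠ i → ∃ t : K, ν i j = t • ν 0 1 := by
      intro j hj
      rcases hcov j hj with rfl | rfl | rfl
      · exact ha
      · exact hb
      · obtain ⟨t, -, ht⟩ := exists_smul_of_bracket_eq_zero (h0 0 1 (by decide)) (h0 _ _ hj.symm) hl
        exact ⟨t, ht⟩
    intro j k hj hk
    obtain ⟨t, ht⟩ := hall j hj
    obtain ⟨t', ht'⟩ := hall k hk
    rw [ht, ht', bracket_smul_left, bracket_smul_right, bracket_self, mul_zero, mul_zero]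
  by_cases d0 : bracket (ν 0 1) (ν 0 3) = 0
  · exact star 0 1 2 3 (by decide) ⟨1, (one_smul _ _).symm⟩ ⟨r, e1⟩ d0
  by_cases d1 : bracket (ν 0 1) (ν 1 3) = 0
  · exact star 1 0 2 3 (by decide) ⟨1, by rw [one_smul, hμ]⟩ ⟨s, e2⟩ d1
  by_cases d2 : bracket (ν 0 1) (ν 2 3) = 0
  · exact star 2 0 1 3 (by decide) ⟨r, by rw [hμ, e1]⟩ ⟨s, by rw [hμ, e2]⟩ d2
  have sub : ∀ a x y : Fin 2 → K, bracket a (x - y) = bracket a x - bracket a y := fun a x y => by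
    simp [bracket]; ring
  refine ⟨![(bracket (ν 0 1) (ν 0 3))⁻¹ • ν 0 3, (bracket (ν 0 1) (ν 1 3))⁻¹ • ν 1 3,
    (bracket (ν 0 1) (ν 2 3))⁻¹ • ν 2 3, 0], isShift_of_six hμ ?_ ?_ ?_ ?_ ?_ ?_ ⟨0, 3, ?_⟩⟩
  · simp [sub, bracket_smul_right, d0, d1]
  · simp [e1, bracket_smul_left, sub, bracket_smul_right]
    field_simp
    ring
  · simp [bracket]; ring
  · simp [e2, bracket_smul_left, sub, bracket_smul_right]
    field_simp
    ring
  · simp [bracket]; ring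
  · simp [bracket]; ring
  · simpa using ⟨d0, h0 0 3 (by decide)⟩

/-- The symmetric bilinear form on `K²` with given coefficients. -/
def symForm (β : Fin 3 → K) (x y : Fin 2 → K) : K :=
  β 0 * (x 0 * y 0) + β 1 * (x 0 * y 1 + x 1 * y 0) + β 2 * (x 1 * y 1)

lemma symForm_comm (β : Fin 3 → K) (x y : Fin 2 → K) : symForm β x y = symForm β y x := by
  simp only [symForm]; ring

/-- If opposite directions are orthogonal for a nondegenerate symmetric bilinear form, then the
projections of the plane that are given by this form yield four points joined by lines in these
directions. -/
lemma exists_isShift_of_symForm (hμ : ∀ i j, μ i j = μ j i) (h0 : ∀ i j, i ≠ j → μ i j ≠ 0)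
    {β : Fin 3 → K} (hβ : β 0 * β 2 - β 1 * β 1 ≠ 0) (h1 : symForm β (μ 0 1) (μ 2 3) = 0)
    (h2 : symForm β (μ 0 2) (μ 1 3) = 0) (h3 : symForm β (μ 0 3) (μ 1 2) = 0) :
    ∃ Q, IsShift μ Q := by
  have key : ∀ x y z : Fin 2 → K, z ≠ 0 → symForm β x z = 0 → symForm β y z = 0 →
      bracket x y = 0 := by
    intro x y z hz hx hy
    have hz' : ∀ i, bracket x y * z i = 0 := by
      intro i
      refine (mul_eq_zero.mp ?_).resolve_left hβ
      simp only [symForm, bracket] at hx hy ⊢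
      fin_cases i
      · simp only [Fin.zero_eta]
        linear_combination (β 1 * y 0 + β 2 * y 1) * hx - (β 1 * x 0 + β 2 * x 1) * hy
      · simp only [Fin.mk_one]
        linear_combination -(β 0 * y 0 + β 1 * y 1) * hx + (β 0 * x 0 + β 1 * x 1) * hy
    by_contra hne
    refine hz ?_
    ext i
    exact (mul_eq_zero.mp (hz' i)).resolve_left hne
  by_cases hstar : symForm β (μ 0 2) (μ 0 3) = 0 ∧ symForm β (μ 0 1) (μ 0 3) = 0 ∧
      symForm β (μ 0 1) (μ 0 2) = 0
  · obtain ⟨hvw, huw, huv⟩ := hstar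
    have e1 := key _ _ _ (h0 0 3 (by decide)) huw hvw
    have e2 := key _ _ _ (h0 0 2 (by decide)) huv (by rw [symForm_comm]; exact hvw)
    have e3 := key _ _ _ (h0 0 1 (by decide)) (by rw [symForm_comm]; exact huv)
      (by rw [symForm_comm]; exact huw)
    refine exists_isShift_of_star hμ h0 (i := 0) fun j k hj hk => ?_
    have sw : ∀ x y : Fin 2 → K, bracket x y = 0 → bracket y x = 0 := fun x y h => by
      rw [bracket_comm, h, neg_zero]
    fin_cases j <;> fin_cases k <;> first
      | exact absurd rfl hj
      | exact absurd rfl hk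
      | exact bracket_self _
      | exact e1
      | exact e2
      | exact e3
      | exact sw _ _ e1
      | exact sw _ _ e2
      | exact sw _ _ e3
  · refine ⟨![0, symForm β (μ 0 2) (μ 0 3) • μ 0 1, symForm β (μ 0 1) (μ 0 3) • μ 0 2,
      symForm β (μ 0 1) (μ 0 2) • μ 0 3], isShift_of_six hμ ?_ ?_ ?_ ?_ ?_ ?_ ?_⟩
    · simp [bracket_smul_right, bracket_self]
    · simp [bracket_smul_right, bracket_self]
    · simp [bracket_smul_right, bracket_self]
    · simp [bracket, symForm] at h3 ⊢
      linear_combination (μ 0 1 0 * μ 0 2 1 - μ 0 1 1 * μ 0 2 0) * h3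
    · simp [bracket, symForm] at h2 ⊢
      linear_combination (μ 0 1 0 * μ 0 3 1 - μ 0 1 1 * μ 0 3 0) * h2
    · simp [bracket, symForm] at h1 ⊢
      linear_combination (μ 0 2 0 * μ 0 3 1 - μ 0 2 1 * μ 0 3 0) * h1
    · by_contra! hall
      refine hstar ⟨?_, ?_, ?_⟩
      · simpa [h0 0 1] using hall 1 0
      · simpa [h0 0 2] using hall 2 0
      · simpa [h0 0 3] using hall 3 0

end Shift

/-! ### Directions of the lines of a limit -/

section PencilNecessity

variable {K : Type*}

section Field

variable [Field K] {g : Fin 4 → (Fin 4 → K)} {m : Finset (Fin 4) → Fin 2 → K}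

/-- A family whose points are all equal and whose planes are all equal has coordinates with respect
to an adapted basis. -/
lemma exists_eq_pencilFamily {F : Family K} (hF : IsConfig Finset.univ F)
    (h1 : ∀ i, F {i} = F {0}) (h3 : ∀ i, F {i}ᶜ = F {0}ᶜ) :
    ∃ (g : Fin 4 → (Fin 4 → K)) (m : Finset (Fin 4) → Fin 2 → K), LinearIndependent K g ∧
      (∀ S : Finset (Fin 4), S.card = 2 → m S ≠ 0) ∧ F {0} = Submodule.span K {g 2} ∧
      F {0}ᶜ = Submodule.span K {g 0, g 1, g 2} ∧
      (∀ S : Finset (Fin 4), S.card = 2 → F S = pencilLine g (m S)) ∧ F = pencilFamily g 0 m := by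
  obtain ⟨e, he0, he⟩ := hF.exists_vec (Finset.mem_univ 0)
  obtain ⟨y, hy, hye⟩ := hF.exists_notMem (Finset.subset_univ {0, 1})
    (U := F {0}) (by rw [hF.rank]; decide)
  obtain ⟨z, hz, hzy⟩ := hF.exists_notMem (Finset.subset_univ {0, 1, 2})
    (U := F {0, 1}) (by rw [hF.rank]; decide)
  obtain ⟨w, -, hw⟩ := hF.exists_notMem (Finset.subset_univ Finset.univ)
    (U := F {0, 1, 2}) (by rw [hF.rank]; decide)
  have e01 : F {0, 1} = Submodule.span K {e} ⊔ Submodule.span K {y} := by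
    refine (hF.eq_of_le (Finset.subset_univ _) (sup_le (he ▸ hF.mono' (by decide))
      ((Submodule.span_singleton_le_iff_mem _ _).mpr hy)) ?_).symm
    rw [Submodule.finrank_sup_span_singleton (he ▸ hye), finrank_span_singleton he0]
    rfl
  have e012 : F {0, 1, 2} = Submodule.span K {y, z, e} := by
    have h : Submodule.span K {y, z, e} = F {0, 1} ⊔ Submodule.span K {z} := by
      rw [e01, ← Submodule.span_union, ← Submodule.span_union]
      congr 1
      ext u; simp; tauto
    rw [h]
    refine (hF.eq_of_le (Finset.subset_univ _) (sup_le (hF.mono' (by decide))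
      ((Submodule.span_singleton_le_iff_mem _ _).mpr hz)) ?_).symm
    rw [Submodule.finrank_sup_span_singleton hzy, hF.rank]
    rfl
  let g : Fin 4 → (Fin 4 → K) := ![y, z, e, w]
  have hg : LinearIndependent K g := by
    refine linearIndependent_of_top_le_span_of_card_eq_finrank ?_ (by simp)
    refine (hF.top_le_span (by decide) e012 hw).trans (Submodule.span_mono ?_)
    rintro u (rfl | rfl | rfl | rfl)
    exacts [⟨0, rfl⟩, ⟨1, rfl⟩, ⟨2, rfl⟩, ⟨3, rfl⟩]
  have hpl : F {0}ᶜ = Submodule.span K {g 0, g 1, g 2} := by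
    rw [← h3 3]
    exact e012
  have key : ∀ S : Finset (Fin 4), S.card = 2 → (∃ i, {i} ⊆ S) ∧ ∃ i : Fin 4, S ⊆ {i}ᶜ := by decide
  have hex : ∀ S : Finset (Fin 4), ∃ a, S.card = 2 → a ≠ 0 ∧ F S = pencilLine g a := by
    intro S
    by_cases hS : S.card = 2
    · obtain ⟨⟨i, hi⟩, j, hj⟩ := key S hS
      obtain ⟨a, ha⟩ := exists_eq_pencilLine hg (l := F S) (by rw [hF.rank, hS])
        (hF.mono' hi (by rw [h1, he]; exact Submodule.mem_span_singleton_self _))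
        (by rw [← hpl, ← h3 j]; exact hF.mono' hj)
      exact ⟨a, fun _ => ha⟩
    · exact ⟨0, fun h => absurd h hS⟩
  choose m hm using hex
  exact ⟨g, m, hg, fun S hS => (hm S hS).1, he, hpl, fun S hS => (hm S hS).2,
    eq_pencilFamily hF (fun i => (h1 i).trans he) (fun S hS => (hm S hS).2)
      (fun i => by rw [h3, hpl]) fun S hS => (hm S hS).1⟩

/-- The minors of two frames of a plane are proportional. -/
lemma exists_minor_eq {E : Type*} [AddCommGroup E] [Module K E] {w : Fin 2 → E}
    (hw : LinearIndependent K w) {y z : E}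
    (h : Submodule.span K (Set.range w) ≤ Submodule.span K {y, z}) :
    ∃ r : K, r ≠ 0 ∧ ∀ α β : E →ₗ[K] K, α (w 0) * β (w 1) - α (w 1) * β (w 0) =
      r * (α y * β z - α z * β y) := by
  obtain ⟨a, b, hab⟩ := Submodule.mem_span_pair.mp (h (Submodule.subset_span ⟨0, rfl⟩))
  obtain ⟨c, d, hcd⟩ := Submodule.mem_span_pair.mp (h (Submodule.subset_span ⟨1, rfl⟩))
  refine ⟨a * d - b * c, fun h0 => ?_, fun α β => ?_⟩
  · have hp := LinearIndependent.pair_iff.mp (by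
      rwa [show w = ![w 0, w 1] from by ext i; fin_cases i <;> rfl] at hw :
        LinearIndependent K ![w 0, w 1])
    have h1 := hp d (-b) (by
      rw [← hab, ← hcd]
      calc _ = (a * d - b * c) • y := by module
        _ = 0 := by rw [h0, zero_smul])
    have h2 := hp (-c) a (by
      rw [← hab, ← hcd]
      calc _ = (a * d - b * c) • z := by module
        _ = 0 := by rw [h0, zero_smul])
    refine hw.ne_zero 0 ?_
    rw [← hab, h2.2, neg_eq_zero.mp h1.2, zero_smul, zero_smul, add_zero]
  · rw [← hab, ← hcd]
    simp only [map_add, map_smul, smul_eq_mul]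
    ring

/-- The coefficients of the product of two linear forms in two variables. -/
def quadCoeff (x y : Fin 2 → K) : Fin 3 → K := ![x 0 * y 0, x 0 * y 1 + x 1 * y 0, x 1 * y 1]

/-- The determinant of the coefficients of the products of `x i` and `y i`, as linear forms; it
vanishes if and only if `x i` and `y i` are orthogonal, for all `i`, with respect to some nonzero
symmetric bilinear form. -/
def involutionDet (x y : Fin 3 → Fin 2 → K) : K :=
  (Matrix.of fun i => quadCoeff (x i) (y i)).det

/-- The three-term Plücker relation: a linear relation between the products of opposite minors. -/
lemma involutionDet_minors (a : Fin 4 → K) (P : Fin 4 → Fin 2 → K) {r : Fin 3 → K}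
    {s : Fin 3 → K} (hr : ∀ i, r i ≠ 0) (hs : ∀ i, s i ≠ 0) :
    involutionDet (![r 0 • (a 0 • P 1 - a 1 • P 0), r 1 • (a 0 • P 2 - a 2 • P 0),
        r 2 • (a 0 • P 3 - a 3 • P 0)])
      (![s 0 • (a 2 • P 3 - a 3 • P 2), s 1 • (a 1 • P 3 - a 3 • P 1),
        s 2 • (a 1 • P 2 - a 2 • P 1)]) = 0 := by
  refine Matrix.exists_vecMul_eq_zero_iff.mp
    ⟨![(r 0 * s 0)⁻¹, -(r 1 * s 1)⁻¹, (r 2 * s 2)⁻¹], fun h => ?_, ?_⟩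
  · exact inv_ne_zero (mul_ne_zero (hr 0) (hs 0)) (congrFun h 0)
  · have h0 := hr 0
    have h1 := hr 1
    have h2 := hr 2
    have h0' := hs 0
    have h1' := hs 1
    have h2' := hs 2
    ext k
    fin_cases k <;> simp [Matrix.vecMul, dotProduct, Fin.sum_univ_three, quadCoeff] <;>
      field_simp <;> ring

lemma exists_symForm_of_involutionDet {x y : Fin 3 → Fin 2 → K} (h : involutionDet x y = 0) :
    ∃ β : Fin 3 → K, β ≠ 0 ∧ ∀ i, symForm β (x i) (y i) = 0 := by
  obtain ⟨β, hβ, h0⟩ := Matrix.exists_mulVec_eq_zero_iff.mpr h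
  refine ⟨β, hβ, fun i => ?_⟩
  refine Eq.trans ?_ (congrFun h0 i)
  simp [Matrix.mulVec, dotProduct, Fin.sum_univ_three, quadCoeff, symForm]
  ring

end Field

variable [NontriviallyNormedField K] [CompleteSpace K] {g : Fin 4 → (Fin 4 → K)}
  {m : Finset (Fin 4) → Fin 2 → K}

/-- In a limit of apartments with a common point and a common plane, opposite lines are orthogonal
for some nonzero symmetric bilinear form: by a Plücker relation, this holds for the projection of
an apartment to the plane, seen from the point. -/
theorem exists_symForm_of_mem_closure (hg : LinearIndependent K g)
    (hm : ∀ S : Finset (Fin 4), S.card = 2 → m S ≠ 0)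
    (h : pencilFamily g 0 m ∈ closure (frameFamilies K Finset.univ)) :
    ∃ β : Fin 3 → K, β ≠ 0 ∧ symForm β (m {0, 1}) (m {2, 3}) = 0 ∧
      symForm β (m {0, 2}) (m {1, 3}) = 0 ∧ symForm β (m {0, 3}) (m {1, 2}) = 0 := by
  let B : Basis (Fin 4) K (Fin 4 → K) := basisOfLinearIndependentOfCardEqFinrank hg (by simp)
  have hB : ∀ i, B i = g i := fun i => by simp [B]
  have hc : ∀ i j, B.coord i (g j) = if j = i then 1 else 0 := fun i j => by
    rw [← hB]; simp [Finsupp.single_apply]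
  let M : (Fin 2 → (Fin 4 → K)) → Fin 2 → K := fun w =>
    ![B.coord 2 (w 0) * B.coord 0 (w 1) - B.coord 2 (w 1) * B.coord 0 (w 0),
      B.coord 2 (w 0) * B.coord 1 (w 1) - B.coord 2 (w 1) * B.coord 1 (w 0)]
  have hMc : ∀ a : Pair, Continuous fun w : Pair → Fin 2 → (Fin 4 → K) => M (w a) := by
    intro a
    have hcc : ∀ i, Continuous (B.coord i) := fun i => LinearMap.continuous_of_finiteDimensional _
    have hci : ∀ i j, Continuous fun w : Pair → Fin 2 → (Fin 4 → K) => B.coord i (w a j) :=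
      fun i j => (hcc i).comp (by fun_prop)
    refine continuous_pi fun i => ?_
    fin_cases i
    · exact ((hci 2 0).mul (hci 0 1)).sub ((hci 2 1).mul (hci 0 0))
    · exact ((hci 2 0).mul (hci 1 1)).sub ((hci 2 1).mul (hci 1 0))
  let x : (Pair → Fin 2 → (Fin 4 → K)) → Fin 3 → Fin 2 → K := fun w =>
    ![M (w ⟨{0, 1}, by decide⟩), M (w ⟨{0, 2}, by decide⟩), M (w ⟨{0, 3}, by decide⟩)]
  let y : (Pair → Fin 2 → (Fin 4 → K)) → Fin 3 → Fin 2 → K := fun w =>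
    ![M (w ⟨{2, 3}, by decide⟩), M (w ⟨{1, 3}, by decide⟩), M (w ⟨{1, 2}, by decide⟩)]
  have hx : Continuous x := by
    refine continuous_pi fun i => ?_
    fin_cases i
    exacts [hMc _, hMc _, hMc _]
  have hy : Continuous y := by
    refine continuous_pi fun i => ?_
    fin_cases i
    exacts [hMc _, hMc _, hMc _]
  have hΦ : Continuous fun w => involutionDet (x w) (y w) := by
    have h1 : ∀ i j, Continuous fun w => x w i j := fun i j =>
      (continuous_apply j).comp ((continuous_apply i).comp hx)
    have h2 : ∀ i j, Continuous fun w => y w i j := fun i j =>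
      (continuous_apply j).comp ((continuous_apply i).comp hy)
    refine Continuous.matrix_det (continuous_matrix fun i k => ?_)
    fin_cases k
    · exact (h1 i 0).mul (h2 i 0)
    · exact ((h1 i 0).mul (h2 i 1)).add ((h1 i 1).mul (h2 i 0))
    · exact (h1 i 1).mul (h2 i 1)
  let u : Pair → Fin 2 → (Fin 4 → K) := fun a => ![g 2, lineVec g (m a.1)]
  have hur : ∀ a, Submodule.span K (Set.range (u a)) = pencilLine g (m a.1) := fun a => by
    simp only [u, Matrix.range_cons, Matrix.range_empty, Set.union_empty]; rfl
  have hul : ∀ a, LinearIndependent K (u a) := fun a => by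
    rw [linearIndependent_iff_card_eq_finrank_span, Set.finrank, hur,
      finrank_pencilLine hg (hm _ a.2), Fintype.card_fin]
  have hcl := frames_mem_closure h (fun (a : Pair) G => G a.1) (fun a => continuous_apply _) u hul
    (fun a => by
      obtain ⟨i, j, hij, ha⟩ := exists_pair_eq a.1 a.2
      have e : lineVec g 0 = 0 := by simp [lineVec]
      rw [hur, ha, pencilFamily_pair hm (by simp [bracket]) hij, Pi.zero_apply, e, add_zero,
        pencilLine_eq_sup])
  have hzero : involutionDet (x u) (y u) = 0 := by
    refine (closure_minimal ?_ (isClosed_singleton.preimage hΦ) hcl :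
      u ∈ (fun w => involutionDet (x w) (y w)) ⁻¹' {0})
    rintro w ⟨hw, G, ⟨c, hc, hG⟩, hwG⟩
    have hmin : ∀ (a : Pair) (i j : Fin 4), a.1 = {i, j} → ∃ r : K, r ≠ 0 ∧ M (w a) =
        r • (B.coord 2 (c i) • ![B.coord 0 (c j), B.coord 1 (c j)] -
          B.coord 2 (c j) • ![B.coord 0 (c i), B.coord 1 (c i)]) := by
      intro a i j ha
      obtain ⟨r, hr, h⟩ := exists_minor_eq (hw a) (y := c i) (z := c j) (by
        rw [hwG a, hG _ (Finset.subset_univ _), ha, Finset.coe_pair, Set.image_pair])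
      refine ⟨r, hr, ?_⟩
      ext k
      fin_cases k
      · exact h (B.coord 2) (B.coord 0)
      · exact h (B.coord 2) (B.coord 1)
    obtain ⟨r0, hr0, e01⟩ := hmin ⟨{0, 1}, by decide⟩ 0 1 rfl
    obtain ⟨r1, hr1, e02⟩ := hmin ⟨{0, 2}, by decide⟩ 0 2 rfl
    obtain ⟨r2, hr2, e03⟩ := hmin ⟨{0, 3}, by decide⟩ 0 3 rfl
    obtain ⟨s0, hs0, e23⟩ := hmin ⟨{2, 3}, by decide⟩ 2 3 rfl
    obtain ⟨s1, hs1, e13⟩ := hmin ⟨{1, 3}, by decide⟩ 1 3 rfl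
    obtain ⟨s2, hs2, e12⟩ := hmin ⟨{1, 2}, by decide⟩ 1 2 rfl
    simp only [Set.mem_preimage, Set.mem_singleton_iff, x, y, e01, e02, e03, e23, e13, e12]
    exact involutionDet_minors (fun i => B.coord 2 (c i))
      (fun i => ![B.coord 0 (c i), B.coord 1 (c i)]) (r := ![r0, r1, r2]) (s := ![s0, s1, s2])
      (by intro i; fin_cases i; exacts [hr0, hr1, hr2])
      (by intro i; fin_cases i; exacts [hs0, hs1, hs2])
  have hMu : ∀ a, M (u a) = m a.1 := by
    intro a
    ext i
    fin_cases i <;> simp [M, u, lineVec, hc, -Basis.coord_apply]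
  simp only [x, y, hMu] at hzero
  obtain ⟨β, hβ, h0⟩ := exists_symForm_of_involutionDet hzero
  exact ⟨β, hβ, h0 0, h0 1, h0 2⟩

end PencilNecessity

/-! ### Morphisms of type (XP) -/

section TypeXP

section Field

variable {K : Type*} [Field K] {g : Fin 4 → (Fin 4 → K)}

lemma bracket_mulSymForm (β : Fin 3 → K) (u v : Fin 2 → K) :
    bracket ![β 1 * u 0 + β 2 * u 1, -(β 0 * u 0 + β 1 * u 1)] v = symForm β u v := by
  simp [bracket, symForm]; ring

/-- A degenerate symmetric bilinear form is a multiple of the square of a linear form. -/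
lemma exists_bracket_of_symForm {β : Fin 3 → K} (hβ : β ≠ 0) (hd : β 0 * β 2 - β 1 * β 1 = 0) :
    ∃ k : Fin 2 → K, k ≠ 0 ∧ ∀ u v, symForm β u v = 0 → bracket k u = 0 ∨ bracket k v = 0 := by
  by_cases h0 : β 0 = 0
  · have h1 : β 1 = 0 := by
      rw [h0, zero_mul, zero_sub, neg_eq_zero] at hd
      exact mul_self_eq_zero.mp hd
    have h2 : β 2 ≠ 0 := fun h2 => hβ (by ext i; fin_cases i; exacts [h0, h1, h2])
    refine ⟨![1, 0], fun h => one_ne_zero (congrFun h 0), fun u v h => ?_⟩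
    simpa [symForm, h0, h1, h2, bracket] using h
  · refine ⟨![β 1, -β 0], fun h => h0 (neg_eq_zero.mp (congrFun h 1)), fun u v h => ?_⟩
    refine mul_eq_zero.mp ?_
    simp only [symForm] at h
    simp only [bracket, Matrix.cons_val_zero, Matrix.cons_val_one]
    linear_combination β 0 * h - u 1 * v 1 * hd

lemma exists_eq_smul_add_lineVec {y : Fin 4 → K} (hy : y ∈ Submodule.span K {g 0, g 1, g 2}) :
    ∃ (r : K) (a : Fin 2 → K), y = r • g 2 + lineVec g a := by
  obtain ⟨r, z, hz, rfl⟩ := Submodule.mem_span_insert.mp hy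
  obtain ⟨s, t, rfl⟩ := Submodule.mem_span_pair.mp hz
  exact ⟨t, ![r, s], by simp [lineVec]; abel⟩

lemma pencilLine_mem_pencil (hg : LinearIndependent K g) {x p : Vertex K}
    (hx : x.carrier = Submodule.span K {g 2}) (hp : p.carrier = Submodule.span K {g 0, g 1, g 2})
    {a : Fin 2 → K} (ha : a ≠ 0) : pencilLine g a ∈ pencil x p := by
  refine ⟨finrank_pencilLine hg ha, ?_, ?_⟩
  · rw [hx, pencilLine_eq_sup]; exact le_sup_left
  · rw [hp, pencilLine]
    refine Submodule.span_le.mpr ?_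
    rintro z (rfl | rfl)
    exacts [Submodule.subset_span (by simp), lineVec_mem_plane _]

lemma mem_pencil_iff (hg : LinearIndependent K g) {x p : Vertex K}
    (hx : x.carrier = Submodule.span K {g 2}) (hp : p.carrier = Submodule.span K {g 0, g 1, g 2})
    {l : Submodule K (Fin 4 → K)} : l ∈ pencil x p ↔ ∃ a, a ≠ 0 ∧ l = pencilLine g a := by
  constructor
  · rintro ⟨h2, hxl, hlp⟩
    refine exists_eq_pencilLine hg h2 (hxl ?_) (hlp.trans hp.le)
    rw [hx]; exact Submodule.mem_span_singleton_self _
  · rintro ⟨a, ha, rfl⟩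
    exact pencilLine_mem_pencil hg hx hp ha

/-- A nondegenerate symmetric bilinear form on `K²` yields an involution of the pencil: a line is
mapped to the orthogonal one. -/
lemma exists_inducesInvolution (hg : LinearIndependent K g) {x p : Vertex K}
    (hx : x.carrier = Submodule.span K {g 2}) (hp : p.carrier = Submodule.span K {g 0, g 1, g 2})
    {β : Fin 3 → K} (hβ : β 0 * β 2 - β 1 * β 1 ≠ 0) :
    ∃ e : (Fin 4 → K) ≃ₗ[K] (Fin 4 → K), InducesInvolution x p e ∧
      ∀ a c : Fin 2 → K, a ≠ 0 → c ≠ 0 → symForm β a c = 0 →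
        (pencilLine g a).map e.toLinearMap = pencilLine g c := by
  let G : (Fin 2 → K) → Fin 2 → K := fun u => ![β 1 * u 0 + β 2 * u 1, -(β 0 * u 0 + β 1 * u 1)]
  have hGG : ∀ u, G (G u) = (-(β 0 * β 2 - β 1 * β 1)) • u := fun u => by
    ext i
    fin_cases i <;> simp [G] <;> ring
  have hG0 : ∀ u, u ≠ 0 → G u ≠ 0 := fun u hu h => by
    have h1 := hGG u
    rw [h] at h1
    exact smul_ne_zero (neg_ne_zero.mpr hβ) hu (by rw [← h1]; ext i; fin_cases i <;> simp [G])
  let g' : Fin 4 → (Fin 4 → K) := ![lineVec g (G ![1, 0]), lineVec g (G ![0, 1]), g 2, g 3]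
  have hg'a : ∀ a : Fin 4 → K, ∑ i, a i • g' i =
      ∑ i, ![G ![a 0, a 1] 0, G ![a 0, a 1] 1, a 2, a 3] i • g i := fun a => by
    simp [Fin.sum_univ_four, g', lineVec, G]
    module
  have hg' : LinearIndependent K g' := by
    rw [Fintype.linearIndependent_iff]
    intro a ha
    rw [hg'a] at ha
    have h := Fintype.linearIndependent_iff.mp hg _ ha
    have h01 : (![a 0, a 1] : Fin 2 → K) = 0 := by
      by_contra h0
      refine hG0 _ h0 ?_
      ext i; fin_cases i
      exacts [h 0, h 1]
    intro i
    fin_cases i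
    exacts [congrFun h01 0, congrFun h01 1, h 2, h 3]
  let B : Basis (Fin 4) K (Fin 4 → K) := basisOfLinearIndependentOfCardEqFinrank hg (by simp)
  let B' : Basis (Fin 4) K (Fin 4 → K) := basisOfLinearIndependentOfCardEqFinrank hg' (by simp)
  let e : (Fin 4 → K) ≃ₗ[K] (Fin 4 → K) := B.equiv B' (Equiv.refl _)
  have he : ∀ i, e (g i) = g' i := fun i => by
    have := B.equiv_apply i B' (Equiv.refl _)
    simpa [B, B'] using this
  have hea : ∀ a, e (lineVec g a) = lineVec g (G a) := fun a => by
    rw [lineVec, map_add, map_smul, map_smul, he, he]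
    simp [g', lineVec, G]
    module
  have hmap : ∀ a, (pencilLine g a).map e.toLinearMap = pencilLine g (G a) := fun a => by
    rw [pencilLine, Submodule.map_span, Set.image_pair, pencilLine]
    simp only [LinearEquiv.coe_coe, hea, he]
    rfl
  have hpen := @mem_pencil_iff K _ g hg x p hx hp
  refine ⟨e, ⟨fun l hl => ?_, fun l hl => ?_, fun h2 => ?_⟩, fun a c ha hc h => ?_⟩
  · obtain ⟨a, ha, rfl⟩ := hpen.mp hl
    rw [hmap]
    exact hpen.mpr ⟨_, hG0 a ha, rfl⟩
  · obtain ⟨a, ha, rfl⟩ := hpen.mp hl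
    rw [hmap, hmap, pencilLine_eq_iff hg (hG0 _ (hG0 a ha)) ha, hGG, bracket_smul_left,
      bracket_self, mul_zero]
  · by_contra! hall
    have hq : ∀ a, symForm β a a = 0 := fun a => by
      by_cases ha : a = 0
      · simp [ha, symForm]
      · have := hall _ (hpen.mpr ⟨a, ha, rfl⟩)
        rw [hmap, pencilLine_eq_iff hg (hG0 a ha) ha, bracket_mulSymForm] at this
        exact this
    have q0 : β 0 = 0 := by simpa [symForm] using hq ![1, 0]
    have q2 : β 2 = 0 := by simpa [symForm] using hq ![0, 1]
    have q1 : β 1 = 0 := by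
      have := hq ![1, 1]
      simp only [symForm, q0, q2, Matrix.cons_val_zero, Matrix.cons_val_one] at this
      refine (mul_eq_zero.mp ?_).resolve_left h2
      linear_combination this
    exact hβ (by rw [q0, q1]; ring)
  · rw [hmap, pencilLine_eq_iff hg (hG0 a ha) hc, bracket_mulSymForm, h]

/-- An involution of the pencil is given by a nondegenerate symmetric bilinear form on `K²`: its
matrix has trace zero. -/
lemma exists_symForm_of_inducesInvolution (hg : LinearIndependent K g) {x p : Vertex K}
    (hx : x.carrier = Submodule.span K {g 2}) (hp : p.carrier = Submodule.span K {g 0, g 1, g 2})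
    {e : (Fin 4 → K) ≃ₗ[K] (Fin 4 → K)} (h : InducesInvolution x p e) :
    ∃ β : Fin 3 → K, β 0 * β 2 - β 1 * β 1 ≠ 0 ∧ ∀ a c : Fin 2 → K, a ≠ 0 → c ≠ 0 →
      (pencilLine g a).map e.toLinearMap = pencilLine g c → symForm β a c = 0 := by
  have hpen := @mem_pencil_iff K _ g hg x p hx hp
  have e0 : (![1, 0] : Fin 2 → K) ≠ 0 := fun h => one_ne_zero (congrFun h 0)
  have e1 : (![0, 1] : Fin 2 → K) ≠ 0 := fun h => one_ne_zero (congrFun h 1)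
  have hlv : ∀ a, lineVec g a ∈ pencilLine g a := fun a => Submodule.subset_span (by simp)
  have hg2 : ∀ a, g 2 ∈ pencilLine g a := fun a => Submodule.subset_span (by simp)
  -- the point of the pencil is the intersection of two of its lines, hence fixed
  obtain ⟨t, ht0, ht⟩ : ∃ t : K, t ≠ 0 ∧ e (g 2) = t • g 2 := by
    have hinf : pencilLine g ![1, 0] ⊓ pencilLine g ![0, 1] ≤ Submodule.span K {g 2} := by
      rintro z ⟨hz0, hz1⟩
      obtain ⟨r, s, rfl⟩ := Submodule.mem_span_pair.mp hz0
      rw [← lineVec_smul] at hz1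
      have := (smul_add_lineVec_mem_pencilLine_iff hg e1 _ _).mp hz1
      have hs : s = 0 := by simpa [bracket] using this
      rw [hs, zero_smul]
      simpa [lineVec] using Submodule.smul_mem _ r (Submodule.mem_span_singleton_self (g 2))
    have hmem : g 2 ∈ (pencilLine g ![1, 0] ⊓ pencilLine g ![0, 1]).map e.toLinearMap := by
      rw [Submodule.map_inf _ e.injective]
      refine ⟨?_, ?_⟩
      · obtain ⟨c, -, hc⟩ := hpen.mp (h.map_mem _ (hpen.mpr ⟨_, e0, rfl⟩))
        rw [hc]; exact hg2 c
      · obtain ⟨c, -, hc⟩ := hpen.mp (h.map_mem _ (hpen.mpr ⟨_, e1, rfl⟩))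
        rw [hc]; exact hg2 c
    obtain ⟨z, hz, hez⟩ := hmem
    obtain ⟨s, rfl⟩ := Submodule.mem_span_singleton.mp (hinf hz)
    have hez : e (s • g 2) = g 2 := hez
    rw [map_smul] at hez
    have hs : s ≠ 0 := by
      rintro rfl
      rw [zero_smul] at hez
      exact hg.ne_zero 2 hez.symm
    exact ⟨s⁻¹, inv_ne_zero hs, by rw [eq_inv_smul_iff₀ hs, hez]⟩
  -- images of vectors of the plane, in coordinates
  have hco : ∀ a, a ≠ 0 → ∃ (r : K) (c : Fin 2 → K), e (lineVec g a) = r • g 2 + lineVec g c := by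
    intro a ha
    refine exists_eq_smul_add_lineVec ?_
    rw [← hp]
    exact (h.map_mem _ (hpen.mpr ⟨a, ha, rfl⟩)).2.2 (Submodule.mem_map_of_mem (hlv a))
  obtain ⟨r₀, G₀, hG₀⟩ := hco _ e0
  obtain ⟨r₁, G₁, hG₁⟩ := hco _ e1
  let G : (Fin 2 → K) → Fin 2 → K := fun a => a 0 • G₀ + a 1 • G₁
  have hG : ∀ a, ∃ r : K, e (lineVec g a) = r • g 2 + lineVec g (G a) := by
    intro a
    refine ⟨a 0 * r₀ + a 1 * r₁, ?_⟩
    have : lineVec g a = a 0 • lineVec g ![1, 0] + a 1 • lineVec g ![0, 1] := by simp [lineVec]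
    rw [this, map_add, map_smul, map_smul, hG₀, hG₁, lineVec_add, lineVec_smul, lineVec_smul]
    module
  have hbr : ∀ a c, a ≠ 0 → c ≠ 0 → (pencilLine g a).map e.toLinearMap = pencilLine g c →
      bracket c (G a) = 0 := by
    intro a c ha hc hac
    obtain ⟨r, hr⟩ := hG a
    rw [← smul_add_lineVec_mem_pencilLine_iff hg hc r, ← hr, ← hac]
    exact Submodule.mem_map_of_mem (hlv a)
  have hG0 : ∀ a, G a = 0 → a = 0 := by
    intro a ha
    obtain ⟨r, hr⟩ := hG a
    have : e (lineVec g a + (-(r * t⁻¹)) • g 2) = 0 := by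
      rw [map_add, map_smul, hr, ht, ha, smul_smul, neg_mul, inv_mul_cancel_right₀ ht0]
      simp [lineVec]
    exact (eq_zero_of_lineVec_add_smul hg ((map_eq_zero_iff e e.injective).mp this)).1
  have hGG : ∀ a, bracket a (G (G a)) = 0 := by
    intro a
    by_cases ha : a = 0
    · simp [ha, bracket]
    obtain ⟨r, hr⟩ := hG a
    obtain ⟨s, hs⟩ := hG (G a)
    have hmem : e (e (lineVec g a)) ∈ pencilLine g a := by
      rw [← h.map_map _ (hpen.mpr ⟨a, ha, rfl⟩)]
      exact Submodule.mem_map_of_mem (Submodule.mem_map_of_mem (hlv a))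
    rw [hr, map_add, map_smul, ht, hs, smul_smul, ← add_assoc, ← add_smul] at hmem
    exact (smul_add_lineVec_mem_pencilLine_iff hg ha _ _).mp hmem
  have hid : (2 : K) ≠ 0 → ∃ a, bracket a (G a) ≠ 0 := by
    intro h2
    by_contra! hall
    obtain ⟨l, hl, hne⟩ := h.ne_id h2
    obtain ⟨a, ha, rfl⟩ := hpen.mp hl
    obtain ⟨c, hc, hac⟩ := hpen.mp (h.map_mem _ hl)
    refine hne (hac.trans ((pencilLine_eq_iff hg hc ha).mpr ?_))
    have h1 := hbr a c ha hc hac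
    have hGa : G a ≠ 0 := fun h0 => ha (hG0 a h0)
    obtain ⟨s, hs, hs'⟩ := exists_smul_of_bracket_eq_zero hc hGa h1
    have h3 := hall a
    rw [hs', bracket_smul_right] at h3
    rw [bracket_comm, (mul_eq_zero.mp h3).resolve_left hs, neg_zero]
  have hGi : ∀ a, G a = ![G₀ 0 * a 0 + G₁ 0 * a 1, G₀ 1 * a 0 + G₁ 1 * a 1] := fun a => by
    ext i
    fin_cases i <;> simp [G] <;> ring
  have htr : ∀ a, (G₀ 0 + G₁ 1) * bracket a (G a) = 0 := fun a => by
    rw [← hGG a]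
    simp [hGi, bracket]
    ring
  have htr0 : G₀ 0 + G₁ 1 = 0 := by
    by_contra hne
    have hall : ∀ a, bracket a (G a) = 0 := fun a => (mul_eq_zero.mp (htr a)).resolve_left hne
    by_cases h2 : (2 : K) = 0
    · have q0 : G₀ 1 = 0 := by simpa [hGi, bracket] using hall ![1, 0]
      have q1 : G₁ 0 = 0 := by simpa [hGi, bracket] using hall ![0, 1]
      have q2 := hall ![1, 1]
      simp [hGi, bracket, q0, q1] at q2
      exact hne (by linear_combination q2 + G₀ 0 * h2)
    · obtain ⟨a, ha⟩ := hid h2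
      exact ha (hall a)
  refine ⟨![G₀ 1, -G₀ 0, -G₁ 0], fun hd => ?_, fun a c ha hc hac => ?_⟩
  · have hd' : G₀ 0 * G₁ 1 - G₁ 0 * G₀ 1 = 0 := by
      simp at hd
      linear_combination hd + G₀ 0 * htr0
    have k1 := hG0 ![G₁ 0, -G₀ 0] (by
      rw [hGi]; ext i; fin_cases i
      · simp; ring
      · simp; linear_combination -hd')
    have k2 := hG0 ![G₁ 1, -G₀ 1] (by
      rw [hGi]; ext i; fin_cases i
      · simp; linear_combination hd'
      · simp; ring)
    refine e0 (hG0 _ ?_)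
    rw [hGi]
    ext i
    fin_cases i
    · simpa using congrFun k1 1
    · simpa using congrFun k2 1
  · have := hbr a c ha hc hac
    rw [hGi] at this
    simp only [bracket, Matrix.cons_val_zero, Matrix.cons_val_one] at this
    simp only [symForm, Matrix.cons_val]
    linear_combination this - a 1 * c 0 * htr0

/-- Three distinct pairwise intersecting pairs form a star or a triangle. -/
lemma star_or_triangle : ∀ S₁ S₂ S₃ : Finset (Fin 4), S₁.card = 2 → S₂.card = 2 → S₃.card = 2 →
    S₁ ≠ S₂ → S₂ ≠ S₃ → S₁ ≠ S₃ → (S₁ ∩ S₂).Nonempty → (S₂ ∩ S₃).Nonempty → (S₁ ∩ S₃).Nonempty →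
    (∃ i, ∀ j, j ≠ i → {i, j} = S₁ ∨ {i, j} = S₂ ∨ {i, j} = S₃) ∨
    ∃ i j k : Fin 4, i ≠ j ∧ i ≠ k ∧ j ≠ k ∧ S₁ = {i, j} ∧ S₂ = {i, k} ∧ S₃ = {j, k} := by
  decide

lemma opposite_pairs : ∀ S : Finset (Fin 4), S.card = 2 →
    (S = {0, 1} ∧ Sᶜ = {2, 3}) ∨ (S = {0, 2} ∧ Sᶜ = {1, 3}) ∨ (S = {0, 3} ∧ Sᶜ = {1, 2}) ∨
    (S = {2, 3} ∧ Sᶜ = {0, 1}) ∨ (S = {1, 3} ∧ Sᶜ = {0, 2}) ∨ (S = {1, 2} ∧ Sᶜ = {0, 3}) := by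
  decide

end Field

variable {K : Type*} [NontriviallyNormedField K] [CompleteSpace K]
  {b : Basis (Fin 4) K (Fin 4 → K)} {f : Mor (apartment b)}

/-- In a limit of apartments, opposite lines are orthogonal for a nonzero symmetric bilinear form. A
nondegenerate form is an involution that exchanges them. A degenerate one is a multiple of the
square of a linear form, which then vanishes on a line of each opposite pair: three equal lines with
pairwise intersecting labels. Conversely, the symmetry provides points joined by lines in the given
directions, which can be shrunk to the common point. -/
theorem Mor.mem_closure_iff_isSymmetricXP (hXP : f.IsTypeXP) :
    f ∈ closure {h : Mor (apartment b) | h.IsMarkedApartment} ↔ f.IsSymmetricXP := by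
  rw [mem_closure_marked_iff]
  obtain ⟨x, p, hxp⟩ := hXP
  have h1 : ∀ i, f.family {i} = f.family {0} := fun i => by
    rw [f.family_singleton, f.family_singleton, (hxp i).1, (hxp 0).1]
  have h3 : ∀ i, f.family {i}ᶜ = f.family {0}ᶜ := fun i => by
    rw [f.family_compl, f.family_compl, (hxp i).2, (hxp 0).2]
  obtain ⟨g, m, hg, hm, hx, hp, hl, e⟩ := exists_eq_pencilFamily f.isConfig_family h1 h3
  have hla : ∀ a : Pair, (f.line a).carrier = pencilLine g (m a.1) := fun a => by
    rw [← f.family_pair, hl _ a.2]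
  rw [f.family_singleton, (hxp 0).1] at hx
  rw [f.family_compl, (hxp 0).2] at hp
  constructor
  · intro h
    obtain ⟨β, hβ, q1, q2, q3⟩ := exists_symForm_of_mem_closure hg hm (e ▸ h)
    by_cases hd : β 0 * β 2 - β 1 * β 1 = 0
    · obtain ⟨k, hk, hkb⟩ := exists_bracket_of_symForm hβ hd
      have hkl : ∀ a : Pair, bracket k (m a.1) = 0 → (f.line a).carrier = pencilLine g k :=
        fun a ha => by rw [hla, eq_comm, pencilLine_eq_iff hg hk (hm _ a.2), ha]
      have three : ∀ a₁ a₂ a₃ : Pair, bracket k (m a₁.1) = 0 → bracket k (m a₂.1) = 0 →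
          bracket k (m a₃.1) = 0 → a₁ ≠ a₂ ∧ a₂ ≠ a₃ ∧ a₁ ≠ a₃ ∧ (a₁.1 ∩ a₂.1).Nonempty ∧
          (a₂.1 ∩ a₃.1).Nonempty ∧ (a₁.1 ∩ a₃.1).Nonempty → f.IsSymmetricXP := by
        rintro a₁ a₂ a₃ k1 k2 k3 ⟨n1, n2, n3, i1, i2, i3⟩
        exact Or.inl ⟨a₁, a₂, a₃, n1, n2, n3, i1, i2, i3,
          Vertex.ext ((hkl _ k1).trans (hkl _ k2).symm),
          Vertex.ext ((hkl _ k2).trans (hkl _ k3).symm)⟩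
      rcases hkb _ _ q1 with k1 | k1 <;> rcases hkb _ _ q2 with k2 | k2 <;>
        rcases hkb _ _ q3 with k3 | k3 <;>
        exact three ⟨_, by decide⟩ ⟨_, by decide⟩ ⟨_, by decide⟩ k1 k2 k3 (by decide)
    · obtain ⟨φ, hφ, hφl⟩ := exists_inducesInvolution hg hx hp hd
      refine Or.inr ⟨x, p, hxp, φ, hφ, fun a => ?_⟩
      rw [hla, hla]
      refine hφl _ _ (hm _ a.2) (hm _ a.compl.2) ?_
      change symForm β (m a.1) (m a.1ᶜ) = 0
      rcases opposite_pairs a.1 a.2 with ⟨h, h'⟩ | ⟨h, h'⟩ | ⟨h, h'⟩ | ⟨h, h'⟩ | ⟨h, h'⟩ | ⟨h, h'⟩ <;>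
        rw [h', h]
      exacts [q1, q2, q3, symForm_comm β _ _ ▸ q1, symForm_comm β _ _ ▸ q2, symForm_comm β _ _ ▸ q3]
  · intro h
    suffices hQ : ∃ Q, IsShift (fun i j => m {i, j}) Q by
      obtain ⟨Q, hQ, hne⟩ := hQ
      rw [e]
      exact pencilFamily_mem_closure hg hm hQ hne
    have hμ : ∀ i j : Fin 4, m {i, j} = m {j, i} := fun i j => by rw [Finset.pair_comm]
    have hm0 : ∀ i j : Fin 4, i ≠ j → m {i, j} ≠ 0 := fun i j hij => hm _ (Finset.card_pair hij)
    rcases h with ⟨a₁, a₂, a₃, n1, n2, n3, i1, i2, i3, l1, l2⟩ | ⟨x', p', hxp', φ, hφ, hφl⟩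
    · have hbr : ∀ a c : Pair, f.line a = f.line c → bracket (m a.1) (m c.1) = 0 := fun a c h => by
        rw [← pencilLine_eq_iff hg (hm _ a.2) (hm _ c.2), ← hla, ← hla, h]
      rcases star_or_triangle a₁.1 a₂.1 a₃.1 a₁.2 a₂.2 a₃.2 (Subtype.coe_injective.ne n1)
        (Subtype.coe_injective.ne n2) (Subtype.coe_injective.ne n3) i1 i2 i3 with
        ⟨i, hi⟩ | ⟨i, j, k, hij, hik, hjk, e1, e2, e3⟩
      · have hall : ∀ j, ∀ hj : j ≠ i, f.line ⟨{i, j}, Finset.card_pair hj.symm⟩ = f.line a₁ := by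
          intro j hj
          rcases hi j hj with h | h | h
          · exact congrArg f.line (Subtype.ext h)
          · exact (congrArg f.line (Subtype.ext h)).trans l1.symm
          · exact (congrArg f.line (Subtype.ext h)).trans (l1.trans l2).symm
        exact exists_isShift_of_star hμ hm0 fun j k hj hk =>
          hbr ⟨{i, j}, _⟩ ⟨{i, k}, _⟩ ((hall j hj).trans (hall k hk).symm)
      · refine exists_isShift_of_triangle hμ hm0 hij hik hjk ?_ ?_
        · rw [← e1, ← e2]; exact hbr _ _ l1
        · rw [← e1, ← e3]; exact hbr _ _ (l1.trans l2)
    · rw [show x' = x from (hxp' 0).1.symm.trans (hxp 0).1,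
        show p' = p from (hxp' 0).2.symm.trans (hxp 0).2] at hφ
      obtain ⟨β, hβ, hq⟩ := exists_symForm_of_inducesInvolution hg hx hp hφ
      have hs : ∀ a : Pair, symForm β (m a.1) (m a.1ᶜ) = 0 := fun a => by
        refine hq _ _ (hm _ a.2) (hm _ a.compl.2) ?_
        have := hφl a
        rw [hla, hla] at this
        exact this
      exact exists_isShift_of_symForm hμ hm0 hβ (hs ⟨{0, 1}, by decide⟩) (hs ⟨{0, 2}, by decide⟩)
        (hs ⟨{0, 3}, by decide⟩)

end TypeXP

end Building

/-! ### Limits of marked apartments -/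

theorem theorem16 {K : Type*} [NontriviallyNormedField K] [LocallyCompactSpace K]
    (b : Module.Basis (Fin 4) K (Fin 4 → K)) (f : Building.Mor (Building.apartment b)) :
    (¬ f.IsTypeL → ¬ f.IsTypeXP →
      f ∈ closure {h : Building.Mor (Building.apartment b) | h.IsMarkedApartment}) ∧
    (f.IsTypeL →
      (f ∈ closure {h : Building.Mor (Building.apartment b) | h.IsMarkedApartment} ↔
        f.IsSymmetricL)) ∧
    (f.IsTypeXP →
      (f ∈ closure {h : Building.Mor (Building.apartment b) | h.IsMarkedApartment} ↔
        f.IsSymmetricXP)) := by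
  -- local compactness is only used through completeness
  have : CompleteSpace K := by
    have := ProperSpace.of_locallyCompactSpace K (E := K)
    infer_instance
  refine ⟨fun hL hXP => ?_, Building.Mor.mem_closure_iff_isSymmetricL,
    Building.Mor.mem_closure_iff_isSymmetricXP⟩
  rw [Building.mem_closure_marked_iff]
  have hF := f.isConfig_family
  have hl : ∃ S S' : Finset (Fin 4), S.card = 2 ∧ S'.card = 2 ∧ f.family S ≠ f.family S' := by
    by_contra! hn
    exact hL (Building.Mor.isTypeL_iff.mpr hn)
  by_cases hx : ∀ i j, f.family {i} = f.family {j}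
  · refine Building.mem_closure_of_planes_ne hF ?_ hl
    by_contra! hp
    refine hXP ⟨f.point 0, f.plane 0, fun i => ⟨Building.Vertex.ext ?_, Building.Vertex.ext ?_⟩⟩
    · rw [← f.family_singleton, ← f.family_singleton, hx]
    · rw [← f.family_compl, ← f.family_compl, hp]
  · push Not at hx
    exact Building.mem_closure_of_points_ne hF hx hl
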